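/- **Setting.** Let $F$ be a finite rooted forest with $n\ge 1$ vertices. For a vertex $v$ let $st_1,\dots,st_k$ be the subtrees rooted in the children of $v$, $T_v$ the subtree rooted in $v$, and $\overline{T_v}$ the set of the vertices of the tree containing $v$ that are not in $T_v$. The betweenness centrality of $v$ is $$bc(v)=\sum_{s\ne t,\ s\ne v,\ t\ne v}\frac{\sigma_{st}(v)}{\sigma_{st}}$$ (sum over ordered pairs of vertices), where $\sigma_{st}$ is the number of shortest paths from $s$ to $t$ and $\sigma_{st}(v)$ the number of those passing through $v$; pairs in different trees contribute $0$. Let $P(v)$ be the number of unordered pairs $\{s,t\}$ of distinct vertices, both different from $v$, whose connecting path passes through $v$. Every vertex has the value $(1,1)$, $x\oplus y=(x_1+y_1,(x_1+y_1)^2)$, so that $(a,a^2)\oplus(b,b^2)=(a+b,(a+b)^2)$, and $\otimes$ is the vector sum; empty combinations are $(0,0)$. $\mathrm{rcs}(v)=\Sigma(c_1)\otimes\cdots\otimes\Sigma(c_k)$ (*reduce-child-subtrees*), where $c_1,\dots,c_k$ are the children of $v$ and $\Sigma(c)$ is the $\oplus$-combination of the values of the vertices in the subtree rooted in $c$. **DFT-Tree.**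 The depth first tour of a forest lists an open-node of every vertex when it is entered and a close-node when it is left; it is read as a sequence of parentheses. Such a sequence is uniquely a concatenation prefix–body–suffix, where the prefix ends where the depth first reaches its minimum (the starting depth $0$ being counted) and the body ends where it is last reached; the body is a sequence of complete subtrees. The *rcs-summary* of the sequence consists of the depth of the minimum, the $\oplus$-combinations of the values over prefix, body and suffix (each vertex counted at its open-node), the $\otimes$-combination of the $\Sigma$-values of the subtrees of the body, and the depth of the end relative to the minimum. A *DFT-Tree* (with balance constant $c$) for $F$ is a memory content as follows: the trees of $F$ are divided into groups, and for each group there is a binary search tree of height at most $c\log_2(N+1)$, with $N$ nodes, storing the depth first tour of the group in symmetric order. Each tour entry is a record with left, right, parent and twin pointers, an open/close tag, and the rcs-summary of the sequence in the search subtree below it; records may have further fields with arbitrary content. Programs run on a machine with finitely many integer registers in use; constants, additions, subtractions, multiplications, halvings, reading or writing one record field, and comparisons cost one step each. **Statement.** 1. For every finite rooted forest $F$ and every vertex $v$ of $F$, $$\mathrm{rcs}(v)=\Big(\sum_i|st_i|,\ \sum_i|st_i|^2\Big),\qquad 2P(v)=2\,|\overline{T_v}|\sum_i|st_i|+\Big(\big(\sum_i|st_i|\big)^2-\sum_i|st_i|^2\Big),\qquad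 bc(v)=2P(v).$$ 2. There is one fixed program, the betweenness query, such that for every $c$ there is a constant $C$ with the following property. For every rooted forest $F$ with $n$ vertices (hence for the current forest at any moment of the life of a dynamic forest), every DFT-Tree for $F$ with balance constant $c$ and every vertex $v$ of $F$, the program, started with the address of the open-node of $v$ (whatever the other registers contain), halts after at most $C\log(n+1)$ steps, leaves the DFT-Tree unchanged, and returns $\mathrm{rcs}(v)$, $|\overline{T_v}|$, $P(v)$ and $bc(v)$. 3. The stored summaries can be maintained locally: there is a program that, given a record whose left and right search subtrees have correct summaries in their roots, computes the correct summary of that record in a number of steps bounded by an absolute constant, changing only the summary fields of that record. -/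

import Mathlib

universe u

namespace DFTree

/-! ### Rooted forests and their depth first tours -/

/-- Finite ordered rooted forests with vertices named by elements of `V`:
`cons r c s` is the forest whose first tree has root `r`, the trees of `c` being the subtrees
rooted in the children of `r`, and whose other trees are those of `s`. -/
inductive Forest (V : Type u) : Type u
  | nil : Forest V
  | cons (root : V) (children : Forest V) (rest : Forest V) : Forest V

/-- An entry of the depth first tour: a vertex, with the tag `true` for its open-node and `false`
for its close-node. -/
abbrev Paren (V : Type u) : Type u := V × Bool

namespace Forest

variable {V : Type u}

/-- The vertices of a forest. -/
def labels : Forest V → List V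
  | nil => []
  | cons r c s => r :: (c.labels ++ s.labels)

/-- The roots of the trees of a forest. -/
def roots : Forest V → List V
  | nil => []
  | cons r _ s => r :: s.roots

/-- The vertex lists of the trees of a forest. -/
def treeLabels : Forest V → List (List V)
  | nil => []
  | cons r c s => (r :: c.labels) :: s.treeLabels

/-- Disjoint union of two forests. -/
def append : Forest V → Forest V → Forest V
  | nil, G => G
  | cons r c s, G => cons r c (s.append G)

/-- Disjoint union of a list of forests. -/
def join (Fs : List (Forest V)) : Forest V := Fs.foldr append nil

/-- The depth first tour: a vertex is entered, its children are visited, the vertex is left. -/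
def tour : Forest V → List (Paren V)
  | nil => []
  | cons r c s => (r, true) :: (c.tour ++ (r, false) :: s.tour)

/-- `F.IsChild u w`: the vertex `w` is a child of the vertex `u`. -/
def IsChild : Forest V → V → V → Prop
  | nil, _, _ => False
  | cons r c s, u, w => (u = r ∧ w ∈ c.roots) ∨ c.IsChild u w ∨ s.IsChild u w

/-- The underlying undirected graph. -/
def graph (F : Forest V) : SimpleGraph V := SimpleGraph.fromRel F.IsChild

/-- The forest formed by the subtrees rooted in the children of `v`
(empty if `v` is not a vertex). -/
def childForest [DecidableEq V] : Forest V → V → Forest V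
  | nil, _ => nil
  | cons r c s, v =>
      if v = r then c else if v ∈ c.labels then c.childForest v else s.childForest v

/-- The vertex lists of the subtrees `st₁, …, st_k` rooted in the children of `v`. -/
def childSubtrees [DecidableEq V] (F : Forest V) (v : V) : List (List V) :=
  (F.childForest v).treeLabels

/-- The vertex list of the subtree `T_v` rooted in `v`. -/
def subtree [DecidableEq V] (F : Forest V) (v : V) : List V := v :: (F.childForest v).labels

/-- The part of the tree containing `v` that lies outside the subtree rooted in `v`. -/
def above [DecidableEq V] (F : Forest V) (v : V) : Set V :=
  {u | u ∈ F.labels ∧ F.graph.Reachable v u ∧ u ∉ F.subtree v}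

/-- `Σ(c₁) ⊗ ⋯ ⊗ Σ(c_d)`, where `c₁, …, c_d` are the children of `v` and `Σ(x)` is the
`⊕`-combination of the values in the subtree rooted in `x`; `zero` and `one` are the values of the
empty `⊕`- and `⊗`-combinations. -/
def reduceChildSubtrees [DecidableEq V] {α : Type} (plus times : α → α → α) (zero one : α)
    (val : V → α) (F : Forest V) (v : V) : α :=
  ((F.childSubtrees v).map fun st => (st.map val).foldr plus zero).foldr times one

end Forest

/-! ### Betweenness centrality -/

/-- The number `σ_st` of shortest paths from `s` to `t`. -/
noncomputable def numShortest {V : Type u} (G : SimpleGraph V) (s t : V) : ℕ :=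
  Set.ncard {p : G.Walk s t | p.length = G.dist s t}

/-- The number `σ_st(v)` of shortest paths from `s` to `t` that pass through `v`. -/
noncomputable def numShortestThrough {V : Type u} (G : SimpleGraph V) (s t v : V) : ℕ :=
  Set.ncard {p : G.Walk s t | p.length = G.dist s t ∧ v ∈ p.support}

/-- Betweenness centrality of `v` in the forest `F`: the sum of `σ_st(v) / σ_st` over the ordered
pairs of distinct vertices `s`, `t`, both different from `v`. The pairs in different trees have
`σ_st(v) = σ_st = 0` and contribute `0`. -/
noncomputable def betweenness {V : Type u} [DecidableEq V] (F : Forest V) (v : V) : ℚ :=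
  ∑ s ∈ F.labels.toFinset, ∑ t ∈ F.labels.toFinset,
    if s ≠ t ∧ s ≠ v ∧ t ≠ v then
      (numShortestThrough F.graph s t v : ℚ) / (numShortest F.graph s t : ℚ)
    else 0

/-- The unordered pairs of distinct vertices, both different from `v`, whose connecting path in the
forest passes through `v`. -/
def pathsThrough {V : Type u} (F : Forest V) (v : V) : Set (Sym2 V) :=
  {e | ∃ s t : V, e = s(s, t) ∧ s ≠ t ∧ s ≠ v ∧ t ≠ v ∧
    ∃ p : F.graph.Walk s t, p.IsPath ∧ v ∈ p.support}

/-! ### The customization: values and operations -/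

/-- The value `(1, 1)` of every vertex. -/
def bcVal {V : Type u} (_ : V) : ℤ × ℤ := (1, 1)

/-- `(a, a²) ⊕ (b, b²) = (a + b, (a + b)²)`. -/
def bcPlus (x y : ℤ × ℤ) : ℤ × ℤ := (x.1 + y.1, (x.1 + y.1) ^ 2)

/-- `⊗` is the vector sum. -/
def bcTimes (x y : ℤ × ℤ) : ℤ × ℤ := (x.1 + y.1, x.2 + y.2)

/-! ### Summaries of sequences of parentheses -/

section Summary

variable {V : Type u}

/-- `+1` for an open parenthesis, `-1` for a closed one. -/
def tag (p : Paren V) : ℤ := if p.2 then 1 else -1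

/-- Number of open minus number of closed parentheses; the depth of a parenthesis in a sequence is
the `depth` of the prefix that ends in it. -/
def depth (s : List (Paren V)) : ℤ := (s.map tag).sum

/-- The vertices whose open-node occurs in a sequence. -/
def opened (s : List (Paren V)) : List V := (s.filter fun p => p.2).map Prod.fst

/-- The decomposition of a sequence into prefix, body and suffix, the body being cut into the
subtrees it is made of: the prefix ends where the minimal depth (the empty prefix, of depth `0`,
being counted) is first reached, the body where it is last reached. -/
structure Decomposition (s pre : List (Paren V)) (body : List (List (Paren V)))
    (suf : List (Paren V)) : Prop where
  eq : s = pre ++ body.flatten ++ suf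
  pre_min : ∀ i < pre.length, depth pre < depth (pre.take i)
  body_tree : ∀ b ∈ body, b ≠ [] ∧ depth b = 0 ∧
    ∀ i, 0 < i → i < b.length → 0 < depth (b.take i)
  suf_pos : ∀ i, 0 < i → i ≤ suf.length → 0 < depth (suf.take i)

/-- The data of a summary of a sequence of parentheses for `reduceChildSubtrees`. -/
structure RcsSummary (α : Type) where
  prefixDepth : ℤ
  prefixPlus : α
  bodyPlus : α
  bodyTimes : α
  suffixPlus : α
  suffixDepth : ℤ

/-- `R` is the summary of the sequence `s`: depth of the minimum; `⊕`-combination over the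
prefix, the body, the suffix; `⊗`-combination of the `Σ`-values of the subtrees of the body;
depth of the end above the minimum. Every vertex is counted where its open-node stands. -/
def IsRcsSummary {α : Type} (plus times : α → α → α) (zero one : α) (val : V → α)
    (s : List (Paren V)) (R : RcsSummary α) : Prop :=
  ∃ (pre : List (Paren V)) (body : List (List (Paren V))) (suf : List (Paren V)),
    Decomposition s pre body suf ∧
    R.prefixDepth = depth pre ∧
    R.prefixPlus = ((opened pre).map val).foldr plus zero ∧
    R.bodyPlus = ((opened body.flatten).map val).foldr plus zero ∧
    R.bodyTimes = (body.map fun b => ((opened b).map val).foldr plus zero).foldr times one ∧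
    R.suffixPlus = ((opened suf).map val).foldr plus zero ∧
    R.suffixDepth = depth suf

end Summary

/-! ### Machine model: programs over a memory of records, with a step count -/

/-- The fields of a memory record. The fields `extra i` are not used by the structure below and may
hold anything that the underlying balanced search tree or other operations need. -/
inductive NodeField
  | left | right | parent | twin | tag
  | prefixDepth | prefixPlus₁ | prefixPlus₂ | bodyPlus₁ | bodyPlus₂ | bodyTimes₁ | bodyTimes₂
  | suffixPlus₁ | suffixPlus₂ | suffixDepth
  | extra (i : ℕ)

/-- The fields that hold the summary of the search tree below a record. -/
def NodeField.IsSummary : NodeField → Prop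
  | .left | .right | .parent | .twin | .tag | .extra _ => False
  | _ => True

/-- A memory: records addressed by integers; the address `0` is the null pointer. -/
abbrev Memory := ℤ → NodeField → ℤ

/-- Registers and memory. -/
structure State where
  reg : ℕ → ℤ
  mem : Memory

/-- Tests comparing two registers. -/
inductive Test
  | eq (a b : ℕ)
  | lt (a b : ℕ)

def Test.Holds (σ : State) : Test → Prop
  | .eq a b => σ.reg a = σ.reg b
  | .lt a b => σ.reg a < σ.reg b

/-- Programs: constants, arithmetic on registers, reading and writing one field of the record whose
address is in a register, and structured control. -/
inductive Program
  | const (r : ℕ) (k : ℤ)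
  | add (r a b : ℕ)
  | sub (r a b : ℕ)
  | mul (r a b : ℕ)
  | half (r a : ℕ)
  | load (r a : ℕ) (f : NodeField)
  | store (a : ℕ) (f : NodeField) (b : ℕ)
  | seq (p q : Program)
  | cond (b : Test) (p q : Program)
  | loop (b : Test) (p : Program)

def State.setReg (σ : State) (r : ℕ) (k : ℤ) : State := ⟨Function.update σ.reg r k, σ.mem⟩

open Classical in
noncomputable def State.setMem (σ : State) (a : ℤ) (f : NodeField) (k : ℤ) : State :=
  ⟨σ.reg, fun a' f' => if a' = a ∧ f' = f then k else σ.mem a' f'⟩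

/-- `Exec p σ k τ`: started in `σ`, the (deterministic) program `p` halts in `τ` after `k` steps.
Every elementary instruction and every evaluation of a test is one step. -/
inductive Exec : Program → State → ℕ → State → Prop
  | const (r k σ) : Exec (.const r k) σ 1 (σ.setReg r k)
  | add (r a b σ) : Exec (.add r a b) σ 1 (σ.setReg r (σ.reg a + σ.reg b))
  | sub (r a b σ) : Exec (.sub r a b) σ 1 (σ.setReg r (σ.reg a - σ.reg b))
  | mul (r a b σ) : Exec (.mul r a b) σ 1 (σ.setReg r (σ.reg a * σ.reg b))
  | half (r a σ) : Exec (.half r a) σ 1 (σ.setReg r (σ.reg a / 2))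
  | load (r a f σ) : Exec (.load r a f) σ 1 (σ.setReg r (σ.mem (σ.reg a) f))
  | store (a f b σ) : Exec (.store a f b) σ 1 (σ.setMem (σ.reg a) f (σ.reg b))
  | seq {p q σ τ ρ i j} : Exec p σ i τ → Exec q τ j ρ → Exec (.seq p q) σ (i + j) ρ
  | cond_true {b p q σ τ i} : b.Holds σ → Exec p σ i τ → Exec (.cond b p q) σ (i + 1) τ
  | cond_false {b p q σ τ i} : ¬ b.Holds σ → Exec q σ i τ → Exec (.cond b p q) σ (i + 1) τ
  | loop_false {b p σ} : ¬ b.Holds σ → Exec (.loop b p) σ 1 σ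
  | loop_true {b p σ τ ρ i j} : b.Holds σ → Exec p σ i τ → Exec (.loop b p) τ j ρ →
      Exec (.loop b p) σ (i + j + 1) ρ

/-! ### DFT-Trees in memory -/

section Store

variable {V : Type u}

/-- Symmetric (left-to-right) order of a binary tree. -/
def inorder {α : Type u} : BinaryTree α → List α
  | .nil => []
  | .node x l r => inorder l ++ x :: inorder r

/-- The summary stored in the record at address `a`. -/
def summaryAt (m : Memory) (a : ℤ) : RcsSummary (ℤ × ℤ) where
  prefixDepth := m a .prefixDepth
  prefixPlus := (m a .prefixPlus₁, m a .prefixPlus₂)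
  bodyPlus := (m a .bodyPlus₁, m a .bodyPlus₂)
  bodyTimes := (m a .bodyTimes₁, m a .bodyTimes₂)
  suffixPlus := (m a .suffixPlus₁, m a .suffixPlus₂)
  suffixDepth := m a .suffixDepth

/-- The address of the root record of a search tree whose node `x` is stored at `addr x`. -/
def pointer (addr : Paren V → ℤ) : BinaryTree (Paren V) → ℤ
  | .nil => 0
  | .node x _ _ => addr x

/-- The root record of the search tree `t`, if there is one, holds the summary of the sequence
stored in `t`. -/
def RootSummary (m : Memory) (addr : Paren V → ℤ) (t : BinaryTree (Paren V)) : Prop :=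
  t ≠ .nil →
    IsRcsSummary bcPlus bcTimes (0, 0) (0, 0) bcVal (inorder t) (summaryAt m (pointer addr t))

/-- The search tree `t` is stored in the memory, below the parent address `p`: child and parent
pointers are right, and every record holds the summary of its own search subtree. -/
def Stored (m : Memory) (addr : Paren V → ℤ) : ℤ → BinaryTree (Paren V) → Prop
  | _, .nil => True
  | p, .node x l r =>
      m (addr x) .parent = p ∧
      m (addr x) .left = pointer addr l ∧ m (addr x) .right = pointer addr r ∧
      RootSummary m addr (.node x l r) ∧
      Stored m addr (addr x) l ∧ Stored m addr (addr x) r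

/-- The memory `m` holds a DFT-Tree for the rooted forest `Forest.join Fs`, customized for
betweenness centrality: a collection of binary search trees, one for each member of `Fs`, which
stores its depth first tour in symmetric order and has height at most `c * log₂ (N + 1)`, where `N`
is its number of nodes. The nodes are distinct non-null records, tagged as open or closed and linked
to their twins. -/
structure IsDFTTree (c : ℝ) (m : Memory) (addr : Paren V → ℤ) (Fs : List (Forest V)) :
    Prop where
  labels_nodup : (Forest.join Fs).labels.Nodup
  addr_injective : ∀ x ∈ (Forest.join Fs).tour, ∀ y ∈ (Forest.join Fs).tour,
    addr x = addr y → x = y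
  addr_ne_null : ∀ x ∈ (Forest.join Fs).tour, addr x ≠ 0
  tag_eq : ∀ x ∈ (Forest.join Fs).tour, m (addr x) .tag = tag x
  twin_eq : ∀ x ∈ (Forest.join Fs).tour, m (addr x) .twin = addr (x.1, !x.2)
  tree : ∀ F ∈ Fs, ∃ t : BinaryTree (Paren V), inorder t = F.tour ∧ Stored m addr 0 t ∧
    (t.height : ℝ) ≤ c * Real.logb 2 (t.numNodes + 1)

end Store

end DFTree

open DFTree

/-! Counting. Removing `v` splits its tree into the part above `v` and the subtrees of its children.
A path between two vertices other than `v` meets `v` exactly when its ends lie in different parts of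
this tree (`Forest.exists_path_through_iff`): every edge that leaves a part leads to `v`, and inside
a part there are walks that avoid `v`. With `a` vertices above, `S = ∑ |stᵢ|` and `Q = ∑ |stᵢ|²`,
the ordered pairs number `(a + S)² - (a² + Q) = 2aS + S² - Q` (`Forest.card_throughPairs`). Paths in
a forest are unique, so each quotient in the betweenness is 0 or 1, and the sum counts these ordered
pairs, twice the unordered ones.

Query. When every vertex has the value `(1, 1)`, a summary is determined by six integers, its
`Digest`. The digest of a concatenation depends only on the digests of the two sequences
(`IsDigest.append`), and the decomposition behind it is unique (`Decomposition.unique`), so a digest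
may be computed along any bracketing. The tour of the group of `v` has the form `L (v M v) R`, where
`M` is the tour of the child subtrees. The body of `M` supplies `S` and `Q`. The suffix of `L`
counts the vertices of the tree of `v` that are opened before `v`, and the prefix of all that
follows the open-node of `v` counts those opened later, hence `a` is the sum of the two minus `S`.

Climbing from a record to the root of its search tree yields the digests of what stands before and
after it (`Stored.exists_walkAt`). For `M` one climbs from the open-node and the close-node of `v`
only to their lowest common ancestor (`Stored.exists_meet`). Each level costs boundedly many steps,
and the height is logarithmic. -/

namespace DFTree

/-! ### Decompositions and digests of sequences of parentheses -/

section SummaryAlgebra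

variable {V : Type u}

/-- The number of vertices opened in a sequence of parentheses. -/
def openCount (s : List (Paren V)) : ℤ := (opened s).length

@[simp] theorem depth_nil : depth ([] : List (Paren V)) = 0 := rfl

@[simp] theorem depth_append (s t : List (Paren V)) : depth (s ++ t) = depth s + depth t := by
  simp [depth]

@[simp] theorem openCount_nil : openCount ([] : List (Paren V)) = 0 := rfl

@[simp] theorem openCount_append (s t : List (Paren V)) :
    openCount (s ++ t) = openCount s + openCount t := by
  simp [openCount, opened]

theorem depth_take_append_of_le {s : List (Paren V)} {i : ℕ} (h : i ≤ s.length)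
    (t : List (Paren V)) : depth ((s ++ t).take i) = depth (s.take i) := by
  rw [List.take_append_of_le_length h]

theorem depth_take_append_of_ge {s : List (Paren V)} {i : ℕ} (h : s.length ≤ i)
    (t : List (Paren V)) : depth ((s ++ t).take i) = depth s + depth (t.take (i - s.length)) := by
  rw [List.take_append, List.take_of_length_le h, depth_append]

theorem depth_flatten_eq_zero {body : List (List (Paren V))} (h : ∀ b ∈ body, depth b = 0) :
    depth body.flatten = 0 := by
  induction body with
  | nil => rfl
  | cons b bs ih =>
    simp only [List.flatten_cons, depth_append]
    rw [h b (by simp), ih fun x hx => h x (by simp [hx])]; rfl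

theorem depth_take_flatten_nonneg {body : List (List (Paren V))}
    (h : ∀ b ∈ body, b ≠ [] ∧ depth b = 0 ∧ ∀ i, 0 < i → i < b.length → 0 < depth (b.take i))
    (i : ℕ) : 0 ≤ depth (body.flatten.take i) := by
  induction body generalizing i with
  | nil => simp
  | cons b bs ih =>
    obtain ⟨-, h0, hpos⟩ := h b (by simp)
    rw [List.flatten_cons]
    rcases le_total i b.length with hi | hi
    · rw [depth_take_append_of_le hi]
      rcases Nat.eq_zero_or_pos i with rfl | hi0
      · simp
      · rcases hi.eq_or_lt with rfl | hlt
        · simp [h0]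
        · exact (hpos i hi0 hlt).le
    · rw [depth_take_append_of_ge hi, h0, zero_add]
      exact ih (fun x hx => h x (by simp [hx])) _

namespace Decomposition

variable {s t pre suf : List (Paren V)} {body : List (List (Paren V))}

theorem depth_eq (h : Decomposition s pre body suf) : depth s = depth pre + depth suf := by
  rw [h.eq, depth_append, depth_append, depth_flatten_eq_zero fun b hb => (h.body_tree b hb).2.1]
  ring

theorem depth_suf_nonneg (h : Decomposition s pre body suf) : 0 ≤ depth suf := by
  rcases List.eq_nil_or_concat suf with h0 | ⟨x, y, h0⟩
  · simp [h0]
  · have := h.suf_pos suf.length (by simp [h0]) le_rfl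
    rw [List.take_length] at this
    exact this.le

theorem depth_pre_nonpos (h : Decomposition s pre body suf) : depth pre ≤ 0 := by
  rcases Nat.eq_zero_or_pos pre.length with h0 | h0
  · rw [List.length_eq_zero_iff.1 h0]; simp
  · simpa using (h.pre_min 0 h0).le

theorem pre_eq_nil (h : Decomposition s pre body suf) (h0 : depth pre = 0) : pre = [] := by
  by_contra hne
  have := h.pre_min 0 (List.length_pos_iff.2 hne)
  simp [h0] at this

theorem depth_pre_le_take_pre (h : Decomposition s pre body suf) (i : ℕ) :
    depth pre ≤ depth (pre.take i) := by
  rcases lt_or_ge i pre.length with hi | hi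
  · exact (h.pre_min i hi).le
  · rw [List.take_of_length_le hi]

/-- Body and suffix never go below the level at which the prefix ends, so this level is the minimum
over the whole sequence. -/
theorem depth_pre_le_take (h : Decomposition s pre body suf) (i : ℕ) :
    depth pre ≤ depth (s.take i) := by
  rw [h.eq, List.append_assoc]
  rcases le_total i pre.length with hi | hi
  · rw [depth_take_append_of_le hi]
    exact h.depth_pre_le_take_pre i
  rw [depth_take_append_of_ge hi]
  have key : ∀ j, 0 ≤ depth ((body.flatten ++ suf).take j) := by
    intro j
    rcases le_total j body.flatten.length with hj | hj
    · rw [depth_take_append_of_le hj]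
      exact depth_take_flatten_nonneg h.body_tree j
    · rw [depth_take_append_of_ge hj, depth_flatten_eq_zero fun b hb => (h.body_tree b hb).2.1,
        zero_add]
      generalize j - body.flatten.length = k
      rcases Nat.eq_zero_or_pos k with rfl | hk
      · simp
      rcases le_total k suf.length with hk' | hk'
      · exact (h.suf_pos k hk hk').le
      · rw [List.take_of_length_le hk']; exact h.depth_suf_nonneg
  have := key (i - pre.length)
  omega

/-- The sign of `depth suf + depth pre'` decides how two decompositions join. If it is negative, the
second sequence goes below the minimum of the first, so the new minimum is first reached at the end
of `pre'` and all of `s` falls into the prefix. -/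
theorem append_of_neg {pre' suf' : List (Paren V)} {body' : List (List (Paren V))}
    (h : Decomposition s pre body suf) (h' : Decomposition t pre' body' suf')
    (hd : depth suf + depth pre' < 0) :
    Decomposition (s ++ t) (s ++ pre') body' suf' where
  eq := by rw [h'.eq]; simp
  pre_min := by
    intro i hi
    rw [depth_append, h.depth_eq]
    rcases le_total i s.length with h1 | h1
    · rw [depth_take_append_of_le h1]
      have := h.depth_pre_le_take i
      omega
    · rw [depth_take_append_of_ge h1, h.depth_eq]
      have := h'.pre_min (i - s.length) (by simp at hi; omega)
      omega
  body_tree := h'.body_tree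
  suf_pos := h'.suf_pos

/-- The second sequence never comes down to the minimum of the first, so all of it joins the suffix.
-/
theorem append_of_pos {pre' suf' : List (Paren V)} {body' : List (List (Paren V))}
    (h : Decomposition s pre body suf) (h' : Decomposition t pre' body' suf')
    (hd : 0 < depth suf + depth pre') :
    Decomposition (s ++ t) pre body (suf ++ t) where
  eq := by rw [h.eq]; simp
  pre_min := h.pre_min
  body_tree := h.body_tree
  suf_pos := by
    intro i hi hi'
    rcases le_total i suf.length with h1 | h1
    · rw [depth_take_append_of_le h1]
      exact h.suf_pos i hi h1
    · rw [depth_take_append_of_ge h1]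
      have := h'.depth_pre_le_take (i - suf.length)
      omega

theorem append_of_zero_nil {pre' suf' : List (Paren V)} {body' : List (List (Paren V))}
    (h : Decomposition s pre body suf) (h' : Decomposition t pre' body' suf')
    (hn : suf ++ pre' = []) :
    Decomposition (s ++ t) pre (body ++ body') suf' where
  eq := by
    rw [List.append_eq_nil_iff] at hn
    rw [h.eq, h'.eq, hn.1, hn.2]; simp
  pre_min := h.pre_min
  body_tree := by
    intro b hb
    rcases List.mem_append.1 hb with hb | hb
    · exact h.body_tree b hb
    · exact h'.body_tree b hb
  suf_pos := h'.suf_pos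

/-- `suf` stays above the minimum and `pre'` returns to it only at its end, so together they form
one further complete subtree of the body. -/
theorem append_of_zero {pre' suf' : List (Paren V)} {body' : List (List (Paren V))}
    (h : Decomposition s pre body suf) (h' : Decomposition t pre' body' suf')
    (hd : depth suf + depth pre' = 0) (hn : suf ++ pre' ≠ []) :
    Decomposition (s ++ t) pre (body ++ (suf ++ pre') :: body') suf' where
  eq := by rw [h.eq, h'.eq]; simp
  pre_min := h.pre_min
  body_tree := by
    intro b hb
    rcases List.mem_append.1 hb with hb | hb
    · exact h.body_tree b hb
    rcases List.mem_cons.1 hb with rfl | hb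
    · refine ⟨hn, by rw [depth_append, hd], fun i hi hi' => ?_⟩
      rcases le_total i suf.length with h1 | h1
      · rw [depth_take_append_of_le h1]
        exact h.suf_pos i hi h1
      · rw [depth_take_append_of_ge h1]
        have := h'.pre_min (i - suf.length) (by simp at hi'; omega)
        omega
    · exact h'.body_tree b hb
  suf_pos := h'.suf_pos

/-- If `pre'` were longer, `pre` would be one of its proper prefixes and lie strictly above `depth
pre'`, although `depth pre` is the minimum over all prefixes of `s`. -/
theorem length_pre_le {pre' suf' : List (Paren V)} {body' : List (List (Paren V))}
    (h : Decomposition s pre body suf) (h' : Decomposition s pre' body' suf') :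
    pre'.length ≤ pre.length := by
  by_contra! hlt
  have h1 := h'.pre_min pre.length hlt
  have h2 := h.depth_pre_le_take pre'.length
  have e1 : pre'.take pre.length = pre := by
    have a : s.take pre.length = pre := by rw [h.eq]; simp
    have b : s.take pre'.length = pre' := by rw [h'.eq]; simp
    rw [← b, List.take_take, min_eq_left hlt.le, a]
  have e2 : s.take pre'.length = pre' := by rw [h'.eq]; simp
  rw [e1] at h1
  rw [e2] at h2
  omega

/-- If `suf'` were longer, the point where `suf` begins would lie inside `suf'`, strictly above the
minimum, although bodies have depth 0 and end at the minimum. -/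
theorem length_suf_le {pre' suf' : List (Paren V)} {body' : List (List (Paren V))}
    (h : Decomposition s pre body suf) (h' : Decomposition s pre' body' suf')
    (hp : pre = pre') : suf'.length ≤ suf.length := by
  by_contra! hlt
  have e1 : (pre ++ body.flatten) = (pre' ++ body'.flatten) ++
      suf'.take (suf'.length - suf.length) := by
    have a : s.take (s.length - suf.length) = pre ++ body.flatten := by
      rw [h.eq, List.length_append, Nat.add_sub_cancel, List.take_left]
    have hl : s.length = (pre' ++ body'.flatten).length + suf'.length := by
      rw [h'.eq, List.length_append]
    rw [← a, hl, h'.eq, List.take_append, List.take_of_length_le (by omega)]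
    congr 2
    omega
  have e2 := congrArg depth e1
  simp only [depth_append, depth_flatten_eq_zero fun b hb => (h.body_tree b hb).2.1,
    depth_flatten_eq_zero fun b hb => (h'.body_tree b hb).2.1, hp] at e2
  have := h'.suf_pos (suf'.length - suf.length) (by omega) (by omega)
  omega

end Decomposition

/-- A subtree ends where the depth first returns to 0, so the first subtrees on both sides have the
same length and can be split off. -/
theorem flatten_trees_injective {body body' : List (List (Paren V))}
    (h : ∀ b ∈ body, b ≠ [] ∧ depth b = 0 ∧ ∀ i, 0 < i → i < b.length → 0 < depth (b.take i))
    (h' : ∀ b ∈ body', b ≠ [] ∧ depth b = 0 ∧ ∀ i, 0 < i → i < b.length → 0 < depth (b.take i))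
    (he : body.flatten = body'.flatten) : body = body' := by
  induction body generalizing body' with
  | nil =>
    cases body' with
    | nil => rfl
    | cons b bs =>
      exact absurd (by simpa using he.symm : b = [] ∧ _).1 (h' b (by simp)).1
  | cons b bs ih =>
    cases body' with
    | nil => exact absurd (by simpa using he : b = [] ∧ _).1 (h b (by simp)).1
    | cons b' bs' =>
      have hb := h b (by simp)
      have hb' := h' b' (by simp)
      have aux : ∀ {x y xs ys : List (Paren V)}, x ++ xs = y ++ ys → x ≠ [] → depth x = 0 →
          (∀ i, 0 < i → i < y.length → 0 < depth (y.take i)) → y.length ≤ x.length := by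
        intro x y xs ys e hx hx0 hy
        by_contra! hlt
        have e' : y.take x.length = x := by
          have := congrArg (List.take x.length) e
          rw [List.take_left, List.take_append_of_le_length hlt.le] at this
          exact this.symm
        have := hy x.length (List.length_pos_iff.2 hx) hlt
        rw [e', hx0] at this
        exact lt_irrefl _ this
      rw [List.flatten_cons, List.flatten_cons] at he
      have hl : b.length = b'.length :=
        le_antisymm (aux he.symm hb'.1 hb'.2.1 hb.2.2) (aux he hb.1 hb.2.1 hb'.2.2)
      obtain ⟨rfl, e⟩ := List.append_inj he hl
      rw [ih (fun x hx => h x (by simp [hx])) (fun x hx => h' x (by simp [hx])) e]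

theorem Decomposition.unique {s pre suf pre' suf' : List (Paren V)}
    {body body' : List (List (Paren V))} (h : Decomposition s pre body suf)
    (h' : Decomposition s pre' body' suf') : pre = pre' ∧ body = body' ∧ suf = suf' := by
  have e := h.eq.symm.trans h'.eq
  rw [List.append_assoc, List.append_assoc] at e
  obtain ⟨e1, e2⟩ := List.append_inj e (le_antisymm (h'.length_pre_le h) (h.length_pre_le h'))
  obtain ⟨e3, e4⟩ := List.append_inj' e2
    (le_antisymm (h'.length_suf_le h e1.symm) (h.length_suf_le h' e1))
  exact ⟨e1, flatten_trees_injective h.body_tree h'.body_tree e3, e4⟩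

/-- The part of a summary that determines it when every vertex has the value `(1, 1)`: depth of the
minimum, numbers of vertices opened in prefix and body, sum of the squared subtree sizes in the
body, number of vertices opened in the suffix, depth of the end above the minimum. -/
@[ext] structure Digest where
  pd : ℤ
  pp : ℤ
  bp : ℤ
  bt : ℤ
  sp : ℤ
  sd : ℤ

/-- The digest of the empty sequence. -/
def Digest.empty : Digest := ⟨0, 0, 0, 0, 0, 0⟩

/-- The digest of a concatenation. -/
def Digest.comb (A B : Digest) : Digest :=
  if A.sd + B.pd < 0 then
    ⟨A.pd + (A.sd + B.pd), A.pp + A.bp + (A.sp + B.pp), B.bp, B.bt, B.sp, B.sd⟩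
  else if 0 < A.sd + B.pd then
    ⟨A.pd, A.pp, A.bp, A.bt, A.sp + B.pp + B.bp + B.sp, (A.sd + B.pd) + B.sd⟩
  else ⟨A.pd, A.pp, A.bp + (A.sp + B.pp) + B.bp, A.bt + (A.sp + B.pp) * (A.sp + B.pp) + B.bt,
    B.sp, B.sd⟩

/-- The digest of a single parenthesis with the given tag. -/
def Digest.single (k : ℤ) : Digest := if 0 < k then ⟨0, 0, 0, 0, 1, 1⟩ else ⟨-1, 0, 0, 0, 0, 0⟩

/-- The summary with a given digest. -/
def Digest.toSummary (A : Digest) : RcsSummary (ℤ × ℤ) :=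
  ⟨A.pd, (A.pp, A.pp ^ 2), (A.bp, A.bp ^ 2), (A.bp, A.bt), (A.sp, A.sp ^ 2), A.sd⟩

/-- `A` is the digest of the sequence `s`. -/
def IsDigest (s : List (Paren V)) (A : Digest) : Prop :=
  ∃ (pre : List (Paren V)) (body : List (List (Paren V))) (suf : List (Paren V)),
    Decomposition s pre body suf ∧
    A = ⟨depth pre, openCount pre, openCount body.flatten,
      (body.map fun b => openCount b * openCount b).sum, openCount suf, depth suf⟩

/-- The values stay on the curve `(a, a²)`, so a `⊕`-combination only counts vertices. -/
theorem foldr_bcPlus (l : List V) :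
    (l.map bcVal).foldr bcPlus (0, 0) = ((l.length : ℤ), (l.length : ℤ) ^ 2) := by
  induction l with
  | nil => simp
  | cons x l ih => simp [ih, bcPlus, bcVal, add_comm]

theorem foldr_bcTimes {β : Type*} (f : β → ℤ × ℤ) (l : List β) :
    (l.map f).foldr bcTimes (0, 0) =
      ((l.map fun b => (f b).1).sum, (l.map fun b => (f b).2).sum) := by
  induction l with
  | nil => rfl
  | cons x l ih => simp [ih, bcTimes]

theorem openCount_flatten (body : List (List (Paren V))) :
    openCount body.flatten = (body.map openCount).sum := by
  induction body with
  | nil => rfl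
  | cons b bs ih => simp [ih]

/-- The remaining fields of a summary are redundant: they are squares of counts, or repeat the
number of vertices in the body as the sum of the subtree sizes. The programs therefore compute with
digests only. -/
theorem isRcsSummary_iff {s : List (Paren V)} {R : RcsSummary (ℤ × ℤ)} :
    IsRcsSummary bcPlus bcTimes (0, 0) (0, 0) bcVal s R ↔
      ∃ A : Digest, IsDigest s A ∧ R = A.toSummary := by
  have hp : ∀ s : List (Paren V), ((opened s).map bcVal).foldr bcPlus (0, 0) =
      (openCount s, openCount s ^ 2) := fun s => foldr_bcPlus _
  simp only [IsRcsSummary, hp, foldr_bcTimes, IsDigest]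
  constructor
  · rintro ⟨pre, body, suf, h, h1, h2, h3, h4, h5, h6⟩
    refine ⟨_, ⟨pre, body, suf, h, rfl⟩, ?_⟩
    cases R
    simp only at h1 h2 h3 h4 h5 h6
    simp [Digest.toSummary, h1, h2, h3, h4, h5, h6, openCount_flatten, ← pow_two]

  · rintro ⟨_, ⟨pre, body, suf, h, rfl⟩, rfl⟩
    refine ⟨pre, body, suf, h, rfl, rfl, rfl, ?_, rfl, rfl⟩
    simp [Digest.toSummary, openCount_flatten, ← pow_two]

namespace IsDigest

variable {s t : List (Paren V)} {A B : Digest}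

theorem unique (h : IsDigest s A) (h' : IsDigest s B) : A = B := by
  obtain ⟨_, _, _, h, rfl⟩ := h
  obtain ⟨_, _, _, h', rfl⟩ := h'
  obtain ⟨rfl, rfl, rfl⟩ := h.unique h'
  rfl

/-- The cases of `Digest.comb` are the ways of joining two decompositions. -/
theorem append (h : IsDigest s A) (h' : IsDigest t B) : IsDigest (s ++ t) (A.comb B) := by
  obtain ⟨pre, body, suf, h, rfl⟩ := h
  obtain ⟨pre', body', suf', h', rfl⟩ := h'
  rcases lt_trichotomy (depth suf + depth pre') 0 with hd | hd | hd
  · refine ⟨_, _, _, h.append_of_neg h' hd, ?_⟩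
    rw [Digest.comb, if_pos hd]
    simp only [Digest.mk.injEq, depth_append, openCount_append, h.depth_eq, and_true]
    refine ⟨by ring, ?_⟩
    rw [h.eq]
    simp only [openCount_append]
    ring
  · rw [Digest.comb, if_neg (by simp [hd]), if_neg (by simp [hd])]
    simp only
    -- An empty middle is not a subtree of the body, but it contributes 0 to every entry, so one
    -- formula covers both cases.
    by_cases hn : suf ++ pre' = []
    · refine ⟨_, _, _, h.append_of_zero_nil h' hn, ?_⟩
      rw [List.append_eq_nil_iff] at hn
      simp [hn]
    · refine ⟨_, _, _, h.append_of_zero h' hd hn, ?_⟩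
      simp [add_assoc]
  · refine ⟨_, _, _, h.append_of_pos h' hd, ?_⟩
    rw [Digest.comb, if_neg (not_lt.2 hd.le), if_pos hd]
    simp only [Digest.mk.injEq, depth_append, openCount_append, h'.depth_eq, true_and]
    refine ⟨?_, by ring⟩
    rw [h'.eq]
    simp only [openCount_append]
    ring

theorem nil : IsDigest ([] : List (Paren V)) Digest.empty :=
  ⟨[], [], [], ⟨rfl, by simp, by simp, by simp; omega⟩, rfl⟩

theorem single (x : Paren V) : IsDigest [x] (Digest.single (tag x)) := by
  obtain ⟨v, b⟩ := x
  cases b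
  · refine ⟨[(v, false)], [], [], ⟨by simp, ?_, by simp, by simp; omega⟩, ?_⟩
    · intro i hi
      simp at hi
      simp [hi, depth, tag]
    · simp [Digest.single, tag, depth, openCount, opened]
  · refine ⟨[], [], [(v, true)], ⟨by simp, by simp, by simp, ?_⟩, ?_⟩
    · intro i hi hi'
      obtain rfl : i = 1 := by simp at hi'; omega
      simp [depth, tag]
    · simp [Digest.single, tag, depth, openCount, opened]

theorem pd_nonpos (h : IsDigest s A) : A.pd ≤ 0 := by
  obtain ⟨_, _, _, h, rfl⟩ := h
  exact h.depth_pre_nonpos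

theorem pp_eq_zero (h : IsDigest s A) (h0 : A.pd = 0) : A.pp = 0 := by
  obtain ⟨_, _, _, h, rfl⟩ := h
  simp [h.pre_eq_nil h0]

theorem openCount_eq (h : IsDigest s A) : openCount s = A.pp + A.bp + A.sp := by
  obtain ⟨_, _, _, h, rfl⟩ := h
  rw [h.eq, openCount_append, openCount_append]

end IsDigest

end SummaryAlgebra

/-! ### Program correctness with step bounds -/

section Runs

/-- Started in `σ`, the program `p` halts after at most `K` steps in a state satisfying `Q`. -/
def Runs (p : Program) (σ : State) (K : ℕ) (Q : State → Prop) : Prop :=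
  ∃ (k : ℕ) (τ : State), Exec p σ k τ ∧ k ≤ K ∧ Q τ

theorem Runs.mono {p : Program} {σ : State} {K K' : ℕ} {Q Q' : State → Prop}
    (h : Runs p σ K Q) (hK : K ≤ K') (hQ : ∀ τ, Q τ → Q' τ) : Runs p σ K' Q' := by
  obtain ⟨k, τ, h1, h2, h3⟩ := h
  exact ⟨k, τ, h1, h2.trans hK, hQ τ h3⟩

theorem Runs.seq {p q : Program} {σ : State} {i j : ℕ} {P Q : State → Prop}
    (h : Runs p σ i P) (h' : ∀ τ, P τ → Runs q τ j Q) : Runs (.seq p q) σ (i + j) Q := by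
  obtain ⟨k, τ, h1, h2, h3⟩ := h
  obtain ⟨k', ρ, h1', h2', h3'⟩ := h' τ h3
  exact ⟨k + k', ρ, .seq h1 h1', add_le_add h2 h2', h3'⟩

theorem Runs.cond {b : Test} {p q : Program} {σ : State} {K : ℕ} {Q : State → Prop}
    (h : b.Holds σ → Runs p σ K Q) (h' : ¬ b.Holds σ → Runs q σ K Q) :
    Runs (.cond b p q) σ (K + 1) Q := by
  by_cases hb : b.Holds σ
  · obtain ⟨k, τ, h1, h2, h3⟩ := h hb
    exact ⟨k + 1, τ, .cond_true hb h1, by omega, h3⟩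
  · obtain ⟨k, τ, h1, h2, h3⟩ := h' hb
    exact ⟨k + 1, τ, .cond_false hb h1, by omega, h3⟩

/-- The invariant is indexed by the rounds done and their number `n` is known in advance. Every
round pays one extra step for its test, and the final `+ 1` is the failing test. -/
theorem Runs.loop {b : Test} {p : Program} {K : ℕ} (I : ℕ → State → Prop) (n : ℕ)
    (step : ∀ i < n, ∀ σ, I i σ → b.Holds σ ∧ Runs p σ K (I (i + 1)))
    (finish : ∀ σ, I n σ → ¬ b.Holds σ) {σ : State} (h : I 0 σ) :
    Runs (.loop b p) σ (n * (K + 1) + 1) (I n) := by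
  induction n generalizing I σ with
  | zero => exact ⟨1, σ, .loop_false (finish σ h), by simp, h⟩
  | succ n ih =>
    obtain ⟨hb, k, τ, h1, h2, h3⟩ := step 0 (by omega) σ h
    obtain ⟨k', ρ, h1', h2', h3'⟩ := ih (fun i => I (i + 1))
      (fun i hi σ hσ => step (i + 1) (by omega) σ hσ) finish h3
    refine ⟨_, ρ, .loop_true hb h1 h1', ?_, h3'⟩
    rw [Nat.succ_mul]
    omega

theorem State.reg_setReg_self (σ : State) (r : ℕ) (k : ℤ) : (σ.setReg r k).reg r = k := by
  simp [State.setReg]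

theorem State.reg_setReg_of_ne {σ : State} {r s : ℕ} {k : ℤ} (h : s ≠ r) :
    (σ.setReg r k).reg s = σ.reg s := by
  simp [State.setReg, h]

theorem State.mem_setReg (σ : State) (r : ℕ) (k : ℤ) : (σ.setReg r k).mem = σ.mem := rfl

namespace Program

/-- Programs without loops. -/
def LoopFree : Program → Prop
  | .seq p q => p.LoopFree ∧ q.LoopFree
  | .cond _ p q => p.LoopFree ∧ q.LoopFree
  | .loop _ _ => False
  | _ => True

/-- An upper bound for the number of steps of a program without loops. -/
def cost : Program → ℕ
  | .seq p q => p.cost + q.cost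
  | .cond _ p q => max p.cost q.cost + 1
  | _ => 1

open Classical in
/-- The effect of a program without loops. -/
noncomputable def eval : Program → State → State
  | .const r k, σ => σ.setReg r k
  | .add r a b, σ => σ.setReg r (σ.reg a + σ.reg b)
  | .sub r a b, σ => σ.setReg r (σ.reg a - σ.reg b)
  | .mul r a b, σ => σ.setReg r (σ.reg a * σ.reg b)
  | .half r a, σ => σ.setReg r (σ.reg a / 2)
  | .load r a f, σ => σ.setReg r (σ.mem (σ.reg a) f)
  | .store a f b, σ => σ.setMem (σ.reg a) f (σ.reg b)
  | .seq p q, σ => q.eval (p.eval σ)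
  | .cond b p q, σ => if b.Holds σ then p.eval σ else q.eval σ
  | .loop _ _, σ => σ

theorem eval_cond_pos {b : Test} {p q : Program} {σ : State} (h : b.Holds σ) :
    (Program.cond b p q).eval σ = p.eval σ := by
  rw [eval, if_pos h]

theorem eval_cond_neg {b : Test} {p q : Program} {σ : State} (h : ¬ b.Holds σ) :
    (Program.cond b p q).eval σ = q.eval σ := by
  rw [eval, if_neg h]

/-- Reduces straight-line and branching code to the evaluation of `eval`, with a step bound
independent of the state. -/
theorem LoopFree.runs {p : Program} (h : p.LoopFree) (σ : State) :
    Runs p σ p.cost (fun τ => τ = p.eval σ) := by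
  induction p generalizing σ with
  | const r k => exact ⟨1, _, .const r k σ, le_rfl, rfl⟩
  | add r a b => exact ⟨1, _, .add r a b σ, le_rfl, rfl⟩
  | sub r a b => exact ⟨1, _, .sub r a b σ, le_rfl, rfl⟩
  | mul r a b => exact ⟨1, _, .mul r a b σ, le_rfl, rfl⟩
  | half r a => exact ⟨1, _, .half r a σ, le_rfl, rfl⟩
  | load r a f => exact ⟨1, _, .load r a f σ, le_rfl, rfl⟩
  | store a f b => exact ⟨1, _, .store a f b σ, le_rfl, rfl⟩
  | seq p q ihp ihq =>
    exact (ihp h.1 σ).seq fun τ hτ => by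
      subst hτ
      exact ihq h.2 _
  | cond b p q ihp ihq =>
    refine Runs.cond (fun hb => ?_) fun hb => ?_
    · exact (ihp h.1 σ).mono (le_max_left _ _) fun τ hτ => by rw [hτ, eval, if_pos hb]
    · exact (ihq h.2 σ).mono (le_max_right _ _) fun τ hτ => by rw [hτ, eval, if_neg hb]
  | loop b p => exact h.elim

theorem LoopFree.runs_of_eval {p : Program} (h : p.LoopFree) {σ : State} {K : ℕ}
    {Q : State → Prop} (hK : p.cost ≤ K) (hQ : Q (p.eval σ)) : Runs p σ K Q :=
  (h.runs σ).mono hK fun _ hτ => hτ ▸ hQ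

end Program

end Runs

/-! ### Programs that load, combine and store digests -/

section Blocks

open Program

infixr:60 " ;; " => Program.seq

/-- The digest stored in the six registers from `b` on. -/
def State.digest (σ : State) (b : ℕ) : Digest :=
  ⟨σ.reg b, σ.reg (b + 1), σ.reg (b + 2), σ.reg (b + 3), σ.reg (b + 4), σ.reg (b + 5)⟩

theorem State.digest_congr {σ τ : State} {b : ℕ}
    (h : ∀ r, b ≤ r → r < b + 6 → τ.reg r = σ.reg r) : τ.digest b = σ.digest b := by
  simp (disch := omega) only [State.digest, h]

/-- The digest stored in the summary fields of the record at address `a`. -/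
def digestAt (m : Memory) (a : ℤ) : Digest :=
  if a = 0 then Digest.empty
  else ⟨m a .prefixDepth, m a .prefixPlus₁, m a .bodyPlus₁, m a .bodyTimes₂, m a .suffixPlus₁,
    m a .suffixDepth⟩

/-- Move a digest. -/
def copyDigest (d s : ℕ) : Program :=
  .const 17 0 ;; .add d s 17 ;; .add (d + 1) (s + 1) 17 ;; .add (d + 2) (s + 2) 17 ;;
    .add (d + 3) (s + 3) 17 ;; .add (d + 4) (s + 4) 17 ;; .add (d + 5) (s + 5) 17

/-- A move is the addition of register 17, which is set to 0. The hypotheses keep it outside both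
blocks, and keep the blocks disjoint so that no entry is overwritten before it is read. -/
theorem runs_copyDigest {d s : ℕ} (hds : s + 6 ≤ d ∨ d + 6 ≤ s) (hs : s + 6 ≤ 17 ∨ 17 < s)
    (hd : d + 6 ≤ 17 ∨ 17 < d) (σ : State) :
    Runs (copyDigest d s) σ 7 fun τ => τ.mem = σ.mem ∧ τ.digest d = σ.digest s ∧
      ∀ r, r ≠ 17 → (r < d ∨ d + 6 ≤ r) → τ.reg r = σ.reg r := by
  refine LoopFree.runs_of_eval (by simp [copyDigest, LoopFree]) (by simp [copyDigest, cost]) ?_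
  refine ⟨rfl, ?_, fun r hr hr' => ?_⟩
  · simp (disch := omega) only [copyDigest, eval, State.digest, State.reg_setReg_self,
      State.reg_setReg_of_ne, add_zero]
  · simp (disch := omega) only [copyDigest, eval, State.reg_setReg_of_ne]

/-- Load the digest of the record whose address is in register `a`. -/
def loadDigest (d a : ℕ) : Program :=
  .const 17 0 ;; .cond (.eq a 17)
    (.const d 0 ;; .const (d + 1) 0 ;; .const (d + 2) 0 ;; .const (d + 3) 0 ;; .const (d + 4) 0 ;;
      .const (d + 5) 0)
    (.load d a .prefixDepth ;; .load (d + 1) a .prefixPlus₁ ;; .load (d + 2) a .bodyPlus₁ ;;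
      .load (d + 3) a .bodyTimes₂ ;; .load (d + 4) a .suffixPlus₁ ;; .load (d + 5) a .suffixDepth)

theorem runs_loadDigest {d a : ℕ} (ha : a ≠ 17)
    (had : a < d ∨ d + 6 ≤ a) (σ : State) :
    Runs (loadDigest d a) σ 8 fun τ => τ.mem = σ.mem ∧
      τ.digest d = digestAt σ.mem (σ.reg a) ∧
      ∀ r, r ≠ 17 → (r < d ∨ d + 6 ≤ r) → τ.reg r = σ.reg r := by
  refine LoopFree.runs_of_eval (by simp [loadDigest, LoopFree]) (by simp [loadDigest, cost]) ?_
  by_cases h : σ.reg a = 0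
  · have hb : (Test.eq a 17).Holds (σ.setReg 17 0) := by
      simp [Test.Holds, State.setReg, ha, h]
    rw [loadDigest, eval, eval, eval_cond_pos hb]
    simp only [eval]
    refine ⟨rfl, ?_, fun r hr hr' => ?_⟩
    · simp (disch := omega) only [State.digest, State.reg_setReg_self,
        State.reg_setReg_of_ne, digestAt, if_pos h, Digest.empty]
    · simp (disch := omega) only [State.reg_setReg_of_ne]
  · have hb : ¬ (Test.eq a 17).Holds (σ.setReg 17 0) := by
      simp [Test.Holds, State.setReg, ha, h]
    rw [loadDigest, eval, eval, eval_cond_neg hb]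
    simp only [eval]
    refine ⟨rfl, ?_, fun r hr hr' => ?_⟩
    · simp (disch := omega) only [State.digest, State.reg_setReg_self,
        State.reg_setReg_of_ne, State.mem_setReg, digestAt, if_neg h]
    · simp (disch := omega) only [State.reg_setReg_of_ne]

/-- The digest of the single parenthesis in the record whose address is in register `a`. -/
def singleDigest (d a : ℕ) : Program :=
  .const 17 0 ;; .load 50 a .tag ;; .cond (.lt 17 50)
    (.const d 0 ;; .const (d + 1) 0 ;; .const (d + 2) 0 ;; .const (d + 3) 0 ;; .const (d + 4) 1 ;;
      .const (d + 5) 1)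
    (.const d (-1) ;; .const (d + 1) 0 ;; .const (d + 2) 0 ;; .const (d + 3) 0 ;;
      .const (d + 4) 0 ;; .const (d + 5) 0)

theorem runs_singleDigest {d a : ℕ} (ha : a ≠ 17) (σ : State) :
    Runs (singleDigest d a) σ 9 fun τ => τ.mem = σ.mem ∧
      τ.digest d = Digest.single (σ.mem (σ.reg a) .tag) ∧
      ∀ r, r ≠ 17 → r ≠ 50 → (r < d ∨ d + 6 ≤ r) → τ.reg r = σ.reg r := by
  refine LoopFree.runs_of_eval (by simp [singleDigest, LoopFree]) (by simp [singleDigest, cost]) ?_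
  by_cases h : 0 < σ.mem (σ.reg a) .tag
  · have hb : (Test.lt 17 50).Holds
        ((σ.setReg 17 0).setReg 50 ((σ.setReg 17 0).mem ((σ.setReg 17 0).reg a) .tag)) := by
      simp [Test.Holds, State.setReg, ha, h]
    rw [singleDigest, eval, eval, eval, eval, eval_cond_pos hb]
    simp only [eval]
    refine ⟨rfl, ?_, fun r hr hr' hr'' => ?_⟩
    · simp (disch := omega) only [State.digest, State.reg_setReg_self,
        State.reg_setReg_of_ne, State.mem_setReg, Digest.single, if_pos h]
    · simp (disch := omega) only [State.reg_setReg_of_ne]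
  · have hb : ¬ (Test.lt 17 50).Holds
        ((σ.setReg 17 0).setReg 50 ((σ.setReg 17 0).mem ((σ.setReg 17 0).reg a) .tag)) := by
      simpa [Test.Holds, State.setReg, ha] using h
    rw [singleDigest, eval, eval, eval, eval, eval_cond_neg hb]
    simp only [eval]
    refine ⟨rfl, ?_, fun r hr hr' hr'' => ?_⟩
    · simp (disch := omega) only [State.digest, State.reg_setReg_self,
        State.reg_setReg_of_ne, State.mem_setReg, Digest.single, if_neg h]
    · simp (disch := omega) only [State.reg_setReg_of_ne]

/-- Combine the digests in the blocks `a` and `b`; the result goes to the block `51`. -/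
def combCore (a b : ℕ) : Program :=
  .const 17 0 ;; .add 50 (a + 5) b ;;
  .cond (.lt 50 17)
    (.add 51 a 50 ;; .add 52 (a + 1) (a + 2) ;; .add 53 (a + 4) (b + 1) ;; .add 52 52 53 ;;
      .add 53 (b + 2) 17 ;; .add 54 (b + 3) 17 ;; .add 55 (b + 4) 17 ;; .add 56 (b + 5) 17)
    (.cond (.lt 17 50)
      (.add 51 a 17 ;; .add 52 (a + 1) 17 ;; .add 53 (a + 2) 17 ;; .add 54 (a + 3) 17 ;;
        .add 55 (a + 4) (b + 1) ;; .add 55 55 (b + 2) ;; .add 55 55 (b + 4) ;;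
        .add 56 50 (b + 5))
      (.add 51 a 17 ;; .add 52 (a + 1) 17 ;; .add 55 (a + 4) (b + 1) ;; .add 53 (a + 2) 55 ;;
        .add 53 53 (b + 2) ;; .mul 55 55 55 ;; .add 54 (a + 3) 55 ;; .add 54 54 (b + 3) ;;
        .add 55 (b + 4) 17 ;; .add 56 (b + 5) 17))

theorem runs_combCore {a b : ℕ} (ha : a + 6 ≤ 17 ∨ 17 < a) (hb : b + 6 ≤ 17 ∨ 17 < b)
    (ha' : a + 6 ≤ 50 ∨ 56 < a) (hb' : b + 6 ≤ 50 ∨ 56 < b) (σ : State) :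
    Runs (combCore a b) σ 14 fun τ => τ.mem = σ.mem ∧
      τ.digest 51 = (σ.digest a).comb (σ.digest b) ∧
      ∀ r, r ≠ 17 → (r < 50 ∨ 56 < r) → τ.reg r = σ.reg r := by
  refine LoopFree.runs_of_eval (by simp [combCore, LoopFree]) (by simp [combCore, cost]) ?_
  have e : ((σ.setReg 17 0).setReg 50
      ((σ.setReg 17 0).reg (a + 5) + (σ.setReg 17 0).reg b)).reg 50 = σ.reg (a + 5) + σ.reg b := by
    simp (disch := omega) only [State.reg_setReg_self,
      State.reg_setReg_of_ne]
  have e' : ((σ.setReg 17 0).setReg 50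
      ((σ.setReg 17 0).reg (a + 5) + (σ.setReg 17 0).reg b)).reg 17 = 0 := by
    simp (disch := omega) only [State.reg_setReg_self,
      State.reg_setReg_of_ne]
  set ρ := (σ.setReg 17 0).setReg 50 ((σ.setReg 17 0).reg (a + 5) + (σ.setReg 17 0).reg b) with hρ
  by_cases h : σ.reg (a + 5) + σ.reg b < 0
  · have hb : (Test.lt 50 17).Holds ρ := by rwa [Test.Holds, e, e']
    rw [combCore, eval, eval, eval, eval, ← hρ, eval_cond_pos hb]
    simp only [eval, hρ]
    refine ⟨rfl, ?_, fun r hr hr' => ?_⟩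
    · rw [Digest.comb, if_pos (by exact h)]
      simp (disch := omega) only [State.digest, State.reg_setReg_self,
        State.reg_setReg_of_ne, add_zero, Nat.reduceAdd]
    · simp (disch := omega) only [State.reg_setReg_of_ne]
  by_cases h' : 0 < σ.reg (a + 5) + σ.reg b
  · have hb : ¬ (Test.lt 50 17).Holds ρ := by rwa [Test.Holds, e, e']
    have hb' : (Test.lt 17 50).Holds ρ := by rwa [Test.Holds, e, e']
    rw [combCore, eval, eval, eval, eval, ← hρ, eval_cond_neg hb, eval_cond_pos hb']
    simp only [eval, hρ]
    refine ⟨rfl, ?_, fun r hr hr' => ?_⟩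
    · rw [Digest.comb, if_neg (by exact h), if_pos (by exact h')]
      simp (disch := omega) only [State.digest, State.reg_setReg_self,
        State.reg_setReg_of_ne, add_zero, Nat.reduceAdd]
    · simp (disch := omega) only [State.reg_setReg_of_ne]
  · have hb : ¬ (Test.lt 50 17).Holds ρ := by rwa [Test.Holds, e, e']
    have hb' : ¬ (Test.lt 17 50).Holds ρ := by rwa [Test.Holds, e, e']
    rw [combCore, eval, eval, eval, eval, ← hρ, eval_cond_neg hb, eval_cond_neg hb']
    simp only [eval, hρ]
    refine ⟨rfl, ?_, fun r hr hr' => ?_⟩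
    · rw [Digest.comb, if_neg (by exact h), if_neg (by exact h')]
      simp (disch := omega) only [State.digest, State.reg_setReg_self,
        State.reg_setReg_of_ne, add_zero, Nat.reduceAdd]
    · simp (disch := omega) only [State.reg_setReg_of_ne]

/-- Combine the digests in the blocks `a` and `b` into the block `d`. -/
def combDigest (d a b : ℕ) : Program := combCore a b ;; copyDigest d 51

/-- The detour through the scratch registers 50 to 56 allows `d` to coincide with `a` or `b`, as is
needed for accumulating digests in place. -/
theorem runs_combDigest {d a b : ℕ} (ha : a + 6 ≤ 17 ∨ 17 < a) (hb : b + 6 ≤ 17 ∨ 17 < b)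
    (hd : d + 6 ≤ 17 ∨ 17 < d) (ha' : a + 6 ≤ 50 ∨ 56 < a) (hb' : b + 6 ≤ 50 ∨ 56 < b)
    (hd' : d + 6 ≤ 50 ∨ 56 < d) (σ : State) :
    Runs (combDigest d a b) σ 21 fun τ => τ.mem = σ.mem ∧
      τ.digest d = (σ.digest a).comb (σ.digest b) ∧
      ∀ r, r ≠ 17 → (r < 50 ∨ 56 < r) → (r < d ∨ d + 6 ≤ r) → τ.reg r = σ.reg r := by
  refine (runs_combCore ha hb ha' hb' σ).seq (j := 7) fun τ ⟨h1, h2, h3⟩ => ?_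
  refine (runs_copyDigest (by omega) (by omega) hd τ).mono le_rfl fun ρ ⟨k1, k2, k3⟩ => ?_
  exact ⟨k1.trans h1, k2.trans h2, fun r hr hr' hr'' => (k3 r hr hr'').trans (h3 r hr hr')⟩

/-- Store the digest in block `10` as the summary of the record whose address is in register `0`. -/
def storeDigest : Program :=
  .mul 50 11 11 ;; .mul 51 12 12 ;; .mul 52 14 14 ;;
  .store 0 .prefixDepth 10 ;; .store 0 .prefixPlus₁ 11 ;; .store 0 .prefixPlus₂ 50 ;;
  .store 0 .bodyPlus₁ 12 ;; .store 0 .bodyPlus₂ 51 ;; .store 0 .bodyTimes₁ 12 ;;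
  .store 0 .bodyTimes₂ 13 ;; .store 0 .suffixPlus₁ 14 ;; .store 0 .suffixPlus₂ 52 ;;
  .store 0 .suffixDepth 15

theorem runs_storeDigest (σ : State) :
    Runs storeDigest σ 13 fun τ => summaryAt τ.mem (σ.reg 0) = (σ.digest 10).toSummary ∧
      ∀ (a : ℤ) (f : NodeField), ¬ (a = σ.reg 0 ∧ f.IsSummary) → τ.mem a f = σ.mem a f := by
  refine LoopFree.runs_of_eval (by simp [storeDigest, LoopFree]) (by simp [storeDigest, cost]) ?_
  constructor
  · simp [storeDigest, eval, State.setReg, State.setMem, summaryAt, Digest.toSummary,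
      State.digest, pow_two]
  · intro a f haf
    by_cases ha : a = σ.reg 0
    · subst ha
      have hf : ¬ f.IsSummary := fun h => haf ⟨rfl, h⟩
      cases f <;> simp [NodeField.IsSummary] at hf <;>
        simp [storeDigest, eval, State.setReg, State.setMem]
    · simp [storeDigest, eval, State.setReg, State.setMem, ha]

end Blocks

/-! ### Local recomputation of a summary -/

section Recalculation

variable {V : Type u}

/-- A node must not have the address 0, because `digestAt` reads a null pointer as the empty search
tree. -/
theorem RootSummary.isDigest {m : Memory} {addr : Paren V → ℤ} {t : BinaryTree (Paren V)}
    (h : RootSummary m addr t) (h0 : ∀ y ∈ inorder t, addr y ≠ 0) :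
    IsDigest (inorder t) (digestAt m (pointer addr t)) := by
  cases t with
  | nil => exact IsDigest.nil
  | node x l r =>
    obtain ⟨A, hA, e⟩ := isRcsSummary_iff.1 (h (by simp))
    have hx : addr x ≠ 0 := h0 x (by simp [inorder])
    rw [pointer, digestAt, if_neg hx]
    convert hA using 1
    cases A
    simp only [summaryAt, pointer, Digest.toSummary, RcsSummary.mk.injEq, Prod.mk.injEq] at e
    simp [e]

/-- Recompute the summary of the record whose address is in register `0`. -/
def recalculate : Program :=
  .load 18 0 .left ;; loadDigest 10 18 ;; singleDigest 40 0 ;; combDigest 10 10 40 ;;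
  .load 18 0 .right ;; loadDigest 20 18 ;; combDigest 10 10 20 ;; storeDigest

theorem Runs.load (r a : ℕ) (f : NodeField) (σ : State) :
    Runs (.load r a f) σ 1 fun τ => τ = σ.setReg r (σ.mem (σ.reg a) f) :=
  ⟨1, _, .load r a f σ, le_rfl, rfl⟩

theorem runs_recalculate (σ : State) :
    Runs recalculate σ 82 fun τ =>
      summaryAt τ.mem (σ.reg 0) =
        (((digestAt σ.mem (σ.mem (σ.reg 0) .left)).comb
          (Digest.single (σ.mem (σ.reg 0) .tag))).comb
            (digestAt σ.mem (σ.mem (σ.reg 0) .right))).toSummary ∧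
      ∀ (a : ℤ) (f : NodeField), ¬ (a = σ.reg 0 ∧ f.IsSummary) → τ.mem a f = σ.mem a f := by
  refine (Runs.load _ _ _ _).seq (j := 81) fun σ1 h1 => ?_
  refine (runs_loadDigest (by omega) (by omega) σ1).seq (j := 73)
    fun σ2 ⟨m2, d2, f2⟩ => ?_
  refine (runs_singleDigest (by omega) σ2).seq (j := 64) fun σ3 ⟨m3, d3, f3⟩ => ?_
  refine (runs_combDigest (by omega) (by omega) (by omega) (by omega) (by omega) (by omega)
    σ3).seq (j := 43) fun σ4 ⟨m4, d4, f4⟩ => ?_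
  refine (Runs.load _ _ _ _).seq (j := 42) fun σ5 h5 => ?_
  refine (runs_loadDigest (by omega) (by omega) σ5).seq (j := 34)
    fun σ6 ⟨m6, d6, f6⟩ => ?_
  refine (runs_combDigest (by omega) (by omega) (by omega) (by omega) (by omega) (by omega)
    σ6).seq (j := 13) fun σ7 ⟨m7, d7, f7⟩ => ?_
  subst h1 h5
  have e3 : σ3.digest 10 = σ2.digest 10 :=
    State.digest_congr fun r h h' => f3 r (by omega) (by omega) (by omega)
  have e6 : σ6.digest 10 = σ4.digest 10 := State.digest_congr fun r h h' => by
    rw [f6 r (by omega) (by omega), State.reg_setReg_of_ne (by omega)]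
  have r2 : σ2.reg 0 = σ.reg 0 := f2 0 (by omega) (by omega)
  have r4 : σ4.reg 0 = σ.reg 0 := by
    rw [f4 0 (by omega) (by omega) (by omega), f3 0 (by omega) (by omega) (by omega), r2]
  have r7 : σ7.reg 0 = σ.reg 0 := by
    rw [f7 0 (by omega) (by omega) (by omega), f6 0 (by omega) (by omega),
      State.reg_setReg_of_ne (by omega), r4]
  have M2 : σ2.mem = σ.mem := m2
  have M4 : σ4.mem = σ.mem := by rw [m4, m3, M2]
  have M7 : σ7.mem = σ.mem := by rw [m7, m6, State.setReg, M4]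
  refine (runs_storeDigest σ7).mono le_rfl fun τ ⟨s1, s2⟩ => ?_
  rw [r7] at s1 s2
  rw [M7] at s2
  refine ⟨s1.trans ?_, s2⟩
  rw [d7, e6, d4, e3, d2, d3, d6, M2, r2]
  simp [State.setReg, M4, r4]

/-- In symmetric order the sequence is that of the left subtree, the single parenthesis `x`, and
that of the right subtree, so two combinations of digests suffice. -/
theorem recalculate_correct (m : Memory) (addr : Paren V → ℤ) (x : Paren V)
    (l r : BinaryTree (Paren V)) (h0 : ∀ y ∈ inorder (.node x l r), addr y ≠ 0)
    (ht : m (addr x) .tag = tag x) (hl : m (addr x) .left = pointer addr l)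
    (hr : m (addr x) .right = pointer addr r) (hsl : RootSummary m addr l)
    (hsr : RootSummary m addr r) (σ : State) (hm : σ.mem = m) (ha : σ.reg 0 = addr x) :
    Runs recalculate σ 82 fun τ => RootSummary τ.mem addr (.node x l r) ∧
      ∀ (a : ℤ) (f : NodeField), ¬ (a = addr x ∧ f.IsSummary) → τ.mem a f = m a f := by
  refine (runs_recalculate σ).mono le_rfl fun τ ⟨h1, h2⟩ => ?_
  rw [hm, ha] at h1 h2
  refine ⟨fun _ => ?_, h2⟩
  rw [isRcsSummary_iff]
  refine ⟨_, ?_, h1⟩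
  rw [hl, hr, ht]
  have := ((hsl.isDigest fun y hy => h0 y (by simp [inorder, hy])).append
    (IsDigest.single x)).append (hsr.isDigest fun y hy => h0 y (by simp [inorder, hy]))
  simpa [inorder] using this

end Recalculation

/-! ### Climbing the search tree -/

section Walk

open Program

/-- A position on the way up, with the digests of the entries before and after the starting point
in the search subtree below the position. -/
structure WalkState where
  cur : ℤ
  before : Digest
  after : Digest

/-- The address of the parent record. -/
def up (m : Memory) (a : ℤ) : ℤ := m a .parent

/-- The start of the way up from the record at address `a`. -/
def walkInit (m : Memory) (a : ℤ) : WalkState :=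
  ⟨a, digestAt m (m a .left), digestAt m (m a .right)⟩

/-- One step up. -/
def walkStep (m : Memory) (w : WalkState) : WalkState :=
  if m (up m w.cur) .right = w.cur then
    ⟨up m w.cur, ((digestAt m (m (up m w.cur) .left)).comb
      (Digest.single (m (up m w.cur) .tag))).comb w.before, w.after⟩
  else
    ⟨up m w.cur, w.before, (w.after.comb (Digest.single (m (up m w.cur) .tag))).comb
      (digestAt m (m (up m w.cur) .right))⟩

/-- The position after `n` steps up. -/
def walkAt (m : Memory) (a : ℤ) (n : ℕ) : WalkState := (walkStep m)^[n] (walkInit m a)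

theorem walkAt_succ (m : Memory) (a : ℤ) (n : ℕ) :
    walkAt m a (n + 1) = walkStep m (walkAt m a n) :=
  Function.iterate_succ_apply' _ _ _

theorem walkStep_cur (m : Memory) (w : WalkState) : (walkStep m w).cur = up m w.cur := by
  unfold walkStep
  split_ifs <;> rfl

theorem walkAt_cur (m : Memory) (a : ℤ) (n : ℕ) : (walkAt m a n).cur = (up m)^[n] a := by
  induction n with
  | zero => rfl
  | succ n ih => rw [walkAt_succ, walkStep_cur, ih, Function.iterate_succ_apply']

/-- Inspect the parent record, whose address is in register `8`. -/
def walkRead : Program := .load 18 8 .right ;; .load 19 8 .left ;; singleDigest 40 8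

theorem runs_walkRead (σ : State) : Runs walkRead σ 11 fun τ => τ.mem = σ.mem ∧
    τ.reg 18 = σ.mem (σ.reg 8) .right ∧ τ.reg 19 = σ.mem (σ.reg 8) .left ∧
    τ.digest 40 = Digest.single (σ.mem (σ.reg 8) .tag) ∧
    ∀ r, (r < 17 ∨ (20 ≤ r ∧ r < 30) ∨ 60 ≤ r) → τ.reg r = σ.reg r := by
  refine (Runs.load _ _ _ _).seq (j := 10) fun σ1 h1 => ?_
  refine (Runs.load _ _ _ _).seq (j := 9) fun σ2 h2 => ?_
  subst h1 h2
  refine (runs_singleDigest (by omega) _).mono le_rfl fun τ ⟨m3, d3, f3⟩ => ?_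
  simp (disch := omega) only [State.reg_setReg_of_ne, State.mem_setReg] at d3 m3
  refine ⟨m3, ?_, ?_, d3, fun r hr => ?_⟩
  · rw [f3 18 (by omega) (by omega) (by omega)]
    simp (disch := omega) only [State.reg_setReg_of_ne, State.reg_setReg_self]
  · rw [f3 19 (by omega) (by omega) (by omega)]
    simp (disch := omega) only [State.reg_setReg_of_ne, State.reg_setReg_self, State.mem_setReg]
  · rw [f3 r (by omega) (by omega) (by omega)]
    simp (disch := omega) only [State.reg_setReg_of_ne]

/-- Update the digests before and after the starting point. -/
def walkCombine : Program := .cond (.eq 18 6)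
  (loadDigest 30 19 ;; combDigest 30 30 40 ;; combDigest 10 30 10)
  (loadDigest 30 18 ;; combDigest 20 20 40 ;; combDigest 20 20 30)

theorem runs_walkCombine (σ : State) : Runs walkCombine σ 51 fun τ => τ.mem = σ.mem ∧
    τ.digest 10 = (if σ.reg 18 = σ.reg 6 then
      ((digestAt σ.mem (σ.reg 19)).comb (σ.digest 40)).comb (σ.digest 10) else σ.digest 10) ∧
    τ.digest 20 = (if σ.reg 18 = σ.reg 6 then σ.digest 20 else
      ((σ.digest 20).comb (σ.digest 40)).comb (digestAt σ.mem (σ.reg 18))) ∧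
    ∀ r, (r < 10 ∨ 60 ≤ r) → τ.reg r = σ.reg r := by
  refine Runs.cond (K := 50) (fun h => ?_) fun h => ?_
  · have h' : σ.reg 18 = σ.reg 6 := h
    simp only [if_pos h']
    refine (runs_loadDigest (by omega) (by omega) σ).seq (j := 42) fun σ1 ⟨m1, d1, f1⟩ => ?_
    refine (runs_combDigest (by omega) (by omega) (by omega) (by omega) (by omega) (by omega)
      σ1).seq (j := 21) fun σ2 ⟨m2, d2, f2⟩ => ?_
    refine (runs_combDigest (by omega) (by omega) (by omega) (by omega) (by omega) (by omega)
      σ2).mono le_rfl fun σ3 ⟨m3, d3, f3⟩ => ?_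
    have e1 : σ1.digest 40 = σ.digest 40 :=
      State.digest_congr fun r _ _ => f1 r (by omega) (by omega)
    have e2 : σ2.digest 10 = σ.digest 10 := State.digest_congr fun r _ _ => by
      rw [f2 r (by omega) (by omega) (by omega), f1 r (by omega) (by omega)]
    refine ⟨by rw [m3, m2, m1], by rw [d3, d2, d1, e1, e2], ?_, fun r hr => ?_⟩
    · exact State.digest_congr fun r _ _ => by
        rw [f3 r (by omega) (by omega) (by omega), f2 r (by omega) (by omega) (by omega),
          f1 r (by omega) (by omega)]
    · rw [f3 r (by omega) (by omega) (by omega), f2 r (by omega) (by omega) (by omega),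
          f1 r (by omega) (by omega)]
  · have h' : ¬ σ.reg 18 = σ.reg 6 := h
    simp only [if_neg h']
    refine (runs_loadDigest (by omega) (by omega) σ).seq (j := 42) fun σ1 ⟨m1, d1, f1⟩ => ?_
    refine (runs_combDigest (by omega) (by omega) (by omega) (by omega) (by omega) (by omega)
      σ1).seq (j := 21) fun σ2 ⟨m2, d2, f2⟩ => ?_
    refine (runs_combDigest (by omega) (by omega) (by omega) (by omega) (by omega) (by omega)
      σ2).mono le_rfl fun σ3 ⟨m3, d3, f3⟩ => ?_
    have e1 : σ1.digest 40 = σ.digest 40 :=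
      State.digest_congr fun r _ _ => f1 r (by omega) (by omega)
    have e1' : σ1.digest 20 = σ.digest 20 :=
      State.digest_congr fun r _ _ => f1 r (by omega) (by omega)
    have e2 : σ2.digest 30 = σ1.digest 30 :=
      State.digest_congr fun r _ _ => f2 r (by omega) (by omega) (by omega)
    refine ⟨by rw [m3, m2, m1], ?_, by rw [d3, d2, e2, d1, e1, e1'], fun r hr => ?_⟩
    · exact State.digest_congr fun r _ _ => by
        rw [f3 r (by omega) (by omega) (by omega), f2 r (by omega) (by omega) (by omega),
          f1 r (by omega) (by omega)]
    · rw [f3 r (by omega) (by omega) (by omega), f2 r (by omega) (by omega) (by omega),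
          f1 r (by omega) (by omega)]

/-- Move to the parent and compare its parent with the finish address. -/
def walkMove : Program :=
  .const 17 0 ;; .add 6 8 17 ;; .load 8 6 .parent ;; .const 18 1 ;; .add 9 9 18 ;;
    .sub 16 8 7 ;; .mul 16 16 16

theorem runs_walkMove (σ : State) : Runs walkMove σ 7 fun τ => τ.mem = σ.mem ∧
    τ.reg 6 = σ.reg 8 ∧ τ.reg 8 = σ.mem (σ.reg 8) .parent ∧ τ.reg 9 = σ.reg 9 + 1 ∧
    τ.reg 16 = (σ.mem (σ.reg 8) .parent - σ.reg 7) * (σ.mem (σ.reg 8) .parent - σ.reg 7) ∧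
    τ.reg 17 = 0 ∧ ∀ r, r ≠ 6 → r ≠ 8 → r ≠ 9 → r ≠ 16 → r ≠ 17 → r ≠ 18 → τ.reg r = σ.reg r := by
  refine LoopFree.runs_of_eval (by simp [walkMove, LoopFree]) (by simp [walkMove, cost]) ?_
  simp (disch := omega) only [walkMove, eval, State.reg_setReg_self, State.reg_setReg_of_ne,
    State.mem_setReg, add_zero, true_and]
  intro r _ _ _ _ _ _
  simp (disch := omega) only [State.reg_setReg_of_ne]

/-- Go up from the record at the address in register `6` to the child of the record at the address
in register `7`. The digests of the entries before and after the starting point, in the search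
subtree reached, go to the blocks `10` and `20`, the number of steps up to register `9`. -/
def walk : Program :=
  .const 9 0 ;; .load 18 6 .left ;; loadDigest 10 18 ;; .load 18 6 .right ;; loadDigest 20 18 ;;
  (.load 8 6 .parent ;; .sub 16 8 7 ;; .mul 16 16 16 ;; .const 17 0) ;;
  .loop (.lt 17 16) (walkRead ;; walkCombine ;; walkMove)

/-- The registers during the way up in the state `w` after `i` steps. -/
structure WalkInv (σ : State) (i : ℕ) (w : WalkState) (τ : State) : Prop where
  mem : τ.mem = σ.mem
  cur : τ.reg 6 = w.cur
  finish : τ.reg 7 = σ.reg 7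
  par : τ.reg 8 = up σ.mem w.cur
  count : τ.reg 9 = i
  test : τ.reg 16 = (up σ.mem w.cur - σ.reg 7) * (up σ.mem w.cur - σ.reg 7)
  zero : τ.reg 17 = 0
  before : τ.digest 10 = w.before
  after : τ.digest 20 = w.after
  frame : ∀ r, (r < 6 ∨ 60 ≤ r) → τ.reg r = σ.reg r

/-- No test expresses `≠`, so the loop runs while the square of the difference of the two addresses
is positive. -/
theorem WalkInv.holds_iff {σ τ : State} {i : ℕ} {w : WalkState} (h : WalkInv σ i w τ) :
    (Test.lt 17 16).Holds τ ↔ up σ.mem w.cur ≠ σ.reg 7 := by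
  rw [Test.Holds, h.zero, h.test]
  constructor
  · intro h0 h1
    simp [h1] at h0
  · intro h0
    have : up σ.mem w.cur - σ.reg 7 ≠ 0 := sub_ne_zero.2 h0
    exact mul_self_pos.2 this

theorem WalkInv.step {σ τ : State} {i : ℕ} {w : WalkState} (h : WalkInv σ i w τ) :
    Runs (walkRead ;; walkCombine ;; walkMove) τ 69 (WalkInv σ (i + 1) (walkStep σ.mem w)) := by
  refine (runs_walkRead τ).seq (j := 58) fun σ1 ⟨m1, r1, l1, d1, f1⟩ => ?_
  refine (runs_walkCombine σ1).seq (j := 7) fun σ2 ⟨m2, b2, a2, f2⟩ => ?_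
  refine (runs_walkMove σ2).mono le_rfl fun σ3 ⟨m3, g6, g8, g9, g16, g17, f3⟩ => ?_
  have M1 : σ1.mem = σ.mem := m1.trans h.mem
  have M2 : σ2.mem = σ.mem := m2.trans M1
  have e8 : σ2.reg 8 = up σ.mem w.cur := by rw [f2 8 (by omega), f1 8 (by omega), h.par]
  have e6 : σ1.reg 6 = w.cur := by rw [f1 6 (by omega), h.cur]
  have e7 : σ2.reg 7 = σ.reg 7 := by rw [f2 7 (by omega), f1 7 (by omega), h.finish]
  have E10 : σ1.digest 10 = w.before := by
    rw [← h.before]; exact State.digest_congr fun r _ _ => f1 r (by omega)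
  have E20 : σ1.digest 20 = w.after := by
    rw [← h.after]; exact State.digest_congr fun r _ _ => f1 r (by omega)
  have F10 : σ3.digest 10 = σ2.digest 10 := State.digest_congr fun r _ _ =>
    f3 r (by omega) (by omega) (by omega) (by omega) (by omega) (by omega)
  have F20 : σ3.digest 20 = σ2.digest 20 := State.digest_congr fun r _ _ =>
    f3 r (by omega) (by omega) (by omega) (by omega) (by omega) (by omega)
  rw [h.mem, h.par] at r1 l1 d1
  refine ⟨m3.trans M2, ?_, ?_, ?_, ?_, ?_, g17, ?_, ?_, ?_⟩
  · rw [g6, e8, walkStep_cur]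
  · rw [f3 7 (by omega) (by omega) (by omega) (by omega) (by omega) (by omega), e7]
  · rw [g8, e8, M2, walkStep_cur]; rfl
  · rw [g9, f2 9 (by omega), f1 9 (by omega), h.count]; push_cast; ring
  · rw [g16, e8, M2, e7, walkStep_cur]; rfl
  · rw [F10, b2, r1, l1, d1, e6, M1, E10, walkStep]
    split_ifs <;> rfl
  · rw [F20, a2, r1, d1, e6, M1, E20, walkStep]
    split_ifs <;> rfl
  · intro r hr
    rw [f3 r (by omega) (by omega) (by omega) (by omega) (by omega) (by omega), f2 r (by omega),
      f1 r (by omega), h.frame r hr]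

/-- The way up from `a` reaches the child of the record at `finish` after `n` steps. -/
def ReachesBelow (m : Memory) (finish a : ℤ) (n : ℕ) : Prop :=
  (∀ i < n, (up m)^[i + 1] a ≠ finish) ∧ (up m)^[n + 1] a = finish

/-- A level costs 69 steps and a test. The constant 24 consists of 23 steps of initialization and
the failing test. -/
theorem runs_walk {σ : State} {n : ℕ} (h : ReachesBelow σ.mem (σ.reg 7) (σ.reg 6) n) :
    Runs walk σ (n * 70 + 24) (WalkInv σ n (walkAt σ.mem (σ.reg 6) n)) := by
  refine ((LoopFree.runs (p := .const 9 0) trivial σ).seq (j := n * 70 + 23)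
    fun σ0 h0 => ?_).mono (by simp [cost]; omega) fun _ => id
  refine ((Runs.load _ _ _ _).seq (j := n * 70 + 22) fun σ1 h1 => ?_).mono (by omega) fun _ => id
  refine ((runs_loadDigest (by omega) (by omega) σ1).seq (j := n * 70 + 14)
    fun σ2 ⟨m2, d2, f2⟩ => ?_).mono (by omega) fun _ => id
  refine ((Runs.load _ _ _ _).seq (j := n * 70 + 13) fun σ3 h3 => ?_).mono (by omega) fun _ => id
  refine ((runs_loadDigest (by omega) (by omega) σ3).seq (j := n * 70 + 5)
    fun σ4 ⟨m4, d4, f4⟩ => ?_).mono (by omega) fun _ => id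
  refine ((LoopFree.runs (by simp [LoopFree]) σ4).seq (j := n * 70 + 1)
    fun σ5 h5 => ?_).mono (by simp [cost]; omega) fun _ => id
  subst h0 h1 h3
  simp only [eval] at m2 d2 f2 h5
  simp (disch := omega) only [State.mem_setReg, State.reg_setReg_self,
    State.reg_setReg_of_ne] at m2 d2 m4 d4
  have F2 : ∀ r, (r < 9 ∨ 20 ≤ r) → σ2.reg r = σ.reg r := fun r hr => by
    rw [f2 r (by omega) (by omega)]
    simp (disch := omega) only [State.reg_setReg_of_ne]
  have F4 : ∀ r, (r < 9 ∨ 26 ≤ r) → σ4.reg r = σ.reg r := fun r hr => by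
    rw [f4 r (by omega) (by omega), State.reg_setReg_of_ne (by omega), F2 r (by omega)]
  have M4 : σ4.mem = σ.mem := m4.trans m2
  refine (Runs.loop (K := 69) (fun i => WalkInv σ i (walkAt σ.mem (σ.reg 6) i)) n ?_ ?_ ?_)
  · intro i hi ρ hρ
    refine ⟨hρ.holds_iff.2 ?_, walkAt_succ σ.mem _ i ▸ hρ.step⟩
    rw [walkAt_cur, ← Function.iterate_succ_apply' (up σ.mem)]
    exact h.1 i hi
  · intro ρ hρ hh
    apply hρ.holds_iff.1 hh
    rw [walkAt_cur, ← Function.iterate_succ_apply' (up σ.mem)]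
    exact h.2
  · rw [h5]
    refine ⟨M4, ?_, ?_, ?_, ?_, ?_, ?_, ?_, ?_, fun r hr => ?_⟩
    · simp (disch := omega) only [State.reg_setReg_of_ne, F4]; rfl
    · simp (disch := omega) only [State.reg_setReg_of_ne, F4]
    · simp (disch := omega) only [State.reg_setReg_of_ne, State.reg_setReg_self, F4, M4]; rfl
    · simp (disch := omega) only [State.reg_setReg_of_ne]
      rw [f4 9 (by omega) (by omega), State.reg_setReg_of_ne (by omega),
        f2 9 (by omega) (by omega), State.reg_setReg_of_ne (by omega), State.reg_setReg_self]
      rfl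
    · simp (disch := omega) only [State.reg_setReg_of_ne, State.reg_setReg_self, F4, M4]
      rfl
    · simp (disch := omega) only [State.reg_setReg_self]
    · have : σ4.digest 10 = σ2.digest 10 := State.digest_congr fun r _ _ => by
        rw [f4 r (by omega) (by omega), State.reg_setReg_of_ne (by omega)]
      rw [← this] at d2
      refine Eq.trans (State.digest_congr fun r _ _ => ?_) d2
      simp (disch := omega) only [State.reg_setReg_of_ne]
    · rw [m2, F2 6 (by omega)] at d4
      refine Eq.trans (State.digest_congr fun r _ _ => ?_) d4
      simp (disch := omega) only [State.reg_setReg_of_ne]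
    · simp (disch := omega) only [State.reg_setReg_of_ne, F4]

end Walk

/-! ### Search trees in memory: ways up and lowest common ancestors -/

section StoredTrees

variable {V : Type u}

/-- What the records of the search tree `t` have to satisfy besides `Stored`. -/
structure ProperlyPlaced (m : Memory) (addr : Paren V → ℤ) (t : BinaryTree (Paren V)) : Prop where
  nodup : ((inorder t).map addr).Nodup
  ne_null : ∀ z ∈ inorder t, addr z ≠ 0
  tag_eq : ∀ z ∈ inorder t, m (addr z) .tag = tag z

/-- Locates an entry `x` relative to the root `y` of a search tree: at the root, in the left
subtree, or in the right one. -/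
theorem append_cons_eq_append_cons {α : Type*} {A B L R : List α} {x y : α}
    (h : A ++ y :: B = L ++ x :: R) :
    (x = y ∧ L = A ∧ R = B) ∨ (∃ R', A = L ++ x :: R' ∧ R = R' ++ y :: B) ∨
      (∃ L', L = A ++ y :: L' ∧ B = L' ++ x :: R) := by
  rcases List.append_eq_append_iff.1 h with ⟨a', h1, h2⟩ | ⟨c', h1, h2⟩
  · cases a' with
    | nil => simp_all
    | cons a a' =>
      simp only [List.cons_append, List.cons.injEq] at h2
      obtain ⟨rfl, h2⟩ := h2
      exact .inr (.inr ⟨a', h1, h2⟩)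
  · cases c' with
    | nil => simp_all
    | cons a a' =>
      simp only [List.cons_append, List.cons.injEq] at h2
      obtain ⟨rfl, h2⟩ := h2
      exact .inr (.inl ⟨a', h1, h2⟩)

variable {m : Memory} {addr : Paren V → ℤ}

theorem ProperlyPlaced.left {x : Paren V} {l r : BinaryTree (Paren V)}
    (h : ProperlyPlaced m addr (.node x l r)) : ProperlyPlaced m addr l where
  nodup := by
    have := h.nodup
    rw [inorder, List.map_append] at this
    exact (List.nodup_append.1 this).1
  ne_null z hz := h.ne_null z (by simp [inorder, hz])
  tag_eq z hz := h.tag_eq z (by simp [inorder, hz])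

theorem ProperlyPlaced.right {x : Paren V} {l r : BinaryTree (Paren V)}
    (h : ProperlyPlaced m addr (.node x l r)) : ProperlyPlaced m addr r where
  nodup := by
    have := h.nodup
    rw [inorder, List.map_append, List.map_cons] at this
    exact (List.nodup_cons.1 (List.nodup_append.1 this).2.1).2
  ne_null z hz := h.ne_null z (by simp [inorder, hz])
  tag_eq z hz := h.tag_eq z (by simp [inorder, hz])

theorem ProperlyPlaced.of_sublist {t t' : BinaryTree (Paren V)} (h : ProperlyPlaced m addr t)
    (hs : (inorder t').Sublist (inorder t)) : ProperlyPlaced m addr t' :=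
  ⟨h.nodup.sublist (hs.map addr), fun z hz => h.ne_null z (hs.subset hz),
    fun z hz => h.tag_eq z (hs.subset hz)⟩

theorem Stored.rootSummary {p : ℤ} {t : BinaryTree (Paren V)} (h : Stored m addr p t) :
    RootSummary m addr t := by
  cases t with
  | nil => intro h; exact absurd rfl h
  | node x l r => exact h.2.2.2.1

theorem Stored.up_pointer {p : ℤ} {t : BinaryTree (Paren V)} (h : Stored m addr p t)
    (ht : t ≠ .nil) : up m (pointer addr t) = p := by
  cases t with
  | nil => exact absurd rfl ht
  | node x l r => exact h.1

theorem pointer_mem {t : BinaryTree (Paren V)} (ht : t ≠ .nil) :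
    pointer addr t ∈ (inorder t).map addr := by
  cases t with
  | nil => exact absurd rfl ht
  | node x l r => simp [pointer, inorder]

/-- The way up from `x` to the root of `t` determines what stands before and after `x` in `t`. -/
theorem Stored.exists_walkAt {p : ℤ} {t : BinaryTree (Paren V)} (h : Stored m addr p t)
    (hp : ProperlyPlaced m addr t) {L R : List (Paren V)} {x : Paren V}
    (he : inorder t = L ++ x :: R) :
    ∃ n < t.height, (walkAt m (addr x) n).cur = pointer addr t ∧
      IsDigest L (walkAt m (addr x) n).before ∧ IsDigest R (walkAt m (addr x) n).after ∧
      ∀ i ≤ n, (up m)^[i] (addr x) ∈ (inorder t).map addr := by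
  induction t generalizing p L R with
  | nil => simp [inorder] at he
  | node y l r ihl ihr =>
    obtain ⟨-, hl, hr, -, hsl, hsr⟩ := h
    have hnd := hp.nodup
    rw [inorder, List.map_append, List.map_cons] at hnd
    have hty := hp.tag_eq y (by simp [inorder])
    have dl : IsDigest (inorder l) (digestAt m (pointer addr l)) :=
      hsl.rootSummary.isDigest hp.left.ne_null
    have dr : IsDigest (inorder r) (digestAt m (pointer addr r)) :=
      hsr.rootSummary.isDigest hp.right.ne_null
    rcases append_cons_eq_append_cons he with ⟨rfl, rfl, rfl⟩ | ⟨R', h1, rfl⟩ | ⟨L', rfl, h1⟩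
    · refine ⟨0, by simp, rfl, ?_, ?_, ?_⟩
      · simpa [walkAt, walkInit, hl] using dl
      · simpa [walkAt, walkInit, hr] using dr
      · intro i hi
        obtain rfl : i = 0 := by omega
        simp [inorder]
    · have hln : l ≠ .nil := by rintro rfl; simp [inorder] at h1
      obtain ⟨n, hn, hc, hb, ha, hm⟩ := ihl hsl hp.left h1
      have hup : up m (walkAt m (addr x) n).cur = addr y := by rw [hc, hsl.up_pointer hln]
      -- The program recognizes a left child by its not being the right child of its parent. An
      -- empty right subtree gives a null pointer, which is no node, and a nonempty one has its root
      -- at another address, since addresses are distinct.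
      have hne : m (addr y) .right ≠ (walkAt m (addr x) n).cur := by
        rw [hc, hr]
        by_cases hrn : r = .nil
        · subst hrn
          intro e
          obtain ⟨z, hz, hz'⟩ := List.mem_map.1 (pointer_mem (addr := addr) hln)
          exact hp.left.ne_null z hz (by rw [hz', ← e]; rfl)
        · intro e
          refine (List.nodup_append.1 hnd).2.2 _ (pointer_mem hln) _ ?_ e.symm
          exact List.mem_cons_of_mem _ (pointer_mem hrn)
      refine ⟨n + 1, by simp; omega, ?_, ?_, ?_, fun i hi => ?_⟩
      · rw [walkAt_succ, walkStep_cur, hup]; rfl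
      · rw [walkAt_succ, walkStep, hup, if_neg hne]
        exact hb
      · rw [walkAt_succ, walkStep, hup, if_neg hne, hr, hty]
        simpa using (ha.append (IsDigest.single y)).append dr
      · rcases Nat.lt_or_ge i (n + 1) with hi' | hi'
        · have := hm i (by omega)
          simp only [inorder, List.map_append, List.mem_append]
          exact .inl this
        · obtain rfl : i = n + 1 := by omega
          rw [← walkAt_cur, walkAt_succ, walkStep_cur, hup]
          simp [inorder]
    · have hrn : r ≠ .nil := by rintro rfl; simp [inorder] at h1
      obtain ⟨n, hn, hc, hb, ha, hm⟩ := ihr hsr hp.right h1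
      have hup : up m (walkAt m (addr x) n).cur = addr y := by rw [hc, hsr.up_pointer hrn]
      have heq : m (addr y) .right = (walkAt m (addr x) n).cur := by rw [hc, hr]
      refine ⟨n + 1, by simp; omega, ?_, ?_, ?_, fun i hi => ?_⟩
      · rw [walkAt_succ, walkStep_cur, hup]; rfl
      · rw [walkAt_succ, walkStep, hup, if_pos heq, hl, hty]
        simpa using (dl.append (IsDigest.single y)).append hb
      · rw [walkAt_succ, walkStep, hup, if_pos heq]
        exact ha
      · rcases Nat.lt_or_ge i (n + 1) with hi' | hi'
        · have := hm i (by omega)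
          simp only [inorder, List.map_append, List.map_cons, List.mem_append, List.mem_cons]
          exact .inr (.inr this)
        · obtain rfl : i = n + 1 := by omega
          rw [← walkAt_cur, walkAt_succ, walkStep_cur, hup]
          simp [inorder]

/-- The way up through a stored search tree ends below the parent of its root. -/
theorem Stored.exists_reachesBelow {p : ℤ} {t : BinaryTree (Paren V)} (h : Stored m addr p t)
    (hp : ProperlyPlaced m addr t) (hpt : p ∉ (inorder t).map addr) {L R : List (Paren V)}
    {x : Paren V} (he : inorder t = L ++ x :: R) :
    ∃ n < t.height, ReachesBelow m p (addr x) n ∧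
      IsDigest L (walkAt m (addr x) n).before ∧ IsDigest R (walkAt m (addr x) n).after ∧
      ∀ i ≤ n, (up m)^[i] (addr x) ∈ (inorder t).map addr := by
  obtain ⟨n, hn, hc, hb, ha, hm⟩ := h.exists_walkAt hp he
  refine ⟨n, hn, ⟨fun i hi e => hpt (e ▸ hm (i + 1) hi), ?_⟩, hb, ha, hm⟩
  rw [Function.iterate_succ_apply', ← walkAt_cur, hc]
  exact h.up_pointer (by rintro rfl; simp [inorder] at he)

/-- Two entries of a stored search tree have a lowest common ancestor. -/
theorem Stored.exists_common_ancestor {p : ℤ} {t : BinaryTree (Paren V)} (h : Stored m addr p t)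
    {L M R : List (Paren V)} {x y : Paren V} (he : inorder t = L ++ x :: (M ++ y :: R)) :
    ∃ (p' : ℤ) (z : Paren V) (l r : BinaryTree (Paren V)) (L' R' : List (Paren V)),
      Stored m addr p' (.node z l r) ∧ (inorder (.node z l r)).Sublist (inorder t) ∧
      ((z = x ∧ inorder r = M ++ y :: R') ∨ (z = y ∧ inorder l = L' ++ x :: M) ∨
        ∃ M₁ M₂, inorder l = L' ++ x :: M₁ ∧ inorder r = M₂ ++ y :: R' ∧ M = M₁ ++ z :: M₂) := by
  induction t generalizing p L R with
  | nil => simp [inorder] at he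
  | node z l r ihl ihr =>
    have h' := h
    obtain ⟨-, -, -, -, hsl, hsr⟩ := h
    rcases append_cons_eq_append_cons he with ⟨rfl, rfl, e⟩ | ⟨R', h1, h2⟩ | ⟨L', rfl, h1⟩
    · exact ⟨p, x, l, r, [], R, h', List.Sublist.refl _, .inl ⟨rfl, e.symm⟩⟩
    · rcases append_cons_eq_append_cons h2.symm with ⟨rfl, rfl, e⟩ | ⟨R'', h3, h4⟩ | ⟨L', rfl, h3⟩
      · exact ⟨p, y, l, r, L, [], h', List.Sublist.refl _, .inr (.inl ⟨rfl, h1⟩)⟩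
      · obtain ⟨p', z', l', r', L₁, R₁, k1, k2, k3⟩ := ihl hsl (h3 ▸ h1)
        exact ⟨p', z', l', r', L₁, R₁, k1, k2.trans (List.sublist_append_left _ _), k3⟩
      · exact ⟨p, z, l, r, L, R, h', List.Sublist.refl _, .inr (.inr ⟨R', L', h1, h3, rfl⟩)⟩
    · obtain ⟨p', z', l', r', L₁, R₁, k1, k2, k3⟩ := ihr hsr h1
      exact ⟨p', z', l', r', L₁, R₁, k1, k2.trans
        ((List.sublist_cons_self _ _).trans (List.sublist_append_right _ _)), k3⟩

end StoredTrees

/-! ### Finding the lowest common ancestor -/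

section Meet

open Program

/-- Go up alternately from the addresses in the registers `70` and `71`, whose depths are in the
registers `72` and `73`, until they agree. -/
def meet : Program :=
  .loop (.lt 17 16)
    (.cond (.lt 73 72) (.load 70 70 .parent ;; .sub 72 72 75)
        (.load 71 71 .parent ;; .sub 73 73 75) ;;
      .sub 16 70 71 ;; .mul 16 16 16)

/-- The registers of `meet` after `i` steps up from `a` and `j` steps up from `b`. -/
structure MeetInv (σ : State) (a b : ℤ) (da db : ℤ) (i j : ℕ) (τ : State) : Prop where
  mem : τ.mem = σ.mem
  cur : τ.reg 70 = (up σ.mem)^[i] a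
  cur' : τ.reg 71 = (up σ.mem)^[j] b
  depth : τ.reg 72 = da - i
  depth' : τ.reg 73 = db - j
  one : τ.reg 75 = 1
  test : τ.reg 16 = (τ.reg 70 - τ.reg 71) * (τ.reg 70 - τ.reg 71)
  zero : τ.reg 17 = 0
  frame : ∀ r, r ≠ 16 → (r < 70 ∨ 73 < r) → τ.reg r = σ.reg r

theorem MeetInv.holds_iff {σ τ : State} {a b da db : ℤ} {i j : ℕ}
    (h : MeetInv σ a b da db i j τ) :
    (Test.lt 17 16).Holds τ ↔ (up σ.mem)^[i] a ≠ (up σ.mem)^[j] b := by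
  rw [Test.Holds, h.zero, h.test, h.cur, h.cur']
  constructor
  · intro h0 h1
    simp [h1] at h0
  · intro h0
    exact mul_self_pos.2 (sub_ne_zero.2 h0)

theorem MeetInv.step {σ τ : State} {a b da db : ℤ} {i j : ℕ}
    (h : MeetInv σ a b da db i j τ) :
    Runs (.cond (.lt 73 72) (.load 70 70 .parent ;; .sub 72 72 75)
        (.load 71 71 .parent ;; .sub 73 73 75) ;; .sub 16 70 71 ;; .mul 16 16 16) τ 5
      fun ρ => if db - j < da - i then MeetInv σ a b da db (i + 1) j ρ
        else MeetInv σ a b da db i (j + 1) ρ := by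
  refine LoopFree.runs_of_eval (by simp [LoopFree]) (by simp [cost]) ?_
  by_cases hlt : db - j < da - i
  · have hb : (Test.lt 73 72).Holds τ := by rwa [Test.Holds, h.depth, h.depth']
    rw [if_pos hlt, eval, eval_cond_pos hb]
    simp only [eval]
    constructor <;> simp (disch := omega) only [State.reg_setReg_self, State.reg_setReg_of_ne,
      State.mem_setReg, h.mem, h.cur, h.cur', h.depth, h.depth', h.one, h.zero]
    · rw [Function.iterate_succ_apply']; rfl
    · push_cast; ring
    · intro r _ _
      simp (disch := omega) only [State.reg_setReg_of_ne, h.frame]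
  · have hb : ¬ (Test.lt 73 72).Holds τ := by rwa [Test.Holds, h.depth, h.depth']
    rw [if_neg hlt, eval, eval_cond_neg hb]
    simp only [eval]
    constructor <;> simp (disch := omega) only [State.reg_setReg_self, State.reg_setReg_of_ne,
      State.mem_setReg, h.mem, h.cur, h.cur', h.depth, h.depth', h.one, h.zero]
    · rw [Function.iterate_succ_apply']; rfl
    · push_cast; ring
    · intro r _ _
      simp (disch := omega) only [State.reg_setReg_of_ne, h.frame]

/-- The meeting point lies `k` levels below the root, `i` steps above `a` and `j` above `b`. Moving
the deeper position, the second one in case of a tie, never passes it: with `i'` and `j'` steps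
done, the move on the first side requires `i - i' > j - j' ≥ 0`, the other one `j - j' ≥ i - i'`,
and here `j' = j` would force `i' = i`. Hence the loop ends after exactly `i + j` moves. -/
theorem runs_meet {σ τ : State} {a b : ℤ} {i j k : ℕ}
    (hij : (up σ.mem)^[i] a = (up σ.mem)^[j] b)
    (hne : ∀ i' ≤ i, ∀ j' ≤ j, (up σ.mem)^[i'] a = (up σ.mem)^[j'] b → i' = i ∧ j' = j)
    (h : MeetInv σ a b (i + k) (j + k) 0 0 τ) :
    Runs meet τ ((i + j) * 6 + 1) (MeetInv σ a b (i + k) (j + k) i j) := by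
  -- Only the total number of moves is indexed; how they divide between the two sides is left
  -- existential.
  refine (Runs.loop (K := 5) (fun t ρ => ∃ i' ≤ i, ∃ j' ≤ j, i' + j' = t ∧
    MeetInv σ a b (i + k) (j + k) i' j' ρ) (i + j) ?_ ?_ ?_).mono le_rfl ?_
  · rintro t ht ρ ⟨i', hi', j', hj', rfl, hρ⟩
    refine ⟨hρ.holds_iff.2 fun e => ?_, ?_⟩
    · have := hne i' hi' j' hj' e
      omega
    · refine hρ.step.mono le_rfl fun ω hω => ?_
      split_ifs at hω with hlt
      · exact ⟨i' + 1, by omega, j', hj', by omega, hω⟩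
      · exact ⟨i', hi', j' + 1, by omega, by omega, hω⟩
  · rintro ρ ⟨i', hi', j', hj', ht, hρ⟩ hh
    obtain ⟨rfl, rfl⟩ : i' = i ∧ j' = j := by omega
    exact hρ.holds_iff.1 hh hij
  · exact ⟨0, by omega, 0, by omega, rfl, h⟩
  · rintro ρ ⟨i', hi', j', hj', ht, hρ⟩
    obtain ⟨rfl, rfl⟩ : i' = i ∧ j' = j := by omega
    exact hρ

end Meet

/-! ### The betweenness query -/

section Query

open Program

/-- Compute the digest of the entries strictly between those in the registers `0` and `74`, the
lowest common ancestor of which is in the registers `7` and `70`, into the block `60`. -/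
def between : Program :=
  .cond (.eq 70 0)
    (.add 6 74 17 ;; walk ;; copyDigest 60 10)
    (.add 6 0 17 ;; walk ;; copyDigest 60 20 ;; .cond (.eq 70 74) (.const 17 0)
      (singleDigest 40 70 ;; combDigest 60 60 40 ;; .const 17 0 ;; .add 6 74 17 ;; walk ;;
        combDigest 60 60 10))

theorem Runs.add (r a b : ℕ) (σ : State) :
    Runs (.add r a b) σ 1 fun τ => τ = σ.setReg r (σ.reg a + σ.reg b) :=
  ⟨1, _, .add r a b σ, le_rfl, rfl⟩

theorem Runs.cond_pos {b : Test} {p q : Program} {σ : State} {K : ℕ} {Q : State → Prop}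
    (hb : b.Holds σ) (h : Runs p σ K Q) : Runs (.cond b p q) σ (K + 1) Q :=
  Runs.cond (fun _ => h) fun hb' => absurd hb hb'

theorem Runs.cond_neg {b : Test} {p q : Program} {σ : State} {K : ℕ} {Q : State → Prop}
    (hb : ¬ b.Holds σ) (h : Runs q σ K Q) : Runs (.cond b p q) σ (K + 1) Q :=
  Runs.cond (fun hb' => absurd hb' hb) fun _ => h

theorem Runs.const (r : ℕ) (k : ℤ) (σ : State) :
    Runs (.const r k) σ 1 fun τ => τ = σ.setReg r k :=
  ⟨1, _, .const r k σ, le_rfl, rfl⟩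

/-- Walk from the record at the address in register `a`. -/
theorem runs_walk_from {σ : State} {a n : ℕ} (h0 : σ.reg 17 = 0)
    (h : ReachesBelow σ.mem (σ.reg 7) (σ.reg a) n) {q : Program} {K : ℕ} {Q : State → Prop}
    (hq : ∀ τ, τ.mem = σ.mem → τ.reg 9 = (n : ℤ) → τ.reg 7 = σ.reg 7 →
      τ.digest 10 = (walkAt σ.mem (σ.reg a) n).before →
      τ.digest 20 = (walkAt σ.mem (σ.reg a) n).after →
      (∀ r, (r < 6 ∨ 60 ≤ r) → τ.reg r = σ.reg r) → Runs q τ K Q) :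
    Runs (.add 6 a 17 ;; walk ;; q) σ (n * 70 + 25 + K) Q := by
  refine ((Runs.add 6 a 17 σ).seq (j := n * 70 + 24 + K) fun τ hτ => ?_).mono (by omega) fun _ => id
  have e6 : τ.reg 6 = σ.reg a := by rw [hτ, State.reg_setReg_self, h0, add_zero]
  have e7 : τ.reg 7 = σ.reg 7 := by rw [hτ, State.reg_setReg_of_ne (by omega)]
  have em : τ.mem = σ.mem := by rw [hτ]; rfl
  have h' : ReachesBelow τ.mem (τ.reg 7) (τ.reg 6) n := by rwa [em, e6, e7]
  refine (runs_walk h').seq fun ρ hρ => ?_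
  rw [e6, em] at hρ
  refine hq ρ (hρ.mem.trans em) hρ.count (hρ.finish.trans e7) hρ.before hρ.after fun r hr => ?_
  rw [hρ.frame r hr, hτ, State.reg_setReg_of_ne (by omega)]

/-- If the ancestor `z` is `a`, then `M` is what precedes `b` in the right subtree of `z`; if it is
`b`, then `M` is what follows `a` in the left subtree. Otherwise `M` consists of what follows `a` on
the left, `z` itself, and what precedes `b` on the right. The climbs stop at a child of `z`, so
nothing outside is included. -/
theorem runs_between {V : Type u} {σ : State} {M : List (Paren V)} {a b z : ℤ} {H : ℕ}
    (ha : σ.reg 0 = a) (hb : σ.reg 74 = b) (hz : σ.reg 70 = z) (hz' : σ.reg 7 = z)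
    (h0 : σ.reg 17 = 0)
    (h : (z = a ∧ ∃ n < H, ReachesBelow σ.mem z b n ∧ IsDigest M (walkAt σ.mem b n).before) ∨
      (z ≠ a ∧ ∃ n < H, ReachesBelow σ.mem z a n ∧
        ((z = b ∧ IsDigest M (walkAt σ.mem a n).after) ∨
        (z ≠ b ∧ ∃ n' < H, ReachesBelow σ.mem z b n' ∧
        IsDigest M (((walkAt σ.mem a n).after.comb (Digest.single (σ.mem z .tag))).comb
          (walkAt σ.mem b n').before))))) :
    Runs between σ (H * 140 + 120) fun τ => τ.mem = σ.mem ∧ IsDigest M (τ.digest 60) ∧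
      ∀ r, 70 ≤ r → τ.reg r = σ.reg r := by
  subst ha hb hz
  rcases h with ⟨e, n, hn, hw, hd⟩ | ⟨e, n, hn, hw, h⟩
  · refine (Runs.cond_pos (K := n * 70 + 25 + 7) (by exact e) ?_).mono
      (by omega) fun _ => id
    refine runs_walk_from h0 (hz' ▸ hw) fun τ m1 _ _ b1 a1 f1 => ?_
    refine (runs_copyDigest (by omega) (by omega) (by omega) τ).mono le_rfl
      fun ρ ⟨m2, d2, f2⟩ => ⟨m2.trans m1, by rwa [d2, b1], fun r hr => ?_⟩
    rw [f2 r (by omega) (by omega), f1 r (by omega)]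
  refine (Runs.cond_neg (K := n * 70 + 25 + (7 + (H * 70 + 80))) (by exact e) ?_).mono
    (by omega) fun _ => id
  refine runs_walk_from h0 (hz' ▸ hw) fun τ m1 _ s1 b1 a1 f1 => ?_
  refine (runs_copyDigest (by omega) (by omega) (by omega) τ).seq fun ρ ⟨m2, d2, f2⟩ => ?_
  have g0 : ρ.reg 0 = σ.reg 0 := by rw [f2 0 (by omega) (by omega), f1 0 (by omega)]
  have g70 : ρ.reg 70 = σ.reg 70 := by rw [f2 70 (by omega) (by omega), f1 70 (by omega)]
  have g74 : ρ.reg 74 = σ.reg 74 := by rw [f2 74 (by omega) (by omega), f1 74 (by omega)]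
  have g7 : ρ.reg 7 = σ.reg 70 := by rw [f2 7 (by omega) (by omega), s1, hz']
  have gm : ρ.mem = σ.mem := m2.trans m1
  rcases h with ⟨hb, hd⟩ | ⟨hb, n', hn', hw', hd⟩
  · refine (Runs.cond_pos (K := 1) (by rw [Test.Holds, g70, g74, hb]) ?_).mono
      (by omega) fun _ => id
    refine (Runs.const 17 0 ρ).mono le_rfl fun ω hω => ?_
    subst hω
    refine ⟨gm, ?_, fun r hr => ?_⟩
    · convert hd using 1
      rw [← a1, ← d2]
      exact State.digest_congr fun r _ _ => State.reg_setReg_of_ne (by omega)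
    · rw [State.reg_setReg_of_ne (by omega), f2 r (by omega) (by omega), f1 r (by omega)]
  · refine (Runs.cond_neg (K := 9 + (21 + (1 + (n' * 70 + 25 + 21))))
      (by rwa [Test.Holds, g70, g74]) ?_).mono
        (by omega) fun _ => id
    refine (runs_singleDigest (by omega) ρ).seq fun σ1 ⟨m3, d3, f3⟩ => ?_
    refine (runs_combDigest (by omega) (by omega) (by omega) (by omega) (by omega) (by omega)
      σ1).seq fun σ2 ⟨m4, d4, f4⟩ => ?_
    refine (Runs.const 17 0 σ2).seq fun σ3 h3 => ?_
    subst h3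
    have k7 : (σ2.setReg 17 0).reg 7 = σ.reg 70 := by
      rw [State.reg_setReg_of_ne (by omega), f4 7 (by omega) (by omega) (by omega),
        f3 7 (by omega) (by omega) (by omega), g7]
    have k74 : (σ2.setReg 17 0).reg 74 = σ.reg 74 := by
      rw [State.reg_setReg_of_ne (by omega), f4 74 (by omega) (by omega) (by omega),
        f3 74 (by omega) (by omega) (by omega), g74]
    have km : (σ2.setReg 17 0).mem = σ.mem := by rw [State.mem_setReg, m4, m3, gm]
    refine runs_walk_from (State.reg_setReg_self _ _ _) (n := n')
      (by rwa [k7, k74, km]) fun σ4 m5 _ _ b5 a5 f5 => ?_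
    refine (runs_combDigest (by omega) (by omega) (by omega) (by omega) (by omega) (by omega)
      σ4).mono le_rfl fun σ5 ⟨m6, d6, f6⟩ => ⟨by rw [m6, m5, km], ?_, fun r hr => ?_⟩
    · convert hd using 1
      have q1 : σ4.digest 60 = σ2.digest 60 := State.digest_congr fun r _ _ => by
        rw [f5 r (by omega), State.reg_setReg_of_ne (by omega)]
      have q2 : σ1.digest 60 = ρ.digest 60 := State.digest_congr fun r _ _ =>
        f3 r (by omega) (by omega) (by omega)
      rw [d6, q1, d4, q2, d2, a1, d3, gm, g70, b5, km, k74]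
    · rw [f6 r (by omega) (by omega) (by omega), f5 r (by omega), State.reg_setReg_of_ne (by omega),
        f4 r (by omega) (by omega) (by omega), f3 r (by omega) (by omega) (by omega),
        f2 r (by omega) (by omega), f1 r (by omega)]

/-- Compute the results of the query from the digest in the block `60`. -/
def output : Program :=
  .const 17 0 ;; .add 1 62 17 ;; .add 2 63 17 ;; .add 3 76 77 ;; .sub 3 3 62 ;; .mul 78 3 1 ;;
    .add 5 78 78 ;; .mul 79 1 1 ;; .sub 79 79 2 ;; .add 5 5 79 ;; .half 4 5

theorem runs_output (σ : State) : Runs output σ 11 fun τ => τ.mem = σ.mem ∧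
    τ.reg 1 = σ.reg 62 ∧ τ.reg 2 = σ.reg 63 ∧ τ.reg 3 = σ.reg 76 + σ.reg 77 - σ.reg 62 ∧
    τ.reg 5 = 2 * (τ.reg 3 * τ.reg 1) + (τ.reg 1 ^ 2 - τ.reg 2) ∧ τ.reg 4 = τ.reg 5 / 2 := by
  refine LoopFree.runs_of_eval (by simp [output, LoopFree]) (by simp [output, cost]) ?_
  simp (disch := omega) only [output, eval, State.reg_setReg_self, State.reg_setReg_of_ne,
    State.mem_setReg, add_zero, true_and]
  refine ⟨by ring, trivial⟩

/-- The betweenness query. -/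
def query : Program :=
  (.load 74 0 .twin ;; .const 7 0 ;; .const 17 0) ;; .add 6 0 17 ;; walk ;;
  (.const 17 0 ;; .add 76 14 17 ;; .add 77 21 17 ;; .add 72 9 17) ;; .add 6 74 17 ;; walk ;;
  (.const 17 0 ;; .add 73 9 17 ;; .add 70 0 17 ;; .add 71 74 17 ;; .const 75 1 ;; .sub 16 70 71 ;;
    .mul 16 16 16) ;; meet ;; (.const 17 0 ;; .add 7 70 17) ;; between ;; output

theorem ReachesBelow.unique {m : Memory} {s a : ℤ} {n n' : ℕ} (h : ReachesBelow m s a n)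
    (h' : ReachesBelow m s a n') : n = n' := by
  by_contra hne
  rcases Nat.lt_or_gt_of_ne hne with hlt | hlt
  · exact h'.1 n hlt h.2
  · exact h.1 n' hlt h'.2

theorem ReachesBelow.of_iterate {m : Memory} {s a z : ℤ} {i k : ℕ} (hz : (up m)^[i] a = z)
    (h : ∀ d < i, (up m)^[d + 1] a ≠ s) (hk : ReachesBelow m s z k) :
    ReachesBelow m s a (i + k) := by
  have e : ∀ d, (up m)^[i + d] a = (up m)^[d] z := fun d => by
    rw [Nat.add_comm, Function.iterate_add_apply, hz]
  refine ⟨fun d hd => ?_, by rw [Nat.add_assoc, e]; exact hk.2⟩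
  rcases Nat.lt_or_ge d i with hdi | hdi
  · exact h d hdi
  · obtain ⟨d', rfl⟩ := Nat.exists_eq_add_of_le hdi
    rw [Nat.add_assoc, e]
    exact hk.1 d' (by omega)

/-- The ways up from two entries of a stored search tree meet. -/
theorem Stored.exists_meet {V : Type u} {m : Memory} {addr : Paren V → ℤ}
    {t : BinaryTree (Paren V)} (h : Stored m addr 0 t) (hp : ProperlyPlaced m addr t)
    {L M R : List (Paren V)} {x y : Paren V} (he : inorder t = L ++ x :: (M ++ y :: R)) :
    ∃ (z : ℤ) (i j k : ℕ), i + k < t.height ∧ j + k < t.height ∧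
      ReachesBelow m 0 (addr x) (i + k) ∧ ReachesBelow m 0 (addr y) (j + k) ∧
      (up m)^[i] (addr x) = z ∧ (up m)^[j] (addr y) = z ∧
      (∀ i' ≤ i, ∀ j' ≤ j, (up m)^[i'] (addr x) = (up m)^[j'] (addr y) → i' = i ∧ j' = j) ∧
      ((z = addr x ∧ ∃ n < t.height, ReachesBelow m z (addr y) n ∧
          IsDigest M (walkAt m (addr y) n).before) ∨
        (z ≠ addr x ∧ ∃ n < t.height, ReachesBelow m z (addr x) n ∧
          ((z = addr y ∧ IsDigest M (walkAt m (addr x) n).after) ∨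
          (z ≠ addr y ∧ ∃ n' < t.height, ReachesBelow m z (addr y) n' ∧
          IsDigest M (((walkAt m (addr x) n).after.comb (Digest.single (m z .tag))).comb
            (walkAt m (addr y) n').before))))) := by
  obtain ⟨p', z, l, r, L', R', hs, hsub, hcase⟩ := h.exists_common_ancestor he
  have hp' := hp.of_sublist hsub
  obtain ⟨-, -, -, -, hsl, hsr⟩ := hs
  have hnd := hp'.nodup
  rw [inorder, List.map_append, List.map_cons, List.nodup_append, List.nodup_cons] at hnd
  obtain ⟨-, ⟨hzr, -⟩, hdisj⟩ := hnd
  have hzl : addr z ∉ (inorder l).map addr := fun hz => hdisj _ hz _ (by simp) rfl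
  have h0 : ∀ s : List (Paren V), s.Sublist (inorder t) → (0 : ℤ) ∉ s.map addr := fun s hs h0 => by
    obtain ⟨w, hw, hw'⟩ := List.mem_map.1 h0
    exact hp.ne_null w (hs.subset hw) hw'
  have hl0 := h0 _ ((List.sublist_append_left _ _).trans hsub)
  have hr0 := h0 _ (((List.sublist_cons_self _ _).trans (List.sublist_append_right _ _)).trans hsub)
  have hzt : z ∈ inorder t := hsub.subset (by simp [inorder])
  have hz0 : addr z ≠ 0 := hp.ne_null z hzt
  have hzx : ∀ w (s : List (Paren V)), w ∈ s → addr z ∉ s.map addr → addr z ≠ addr w :=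
    fun w s hw hz e => hz (e ▸ List.mem_map_of_mem hw)
  obtain ⟨Lz, Rz, hez⟩ := List.append_of_mem hzt
  -- `k` is the depth of `z` in the search tree; with `i` and `j` steps up to `z`, the two entries
  -- have depths `i + k` and `j + k`.
  obtain ⟨k, -, hk, -⟩ := h.exists_reachesBelow hp (h0 _ (List.Sublist.refl _)) hez
  obtain ⟨nx, hnx, hx, -⟩ := h.exists_reachesBelow hp (h0 _ (List.Sublist.refl _)) he
  obtain ⟨ny, hny, hy, -⟩ := h.exists_reachesBelow hp (h0 _ (List.Sublist.refl _))
    (L := L ++ x :: M) (x := y) (R := R) (by rw [he]; simp)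
  -- Below `z` one way stays in the left subtree and the other in the right one. Their addresses are
  -- disjoint and differ from that of `z`, so the ways coincide for the first time at `z`.
  have key : ∀ i j, (up m)^[i] (addr x) = addr z → (up m)^[j] (addr y) = addr z →
      (∀ d < i, (up m)^[d] (addr x) ∈ (inorder l).map addr) →
      (∀ d < j, (up m)^[d] (addr y) ∈ (inorder r).map addr) →
      i + k < t.height ∧ j + k < t.height ∧
      ReachesBelow m 0 (addr x) (i + k) ∧ ReachesBelow m 0 (addr y) (j + k) ∧
      (up m)^[i] (addr x) = addr z ∧ (up m)^[j] (addr y) = addr z ∧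
      (∀ i' ≤ i, ∀ j' ≤ j, (up m)^[i'] (addr x) = (up m)^[j'] (addr y) → i' = i ∧ j' = j) := by
    intro i j hi hj hil hjr
    have hxi : ReachesBelow m 0 (addr x) (i + k) := hk.of_iterate hi fun d hd e => by
      rcases Nat.lt_or_ge (d + 1) i with h' | h'
      · exact hl0 (e ▸ hil _ h')
      · rw [show d + 1 = i by omega, hi] at e
        exact hz0 e
    have hyj : ReachesBelow m 0 (addr y) (j + k) := hk.of_iterate hj fun d hd e => by
      rcases Nat.lt_or_ge (d + 1) j with h' | h'
      · exact hr0 (e ▸ hjr _ h')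
      · rw [show d + 1 = j by omega, hj] at e
        exact hz0 e
    refine ⟨hx.unique hxi ▸ hnx, hy.unique hyj ▸ hny, hxi, hyj, hi, hj, fun i' hi' j' hj' e => ?_⟩
    rcases hi'.lt_or_eq with h1 | rfl
    · exfalso
      rcases hj'.lt_or_eq with h2 | rfl
      · exact hdisj _ (hil i' h1) _ (List.mem_cons_of_mem _ (hjr j' h2)) e
      · exact hzl (hj ▸ e ▸ hil i' h1)
    · rcases hj'.lt_or_eq with h2 | rfl
      · exact absurd (hi ▸ e ▸ hjr j' h2) hzr
      · exact ⟨rfl, rfl⟩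
  -- The ancestor is `x`, or `y`, or a third entry. A side whose entry is itself the ancestor takes
  -- 0 steps; on another side the step from the child of `z` to `z` makes `n` into `n + 1`.
  rcases hcase with ⟨rfl, hr⟩ | ⟨rfl, hl⟩ | ⟨M₁, M₂, hl, hr, rfl⟩
  · obtain ⟨n, -, hn, hb, -, hm⟩ := hsr.exists_reachesBelow hp'.right hzr hr
    obtain ⟨k1, k2, k3, k4, k5, k6, k7⟩ := key 0 (n + 1) rfl hn.2 (by simp)
      fun d hd => hm d (by omega)
    exact ⟨_, 0, n + 1, k, k1, k2, k3, k4, k5, k6, k7, .inl ⟨rfl, n, by omega, hn, hb⟩⟩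
  · obtain ⟨n, -, hn, -, ha, hm⟩ := hsl.exists_reachesBelow hp'.left hzl hl
    obtain ⟨k1, k2, k3, k4, k5, k6, k7⟩ := key (n + 1) 0 hn.2 rfl
      (fun d hd => hm d (by omega)) (by simp)
    exact ⟨_, n + 1, 0, k, k1, k2, k3, k4, k5, k6, k7,
      .inr ⟨hzx x _ (by simp [hl]) hzl, n, by omega, hn, .inl ⟨rfl, ha⟩⟩⟩
  · obtain ⟨n, -, hn, -, ha, hm⟩ := hsl.exists_reachesBelow hp'.left hzl hl
    obtain ⟨n', -, hn', hb, -, hm'⟩ := hsr.exists_reachesBelow hp'.right hzr hr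
    obtain ⟨k1, k2, k3, k4, k5, k6, k7⟩ := key (n + 1) (n' + 1) hn.2 hn'.2
      (fun d hd => hm d (by omega)) fun d hd => hm' d (by omega)
    refine ⟨_, n + 1, n' + 1, k, k1, k2, k3, k4, k5, k6, k7,
      .inr ⟨hzx x _ (by simp [hl]) hzl, n, by omega, hn,
        .inr ⟨hzx y _ (by simp [hr]) hzr, n', by omega, hn', ?_⟩⟩⟩
    rw [hp.tag_eq z hzt]
    simpa using (ha.append (IsDigest.single z)).append hb

/-- A climb from `x` to the root gives the digests of `L` and of everything after `x`. The climb
from `y` to the root serves only to determine its depth for `meet`. -/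
theorem runs_query {V : Type u} {m : Memory} {addr : Paren V → ℤ}
    {t : BinaryTree (Paren V)} (h : Stored m addr 0 t) (hp : ProperlyPlaced m addr t)
    {L M R : List (Paren V)} {x y : Paren V} (he : inorder t = L ++ x :: (M ++ y :: R))
    (htw : m (addr x) .twin = addr y) {σ : State} (hm : σ.mem = m) (h0 : σ.reg 0 = addr x) :
    Runs query σ (t.height * 400 + 250) fun τ => τ.mem = m ∧ ∃ A B D : Digest,
      IsDigest L A ∧ IsDigest (M ++ y :: R) B ∧ IsDigest M D ∧
      τ.reg 1 = D.bp ∧ τ.reg 2 = D.bt ∧ τ.reg 3 = A.sp + B.pp - D.bp ∧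
      τ.reg 5 = 2 * (τ.reg 3 * τ.reg 1) + (τ.reg 1 ^ 2 - τ.reg 2) ∧
      τ.reg 4 = τ.reg 5 / 2 := by
  obtain ⟨z, i, j, k, hi, hj, hx, hy, hzi, hzj, hne, hcase⟩ := h.exists_meet hp he
  obtain ⟨nx, -, hx', hA, hB, -⟩ := h.exists_reachesBelow hp (fun h0 => by
    obtain ⟨w, hw, hw'⟩ := List.mem_map.1 h0
    exact hp.ne_null w hw hw') he
  obtain rfl := hx.unique hx'
  subst hm
  -- With `h` the height, the climbs to the root cost at most `70 h` each, the meeting `12 h` and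
  -- the interval `140 h`, up to constants, well within `400 h + 250`.
  refine ((LoopFree.runs (by simp [LoopFree]) σ).seq (j := (i + k) * 70 + 25 +
    (5 + ((j + k) * 70 + 25 + (7 + ((i + j) * 6 + 1 + (2 + (t.height * 140 + 120 + 11)))))))
    fun σ1 h1 => ?_).mono (by simp only [cost]; omega) fun _ => id
  simp only [eval] at h1
  have a1 : σ1.mem = σ.mem := by rw [h1]; rfl
  have b1 : σ1.reg 74 = addr y := by
    rw [h1]; simp (disch := omega) only [State.reg_setReg_of_ne, State.reg_setReg_self, h0, htw]
  have c1 : σ1.reg 0 = addr x := by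
    rw [h1]; simp (disch := omega) only [State.reg_setReg_of_ne, h0]
  have d1 : σ1.reg 7 = 0 := by
    rw [h1]; simp (disch := omega) only [State.reg_setReg_of_ne, State.reg_setReg_self]
  have e1 : σ1.reg 17 = 0 := by rw [h1]; exact State.reg_setReg_self _ _ _
  refine runs_walk_from e1 (n := i + k) (by rwa [a1, c1, d1])
    fun σ2 a2 g2 s2 x2 y2 f2 => ?_
  refine ((LoopFree.runs (by simp [LoopFree]) σ2).seq (j := (j + k) * 70 + 25 +
    (7 + ((i + j) * 6 + 1 + (2 + (t.height * 140 + 120 + 11)))))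
    fun σ3 h3 => ?_).mono (by simp only [cost]; omega) fun _ => id
  simp only [eval] at h3
  have a3 : σ3.mem = σ.mem := by rw [h3, ← a1, ← a2]; rfl
  have b3 : σ3.reg 74 = addr y := by
    rw [h3]; simp (disch := omega) only [State.reg_setReg_of_ne, f2, b1]
  have c3 : σ3.reg 0 = addr x := by
    rw [h3]; simp (disch := omega) only [State.reg_setReg_of_ne, f2, c1]
  have d3 : σ3.reg 7 = 0 := by
    rw [h3]; simp (disch := omega) only [State.reg_setReg_of_ne, s2, d1]
  have e3 : σ3.reg 17 = 0 := by
    rw [h3]; simp (disch := omega) only [State.reg_setReg_of_ne, State.reg_setReg_self]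
  -- Register 14, saved in 76, is the entry `sp` of the block 10; register 21, saved in 77, is the
  -- entry `pp` of the block 20.
  have p3 : σ3.reg 76 = (walkAt σ.mem (addr x) (i + k)).before.sp := by
    rw [h3, ← c1, ← a1, ← x2]
    simp (disch := omega) only [State.reg_setReg_of_ne, State.reg_setReg_self, add_zero]; rfl
  have q3 : σ3.reg 77 = (walkAt σ.mem (addr x) (i + k)).after.pp := by
    rw [h3, ← c1, ← a1, ← y2]
    simp (disch := omega) only [State.reg_setReg_of_ne, State.reg_setReg_self, add_zero]; rfl
  have r3 : σ3.reg 72 = (i + k : ℤ) := by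
    rw [h3]
    simp (disch := omega) only [State.reg_setReg_of_ne, State.reg_setReg_self, add_zero, g2]
    push_cast; rfl
  refine runs_walk_from e3 (n := j + k) (by rwa [a3, b3, d3])
    fun σ4 a4 g4 s4 x4 y4 f4 => ?_
  refine ((LoopFree.runs (by simp [LoopFree]) σ4).seq (j := (i + j) * 6 + 1 +
    (2 + (t.height * 140 + 120 + 11))) fun σ5 h5 => ?_).mono
      (by simp only [cost]; omega) fun _ => id
  simp only [eval] at h5
  have a5 : σ5.mem = σ.mem := by rw [h5, ← a3, ← a4]; rfl
  have F5 : ∀ r, (r < 6 ∨ 73 < r) → r ≠ 75 → σ5.reg r = σ3.reg r := fun r _ _ => by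
    rw [h5]; simp (disch := omega) only [State.reg_setReg_of_ne, f4]
  have I5 : MeetInv σ5 (addr x) (addr y) (i + k) (j + k) 0 0 σ5 := by
    refine ⟨rfl, ?_, ?_, ?_, ?_, ?_, ?_, ?_, fun _ _ _ => rfl⟩ <;> rw [h5] <;>
      simp (disch := omega) only [State.reg_setReg_of_ne, State.reg_setReg_self, add_zero, f4, g4,
        c3, b3, r3]
    · rfl
    · rfl
    · simp
    · simp
  refine (runs_meet (by rw [a5, hzi, hzj]) (by rwa [a5]) I5).seq fun σ6 I6 => ?_
  refine ((LoopFree.runs (by simp [LoopFree]) σ6).seq (j := t.height * 140 + 120 + 11)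
    fun σ7 h7 => ?_).mono (by simp only [cost]; omega) fun _ => id
  simp only [eval] at h7
  have a7 : σ7.mem = σ.mem := by rw [h7, ← a5, ← I6.mem]; rfl
  have F7 : ∀ r, (r < 6 ∨ 73 < r) → r ≠ 75 → σ7.reg r = σ3.reg r := fun r _ _ => by
    rw [h7]; simp (disch := omega) only [State.reg_setReg_of_ne, I6.frame, F5]
  have z6 : σ6.reg 70 = z := by rw [I6.cur, a5, hzi]
  have z7 : σ7.reg 70 = z := by
    rw [h7]; simp (disch := omega) only [State.reg_setReg_of_ne, z6]
  have z7' : σ7.reg 7 = z := by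
    rw [h7]
    simp (disch := omega) only [State.reg_setReg_of_ne, State.reg_setReg_self, z6, add_zero]
  have e7 : σ7.reg 17 = 0 := by
    rw [h7]; simp (disch := omega) only [State.reg_setReg_of_ne, State.reg_setReg_self]
  refine (runs_between (M := M) (H := t.height)
    ((F7 0 (by omega) (by omega)).trans c3) ((F7 74 (by omega) (by omega)).trans b3) z7 z7' e7
    (by rwa [a7])).seq fun σ8 ⟨a8, d8, f8⟩ => ?_
  refine (runs_output σ8).mono le_rfl fun τ ⟨a9, o1, o2, o3, o5, o4⟩ => ?_
  refine ⟨by rw [a9, a8, a7], _, _, _, hA, hB, d8, o1, o2, ?_, o5, o4⟩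
  rw [o3, f8 76 (by omega), f8 77 (by omega), F7 76 (by omega) (by omega),
    F7 77 (by omega) (by omega), p3, q3]
  rfl

end Query

/-! ### Depth first tours and the position of a vertex in them -/

namespace Forest

variable {V : Type u}

theorem roots_subset_labels (F : Forest V) : F.roots ⊆ F.labels := by
  induction F with
  | nil => simp [roots]
  | cons r c s _ ihs =>
    intro x hx
    simp only [roots, List.mem_cons] at hx
    rcases hx with rfl | hx
    · simp [labels]
    · simp [labels, ihs hx]

theorem labels_eq_flatten (F : Forest V) : F.labels = F.treeLabels.flatten := by
  induction F with
  | nil => rfl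
  | cons r c s _ ihs => simp [labels, treeLabels, ihs]

theorem labels_append (F G : Forest V) : (F.append G).labels = F.labels ++ G.labels := by
  induction F with
  | nil => rfl
  | cons r c s _ ihs => simp [append, labels, ihs]

theorem mem_tour {F : Forest V} {x : Paren V} : x ∈ F.tour ↔ x.1 ∈ F.labels := by
  obtain ⟨u, b⟩ := x
  induction F with
  | nil => simp [tour, labels]
  | cons r c s ihc ihs =>
    simp only [tour, labels, List.mem_cons, List.mem_append, ihc, ihs, Prod.mk.injEq]
    cases b <;> simp
    all_goals tauto

theorem tour_nodup {F : Forest V} (h : F.labels.Nodup) : F.tour.Nodup := by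
  induction F with
  | nil => simp [tour]
  | cons r c s ihc ihs =>
    simp only [labels, List.nodup_cons, List.mem_append, not_or, List.nodup_append] at h
    obtain ⟨⟨hrc, hrs⟩, hc, hs, hcs⟩ := h
    simp only [tour, List.nodup_cons, List.mem_append, List.mem_cons, not_or, List.nodup_append,
      mem_tour]
    refine ⟨⟨hrc, by simp, hrs⟩, ihc hc, ⟨hrs, ihs hs⟩, ?_⟩
    rintro a ha b (rfl | hb) rfl
    · exact hrc ha
    · exact hcs _ ha _ hb rfl

theorem tour_length (F : Forest V) : F.tour.length = 2 * F.labels.length := by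
  induction F with
  | nil => rfl
  | cons r c s ihc ihs =>
    simp only [tour, labels, List.length_cons, List.length_append, ihc, ihs]
    ring

/-- A tour never goes below 0 and ends at 0: prefix and suffix are empty, and the subtrees of the
body are the trees of the forest. -/
theorem isDigest_tour (F : Forest V) :
    IsDigest F.tour ⟨0, 0, F.labels.length,
      (F.treeLabels.map fun st => (st.length : ℤ) ^ 2).sum, 0, 0⟩ := by
  induction F with
  | nil => exact IsDigest.nil
  | cons r c s ihc ihs =>
    have := (((IsDigest.single (r, true)).append ihc).append
      (IsDigest.single (r, false))).append ihs
    convert this using 1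
    · simp [tour]
    · simp [Digest.comb, Digest.single, tag, labels, treeLabels]
      constructor <;> ring

theorem openCount_tour (F : Forest V) : openCount F.tour = F.labels.length := by
  simpa using F.isDigest_tour.openCount_eq

/-- The vertex list of the tree containing `v`. -/
def treeOf [DecidableEq V] : Forest V → V → List V
  | nil, _ => []
  | cons r c s, v => if v ∈ r :: c.labels then r :: c.labels else s.treeOf v

theorem treeOf_append [DecidableEq V] (F G : Forest V) (v : V) :
    (F.append G).treeOf v = if v ∈ F.labels then F.treeOf v else G.treeOf v := by
  induction F with
  | nil => rfl
  | cons r c s _ ihs =>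
    simp only [append, treeOf, labels, ihs]
    by_cases h : v ∈ r :: c.labels
    · have : v ∈ r :: (c.labels ++ s.labels) := by
        simp only [List.mem_cons, List.mem_append] at h ⊢; tauto
      simp only [if_pos h, if_pos this]
    · by_cases h' : v ∈ s.labels
      · simp [h, h']
      · have : v ∉ r :: (c.labels ++ s.labels) := by
          simp only [List.mem_cons, List.mem_append] at h ⊢; tauto
        simp only [if_neg h, if_neg h', if_neg this]

theorem childForest_append [DecidableEq V] (F G : Forest V) (v : V) :
    (F.append G).childForest v = if v ∈ F.labels then F.childForest v else G.childForest v := by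
  induction F with
  | nil => rfl
  | cons r c s _ ihs =>
    simp only [append, childForest, labels, ihs, List.mem_cons, List.mem_append]
    by_cases h1 : v = r
    · simp [h1]
    · by_cases h2 : v ∈ c.labels <;> simp [h1, h2]

/-- Before `v` is opened, depth 0 is last reached where the tree of `v` begins, so the suffix of `L`
counts the vertices of this tree opened before `v`. After `v` is closed, the minimum is first
reached where the tree ends, so the prefix of `R` counts those opened later. Other trees of the
forest fall into the bodies. -/
theorem exists_tour_eq [DecidableEq V] {F : Forest V} (hF : F.labels.Nodup) {v : V}
    (hv : v ∈ F.labels) :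
    ∃ (L R : List (Paren V)) (A B : Digest),
      F.tour = L ++ (v, true) :: ((F.childForest v).tour ++ (v, false) :: R) ∧
      IsDigest L A ∧ IsDigest R B ∧ A.pd = 0 ∧ A.pp = 0 ∧ B.sd = 0 ∧ B.sp = 0 ∧
      A.sp + ((F.childForest v).labels.length + 1) + B.pp = (F.treeOf v).length := by
  induction F with
  | nil => simp [labels] at hv
  | cons r c s ihc ihs =>
    simp only [labels, List.nodup_cons, List.mem_append, not_or, List.nodup_append] at hF
    obtain ⟨⟨hrc, hrs⟩, hc, hs, hcs⟩ := hF
    by_cases h1 : v = r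
    · subst h1
      refine ⟨[], s.tour, _, _, ?_, IsDigest.nil, s.isDigest_tour, rfl, rfl, rfl, rfl, ?_⟩
      · simp [tour, childForest]
      · simp [Digest.empty, childForest, treeOf]
    by_cases h2 : v ∈ c.labels
    · obtain ⟨L, R, A, B, e, hA, hB, hpd, hpp, hsd, hsp, -⟩ := ihc hc h2
      -- The tree of `v` now has the root `r`: opening `r` moves everything before `v` in the tour
      -- of `c` into the suffix, closing `r` moves everything after `v` into the prefix. The size
      -- equation for the tree of `v` within `c` is thus replaced by a count of all open-nodes in
      -- the tour of `c`.
      have ec := congrArg openCount e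
      rw [openCount_tour, openCount_append, ← List.singleton_append, openCount_append,
        openCount_append, openCount_tour, ← List.singleton_append (l := R), openCount_append,
        hA.openCount_eq, hB.openCount_eq] at ec
      have eo : openCount [(v, true)] = 1 := rfl
      have eo' : openCount [(v, false)] = 0 := rfl
      refine ⟨(r, true) :: L, R ++ (r, false) :: s.tour, _, _, ?_,
        (IsDigest.single (r, true)).append hA,
        by simpa using (hB.append (IsDigest.single (r, false))).append s.isDigest_tour,
        ?_, ?_, ?_, ?_, ?_⟩
      · simp [tour, childForest, h1, h2, e]
      · simp [Digest.comb, Digest.single, tag, hpd]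
      · simp [Digest.comb, Digest.single, tag, hpd]
      · simp [Digest.comb, Digest.single, tag, hsd]
      · simp [Digest.comb, Digest.single, tag, hsd]
      · simp [Digest.comb, Digest.single, tag, hpd, hpp, hsd, hsp, treeOf, childForest, h1, h2]
        rw [eo, eo', hpp, hsp] at ec
        omega
    · have h3 : v ∈ s.labels := by simpa [labels, h1, h2] using hv
      obtain ⟨L, R, A, B, e, hA, hB, hpd, hpp, hsd, hsp, hl⟩ := ihs hs h3
      refine ⟨(r, true) :: (c.tour ++ (r, false) :: L), R, _, B, ?_,
        by simpa using (((IsDigest.single (r, true)).append c.isDigest_tour).append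
          (IsDigest.single (r, false))).append hA, hB, ?_, ?_, hsd, hsp, ?_⟩
      · simp [tour, childForest, h1, h2, e]
      · simp [Digest.comb, Digest.single, tag, hpd]
      · simp [Digest.comb, Digest.single, tag, hpd]
      · simp [Digest.comb, Digest.single, tag, hpd, treeOf, childForest, h1, h2, hl]

/-! ### Parents and children -/

section Child

variable {F : Forest V}

theorem IsChild.mem {u w : V} (h : F.IsChild u w) : u ∈ F.labels ∧ w ∈ F.labels := by
  induction F with
  | nil => exact h.elim
  | cons r c s ihc ihs =>
    simp only [labels, List.mem_cons, List.mem_append]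
    rcases h with ⟨rfl, h⟩ | h | h
    · exact ⟨.inl rfl, .inr (.inl (c.roots_subset_labels h))⟩
    · exact ⟨.inr (.inl (ihc h).1), .inr (.inl (ihc h).2)⟩
    · exact ⟨.inr (.inr (ihs h).1), .inr (.inr (ihs h).2)⟩

theorem nodup_cons_iff {r : V} {c s : Forest V} : (cons r c s).labels.Nodup ↔
    (r ∉ c.labels ∧ r ∉ s.labels) ∧ c.labels.Nodup ∧ s.labels.Nodup ∧
      ∀ a ∈ c.labels, a ∉ s.labels := by
  simp only [labels, List.nodup_cons, List.mem_append, not_or, List.nodup_append]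
  refine and_congr Iff.rfl (and_congr Iff.rfl (and_congr Iff.rfl ?_))
  exact ⟨fun h a ha hb => h a ha a hb rfl, fun h a ha b hb e => h a ha (e ▸ hb)⟩

theorem isChild_cons_root {r : V} {c s : Forest V} (h : (cons r c s).labels.Nodup) {w : V} :
    (cons r c s).IsChild r w ↔ w ∈ c.roots := by
  obtain ⟨⟨hrc, hrs⟩, -⟩ := nodup_cons_iff.1 h
  refine ⟨?_, fun h => .inl ⟨rfl, h⟩⟩
  rintro (⟨-, h⟩ | h | h)
  · exact h
  · exact absurd h.mem.1 hrc
  · exact absurd h.mem.1 hrs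

theorem isChild_cons_of_mem_left {r : V} {c s : Forest V} (h : (cons r c s).labels.Nodup)
    {u w : V} (hu : u ∈ c.labels) : (cons r c s).IsChild u w ↔ c.IsChild u w := by
  obtain ⟨⟨hrc, hrs⟩, -, -, hcs⟩ := nodup_cons_iff.1 h
  refine ⟨?_, fun h => .inr (.inl h)⟩
  rintro (⟨rfl, h⟩ | h | h)
  · exact absurd hu hrc
  · exact h
  · exact absurd h.mem.1 (hcs u hu)

theorem isChild_cons_of_mem_right {r : V} {c s : Forest V} (h : (cons r c s).labels.Nodup)
    {u w : V} (hu : u ∈ s.labels) : (cons r c s).IsChild u w ↔ s.IsChild u w := by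
  obtain ⟨⟨hrc, hrs⟩, -, -, hcs⟩ := nodup_cons_iff.1 h
  refine ⟨?_, fun h => .inr (.inr h)⟩
  rintro (⟨rfl, h⟩ | h | h)
  · exact absurd hu hrs
  · exact absurd hu (hcs u h.mem.1)
  · exact h

theorem IsChild.notMem_roots (hF : F.labels.Nodup) {u w : V} (h : F.IsChild u w) :
    w ∉ F.roots := by
  induction F with
  | nil => exact h.elim
  | cons r c s ihc ihs =>
    obtain ⟨⟨hrc, hrs⟩, hc, hs, hcs⟩ := nodup_cons_iff.1 hF
    have aux : ∀ {w}, w ∈ c.labels → w ∉ (cons r c s).roots := by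
      intro w hw hw'
      rcases List.mem_cons.1 hw' with rfl | hw'
      · exact hrc hw
      · exact hcs w hw (s.roots_subset_labels hw')
    rcases h with ⟨rfl, h⟩ | h | h
    · exact aux (c.roots_subset_labels h)
    · exact aux h.mem.2
    · intro hw
      rcases List.mem_cons.1 hw with rfl | hw
      · exact hrs h.mem.2
      · exact ihs hs h hw

theorem IsChild.parent_unique (hF : F.labels.Nodup) {u u' w : V} (h : F.IsChild u w)
    (h' : F.IsChild u' w) : u = u' := by
  induction F with
  | nil => exact h.elim
  | cons r c s ihc ihs =>
    obtain ⟨⟨hrc, hrs⟩, hc, hs, hcs⟩ := nodup_cons_iff.1 hF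
    rcases h with ⟨rfl, h⟩ | h | h <;> rcases h' with ⟨rfl, h'⟩ | h' | h'
    · rfl
    · exact absurd h (h'.notMem_roots hc)
    · exact absurd h'.mem.2 (hcs w (c.roots_subset_labels h))
    · exact absurd h' (h.notMem_roots hc)
    · exact ihc hc h h'
    · exact absurd h'.mem.2 (hcs w h.mem.2)
    · exact absurd h.mem.2 (hcs w (c.roots_subset_labels h'))
    · exact absurd h.mem.2 (hcs w h'.mem.2)
    · exact ihs hs h h'

/-- `labels` lists the vertices in preorder, parents before children; this excludes cycles in the
descent. -/
theorem IsChild.idxOf_lt [DecidableEq V] (hF : F.labels.Nodup) {u w : V} (h : F.IsChild u w) :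
    F.labels.idxOf u < F.labels.idxOf w := by
  induction F with
  | nil => exact h.elim
  | cons r c s ihc ihs =>
    obtain ⟨⟨hrc, hrs⟩, hc, hs, hcs⟩ := nodup_cons_iff.1 hF
    have hne : ∀ {w}, w ∈ c.labels ∨ w ∈ s.labels → r ≠ w := by
      rintro w (hw | hw) rfl
      · exact hrc hw
      · exact hrs hw
    rw [labels]
    rcases h with ⟨rfl, h⟩ | h | h
    · rw [List.idxOf_cons_self, List.idxOf_cons_ne _ (hne (.inl (c.roots_subset_labels h)))]
      omega
    · rw [List.idxOf_cons_ne _ (hne (.inl h.mem.1)), List.idxOf_cons_ne _ (hne (.inl h.mem.2)),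
        List.idxOf_append_of_mem h.mem.1, List.idxOf_append_of_mem h.mem.2]
      have := ihc hc h
      omega
    · rw [List.idxOf_cons_ne _ (hne (.inr h.mem.1)), List.idxOf_cons_ne _ (hne (.inr h.mem.2)),
        List.idxOf_append_of_notMem fun hu => hcs u hu h.mem.1,
        List.idxOf_append_of_notMem fun hu => hcs w hu h.mem.2]
      have := ihs hs h
      omega

/-- `F.Desc u w`: the vertex `w` is in the subtree rooted in `u`. -/
def Desc (F : Forest V) : V → V → Prop := Relation.ReflTransGen F.IsChild

theorem Desc.idxOf_le [DecidableEq V] (hF : F.labels.Nodup) {u w : V} (h : F.Desc u w) :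
    F.labels.idxOf u ≤ F.labels.idxOf w := by
  induction h with
  | refl => rfl
  | tail _ h ih => exact ih.trans (h.idxOf_lt hF).le

theorem Desc.mono {F G : Forest V} (h : ∀ u w, F.IsChild u w → G.IsChild u w) {u w : V}
    (hd : F.Desc u w) : G.Desc u w :=
  Relation.ReflTransGen.mono h _ _ hd

/-- If the vertices of `G` have the same children in `F` as in `G`, a descent that starts in `G`
never leaves it. -/
theorem desc_iff_of_closed {F G : Forest V}
    (h : ∀ u ∈ G.labels, ∀ w, F.IsChild u w ↔ G.IsChild u w) {u w : V} (hu : u ∈ G.labels) :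
    F.Desc u w ↔ G.Desc u w := by
  constructor
  · intro hd
    have : G.Desc u w ∧ w ∈ G.labels := by
      induction hd with
      | refl => exact ⟨.refl, hu⟩
      | tail _ hc ih =>
        have hc' := (h _ ih.2 _).1 hc
        exact ⟨ih.1.tail hc', hc'.mem.2⟩
    exact this.1
  · intro hd
    induction hd with
    | refl => exact .refl
    | tail _ hc ih => exact ih.tail ((h _ hc.mem.1 _).2 hc)

theorem exists_root_desc {u : V} (hu : u ∈ F.labels) : ∃ ρ ∈ F.roots, F.Desc ρ u := by
  induction F with
  | nil => simp [labels] at hu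
  | cons r c s ihc ihs =>
    simp only [labels, List.mem_cons, List.mem_append] at hu
    rcases hu with rfl | hu | hu
    · exact ⟨u, by simp [roots], .refl⟩
    · obtain ⟨ρ, hρ, hd⟩ := ihc hu
      exact ⟨r, by simp [roots], .head (.inl ⟨rfl, hρ⟩)
        (hd.mono (G := cons r c s) fun _ _ h => Or.inr (.inl h))⟩
    · obtain ⟨ρ, hρ, hd⟩ := ihs hu
      exact ⟨ρ, by simp [roots, hρ], hd.mono (G := cons r c s) fun _ _ h => Or.inr (.inr h)⟩

theorem mem_cons_labels_iff {r : V} {c s : Forest V} (h : (cons r c s).labels.Nodup) {u : V} :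
    u ∈ r :: c.labels ↔ (cons r c s).Desc r u := by
  obtain ⟨⟨hrc, hrs⟩, -, -, hcs⟩ := nodup_cons_iff.1 h
  constructor
  · intro hu
    rcases List.mem_cons.1 hu with rfl | hu
    · exact .refl
    · obtain ⟨ρ, hρ, hd⟩ := exists_root_desc hu
      exact .head (.inl ⟨rfl, hρ⟩)
        (hd.mono (G := cons r c s) fun _ _ h => Or.inr (.inl h))
  · intro hd
    induction hd with
    | refl => simp
    | tail _ hc ih =>
      rcases hc with ⟨-, hc⟩ | hc | hc
      · exact List.mem_cons_of_mem _ (c.roots_subset_labels hc)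
      · exact List.mem_cons_of_mem _ hc.mem.2
      · exfalso
        rcases List.mem_cons.1 ih with rfl | hu
        · exact hrs hc.mem.1
        · exact hcs _ hu hc.mem.1

theorem exists_root_of_mem_treeLabels (hF : F.labels.Nodup) {st : List V}
    (hst : st ∈ F.treeLabels) : ∃ ρ ∈ F.roots, ∀ u, u ∈ st ↔ F.Desc ρ u := by
  induction F with
  | nil => simp [treeLabels] at hst
  | cons r c s ihc ihs =>
    obtain ⟨⟨hrc, hrs⟩, hc, hs, hcs⟩ := nodup_cons_iff.1 hF
    rcases List.mem_cons.1 hst with rfl | hst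
    · exact ⟨r, by simp [roots], fun u => mem_cons_labels_iff hF⟩
    · obtain ⟨ρ, hρ, h⟩ := ihs hs hst
      refine ⟨ρ, by simp [roots, hρ], fun u => (h u).trans (desc_iff_of_closed ?_ ?_).symm⟩
      · exact fun u hu w => isChild_cons_of_mem_right hF hu
      · exact s.roots_subset_labels hρ

theorem childForest_labels_sublist [DecidableEq V] (F : Forest V) (v : V) :
    (F.childForest v).labels.Sublist F.labels := by
  induction F with
  | nil => simp [childForest]
  | cons r c s ihc ihs =>
    rw [childForest, labels]
    split_ifs
    · exact (List.sublist_append_left _ _).trans (List.sublist_cons_self _ _)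
    · exact (ihc.trans (List.sublist_append_left _ _)).trans (List.sublist_cons_self _ _)
    · exact (ihs.trans (List.sublist_append_right _ _)).trans (List.sublist_cons_self _ _)

theorem isChild_iff_mem_roots_childForest [DecidableEq V] (hF : F.labels.Nodup)
    {v w : V} (hv : v ∈ F.labels) :
    F.IsChild v w ↔ w ∈ (F.childForest v).roots := by
  induction F with
  | nil => simp [labels] at hv
  | cons r c s ihc ihs =>
    obtain ⟨⟨hrc, hrs⟩, hc, hs, hcs⟩ := nodup_cons_iff.1 hF
    rw [childForest]
    split_ifs with h1 h2
    · subst h1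
      exact isChild_cons_root hF
    · rw [isChild_cons_of_mem_left hF h2, ihc hc h2]
    · have h3 : v ∈ s.labels := by simpa [labels, h1, h2] using hv
      rw [isChild_cons_of_mem_right hF h3, ihs hs h3]

theorem isChild_iff_childForest_isChild [DecidableEq V]
    (hF : F.labels.Nodup) {v u w : V} (hv : v ∈ F.labels)
    (hu : u ∈ (F.childForest v).labels) : F.IsChild u w ↔ (F.childForest v).IsChild u w := by
  induction F with
  | nil => simp [labels] at hv
  | cons r c s ihc ihs =>
    obtain ⟨⟨hrc, hrs⟩, hc, hs, hcs⟩ := nodup_cons_iff.1 hF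
    rw [childForest] at hu ⊢
    split_ifs at hu ⊢ with h1 h2
    · exact isChild_cons_of_mem_left hF hu
    · rw [isChild_cons_of_mem_left hF ((c.childForest_labels_sublist v).subset hu), ihc hc h2 hu]
    · have h3 : v ∈ s.labels := by simpa [labels, h1, h2] using hv
      rw [isChild_cons_of_mem_right hF ((s.childForest_labels_sublist v).subset hu),
        ihs hs h3 hu]

theorem exists_child_of_mem_childSubtrees [DecidableEq V]
    (hF : F.labels.Nodup) {v : V} (hv : v ∈ F.labels)
    {st : List V} (hst : st ∈ F.childSubtrees v) :
    ∃ ρ, F.IsChild v ρ ∧ ∀ u, u ∈ st ↔ F.Desc ρ u := by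
  obtain ⟨ρ, hρ, h⟩ :=
    exists_root_of_mem_treeLabels (hF.sublist (F.childForest_labels_sublist v)) hst
  refine ⟨ρ, (isChild_iff_mem_roots_childForest hF hv).2 hρ,
    fun u => (h u).trans (desc_iff_of_closed ?_ ?_).symm⟩
  · exact fun u hu w => isChild_iff_childForest_isChild hF hv hu
  · exact roots_subset_labels _ hρ

theorem mem_subtree_iff [DecidableEq V] (hF : F.labels.Nodup) {v u : V} (hv : v ∈ F.labels) :
    u ∈ F.subtree v ↔ F.Desc v u := by
  have hcl := fun u hu w => isChild_iff_childForest_isChild (w := w) (u := u) hF hv hu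
  constructor
  · intro hu
    rcases List.mem_cons.1 hu with rfl | hu
    · exact .refl
    · obtain ⟨ρ, hρ, hd⟩ := exists_root_desc hu
      exact .head ((isChild_iff_mem_roots_childForest hF hv).2 hρ)
        ((desc_iff_of_closed hcl (roots_subset_labels _ hρ)).2 hd)
  · intro hd
    rw [subtree, List.mem_cons]
    induction hd with
    | refl => exact .inl rfl
    | tail _ hc ih =>
      rcases ih with rfl | ih
      · exact .inr (roots_subset_labels _ ((isChild_iff_mem_roots_childForest hF hv).1 hc))
      · exact .inr ((hcl _ ih _).1 hc).mem.2

theorem notMem_childForest_labels [DecidableEq V] (hF : F.labels.Nodup) {v : V} :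
    v ∉ (F.childForest v).labels := by
  induction F with
  | nil => simp [childForest, labels]
  | cons r c s ihc ihs =>
    obtain ⟨⟨hrc, hrs⟩, hc, hs, hcs⟩ := nodup_cons_iff.1 hF
    rw [childForest]
    split_ifs with h1
    · exact h1 ▸ hrc
    · exact ihc hc
    · exact ihs hs

theorem treeOf_mem_treeLabels [DecidableEq V] {v : V} (hv : v ∈ F.labels) :
    F.treeOf v ∈ F.treeLabels ∧ v ∈ F.treeOf v := by
  induction F with
  | nil => simp [labels] at hv
  | cons r c s ihc ihs =>
    rw [treeOf, treeLabels]
    split_ifs with h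
    · exact ⟨by simp, h⟩
    · have h3 : v ∈ s.labels := by
        simp only [labels, List.mem_cons, List.mem_append] at hv h; tauto
      exact ⟨List.mem_cons_of_mem _ (ihs h3).1, (ihs h3).2⟩

theorem treeOf_sublist [DecidableEq V] (F : Forest V) (v : V) : (F.treeOf v).Sublist F.labels := by
  induction F with
  | nil => simp [treeOf]
  | cons r c s _ ihs =>
    rw [treeOf, labels]
    split_ifs
    · exact (List.sublist_append_left _ _).cons_cons _
    · exact (ihs.trans (List.sublist_append_right _ _)).trans (List.sublist_cons_self _ _)

end Child

end Forest

namespace Forest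

variable {V : Type u} {F : Forest V}

/-! ### The graph of a forest -/

theorem IsChild.ne [DecidableEq V] (hF : F.labels.Nodup) {u w : V} (h : F.IsChild u w) :
    u ≠ w := by
  rintro rfl
  exact lt_irrefl _ (h.idxOf_lt hF)

theorem IsChild.not_desc [DecidableEq V] (hF : F.labels.Nodup) {u w : V} (h : F.IsChild u w) :
    ¬ F.Desc w u :=
  fun hd => absurd (hd.idxOf_le hF) (not_le.2 (h.idxOf_lt hF))

theorem IsChild.adj [DecidableEq V] (hF : F.labels.Nodup) {u w : V} (h : F.IsChild u w) :
    F.graph.Adj u w :=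
  (SimpleGraph.fromRel_adj _ _ _).2 ⟨h.ne hF, .inl h⟩

/-- Parents are unique, so the only edge leaving the subtree rooted in `ρ` joins `ρ` to its parent.
All statements about components rest on this. -/
theorem desc_of_adj (hF : F.labels.Nodup) {ρ x y : V} (hx : F.Desc ρ x) (h : F.graph.Adj x y) :
    F.Desc ρ y ∨ (x = ρ ∧ F.IsChild y x) := by
  obtain ⟨-, h | h⟩ := (SimpleGraph.fromRel_adj _ _ _).1 h
  · exact .inl (hx.tail h)
  · rcases Relation.ReflTransGen.cases_tail hx with h0 | ⟨b, hb, hbx⟩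
    · exact .inr ⟨h0, h⟩
    · obtain rfl := hbx.parent_unique hF h
      exact .inl hb

/-- Every edge is a bridge: once the edge from `w` to its parent is deleted, no walk leaves the
subtree of `w`. -/
theorem graph_isAcyclic [DecidableEq V] (hF : F.labels.Nodup) : F.graph.IsAcyclic := by
  rw [SimpleGraph.isAcyclic_iff_forall_isBridge]
  have key : ∀ {u w : V}, F.IsChild u w → F.graph.IsBridge s(w, u) := by
    intro u w h
    rw [SimpleGraph.isBridge_iff]
    rintro ⟨p⟩
    have : ∀ {a b : V}, (F.graph.deleteEdges {s(w, u)}).Walk a b → F.Desc w a → F.Desc w b := by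
      intro a b q
      induction q with
      | nil => exact id
      | cons hadj q ih =>
        intro ha
        rw [SimpleGraph.deleteEdges_adj] at hadj
        rcases desc_of_adj hF ha hadj.1 with hd | ⟨rfl, hd⟩
        · exact ih hd
        · obtain rfl := hd.parent_unique hF h
          exact absurd rfl hadj.2
    exact h.not_desc hF (this p .refl)
  intro e he
  induction e with
  | _ u w =>
    obtain ⟨-, h | h⟩ := (SimpleGraph.fromRel_adj _ _ _).1 ((SimpleGraph.mem_edgeSet _).1 he)
    · rw [Sym2.eq_swap]; exact key h
    · exact key h

theorem isPath_unique [DecidableEq V] (hF : F.labels.Nodup) {s t : V} {p q : F.graph.Walk s t}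
    (hp : p.IsPath) (hq : q.IsPath) : p = q :=
  congrArg Subtype.val (((graph_isAcyclic hF).subsingleton_path s t).elim ⟨p, hp⟩ ⟨q, hq⟩)

theorem Desc.exists_walk [DecidableEq V] (hF : F.labels.Nodup) {a u : V} (h : F.Desc a u) :
    ∃ p : F.graph.Walk a u, ∀ x ∈ p.support, F.Desc a x ∧ F.Desc x u := by
  induction h with
  | refl => exact ⟨.nil, fun x hx => by simp at hx; subst hx; exact ⟨.refl, .refl⟩⟩
  | tail h hc ih =>
    obtain ⟨p, hp⟩ := ih
    refine ⟨p.concat (hc.adj hF), fun x hx => ?_⟩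
    rw [SimpleGraph.Walk.support_concat, List.mem_append] at hx
    rcases hx with hx | hx
    · exact ⟨(hp x hx).1, (hp x hx).2.tail hc⟩
    · rw [List.mem_singleton] at hx
      subst hx
      exact ⟨h.tail hc, .refl⟩

theorem exists_root_treeOf [DecidableEq V] (hF : F.labels.Nodup) {v : V} (hv : v ∈ F.labels) :
    ∃ ρ ∈ F.roots, ∀ u, u ∈ F.treeOf v ↔ F.Desc ρ u :=
  exists_root_of_mem_treeLabels hF (treeOf_mem_treeLabels hv).1

theorem mem_treeOf_of_adj [DecidableEq V] (hF : F.labels.Nodup) {v : V} (hv : v ∈ F.labels)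
    {x y : V} (hx : x ∈ F.treeOf v) (h : F.graph.Adj x y) : y ∈ F.treeOf v := by
  obtain ⟨ρ, hρ, hd⟩ := exists_root_treeOf hF hv
  rw [hd] at hx ⊢
  rcases desc_of_adj hF hx h with h | ⟨rfl, h⟩
  · exact h
  · exact absurd hρ (h.notMem_roots hF)

/-- No edge leaves a tree, since its root has no parent; conversely, all its vertices are joined to
the root. -/
theorem reachable_iff_mem_treeOf [DecidableEq V] (hF : F.labels.Nodup) {v : V}
    (hv : v ∈ F.labels) {u : V} : F.graph.Reachable v u ↔ u ∈ F.treeOf v := by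
  constructor
  · rintro ⟨p⟩
    have : ∀ {a b : V}, F.graph.Walk a b → a ∈ F.treeOf v → b ∈ F.treeOf v := by
      intro a b q
      induction q with
      | nil => exact id
      | cons hadj q ih => exact fun ha => ih (mem_treeOf_of_adj hF hv ha hadj)
    exact this p (treeOf_mem_treeLabels hv).2
  · intro hu
    obtain ⟨ρ, -, hd⟩ := exists_root_treeOf hF hv
    obtain ⟨p, -⟩ := ((hd u).1 hu).exists_walk hF
    obtain ⟨q, -⟩ := ((hd v).1 (treeOf_mem_treeLabels hv).2).exists_walk hF
    exact ⟨q.reverse.append p⟩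

/-- The vertices of the tree containing `v` that are not below `v`. -/
def aboveList [DecidableEq V] (F : Forest V) (v : V) : List V :=
  (F.treeOf v).filter (fun u => u ∉ F.subtree v)

/-- The vertex lists of the components that remain of the tree containing `v` without `v`. -/
def parts [DecidableEq V] (F : Forest V) (v : V) : List (List V) :=
  F.aboveList v :: F.childSubtrees v

theorem subtree_subset_treeOf [DecidableEq V] (hF : F.labels.Nodup) {v : V}
    (hv : v ∈ F.labels) : F.subtree v ⊆ F.treeOf v := by
  intro u hu
  obtain ⟨ρ, -, hd⟩ := exists_root_treeOf hF hv
  rw [hd]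
  exact ((hd v).1 (treeOf_mem_treeLabels hv).2).trans ((mem_subtree_iff hF hv).1 hu)

theorem subtree_nodup [DecidableEq V] (hF : F.labels.Nodup) (v : V) : (F.subtree v).Nodup :=
  List.nodup_cons.2 ⟨notMem_childForest_labels hF, hF.sublist (F.childForest_labels_sublist v)⟩

theorem above_eq [DecidableEq V] (hF : F.labels.Nodup) {v : V} (hv : v ∈ F.labels) :
    F.above v = {u | u ∈ F.aboveList v} := by
  ext u
  simp only [above, Set.mem_ofPred_eq, aboveList, List.mem_filter, decide_eq_true_eq,
    reachable_iff_mem_treeOf hF hv]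
  exact ⟨fun h => h.2, fun h => ⟨(F.treeOf_sublist v).subset h.1, h⟩⟩

theorem aboveList_nodup [DecidableEq V] (hF : F.labels.Nodup) (v : V) : (F.aboveList v).Nodup :=
  (hF.sublist (F.treeOf_sublist v)).filter _

theorem above_ncard_eq_length [DecidableEq V] (hF : F.labels.Nodup) {v : V}
    (hv : v ∈ F.labels) : (F.above v).ncard = (F.aboveList v).length := by
  rw [above_eq hF hv, ← List.coe_toFinset, Set.ncard_coe_finset,
    List.toFinset_card_of_nodup (aboveList_nodup hF v)]

theorem aboveList_length_add [DecidableEq V] (hF : F.labels.Nodup) {v : V} (hv : v ∈ F.labels) :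
    (F.aboveList v).length + ((F.childForest v).labels.length + 1) = (F.treeOf v).length := by
  have h := List.length_eq_length_filter_add (l := F.treeOf v) (fun u => decide (u ∈ F.subtree v))
  have hperm : ((F.treeOf v).filter (fun u => decide (u ∈ F.subtree v))).Perm (F.subtree v) := by
    rw [List.perm_ext_iff_of_nodup ((hF.sublist (F.treeOf_sublist v)).filter _)
      (subtree_nodup hF v)]
    intro u
    simp only [List.mem_filter, decide_eq_true_eq]
    exact ⟨fun h => h.2, fun h => ⟨subtree_subset_treeOf hF hv h, h⟩⟩
  rw [hperm.length_eq] at h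
  have e : F.aboveList v = (F.treeOf v).filter (fun u => !decide (u ∈ F.subtree v)) := by
    simp [aboveList]
  rw [e, h]
  simp only [subtree, List.length_cons]
  omega

theorem flatten_parts_nodup [DecidableEq V] (hF : F.labels.Nodup) (v : V) :
    (F.parts v).flatten.Nodup := by
  rw [parts, List.flatten_cons, childSubtrees, ← labels_eq_flatten, List.nodup_append]
  refine ⟨aboveList_nodup hF v, hF.sublist (F.childForest_labels_sublist v), ?_⟩
  rintro a ha b hb rfl
  have := (List.mem_filter.1 ha).2
  simp [subtree, hb] at this

theorem mem_flatten_parts [DecidableEq V] (hF : F.labels.Nodup) {v : V} (hv : v ∈ F.labels)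
    {u : V} : u ∈ (F.parts v).flatten ↔ u ∈ F.treeOf v ∧ u ≠ v := by
  have hs : F.subtree v = v :: (F.childForest v).labels := rfl
  rw [parts, List.flatten_cons, childSubtrees, ← labels_eq_flatten, List.mem_append, aboveList,
    List.mem_filter, decide_eq_true_eq]
  constructor
  · rintro (⟨h1, h2⟩ | h)
    · exact ⟨h1, fun e => h2 (by simp [hs, e])⟩
    · exact ⟨subtree_subset_treeOf hF hv (by simp [hs, h]),
        fun e => notMem_childForest_labels hF (e ▸ h)⟩
  · rintro ⟨h1, h2⟩
    by_cases h : u ∈ F.subtree v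
    · exact .inr (by simpa [hs, h2] using h)
    · exact .inl ⟨h1, h⟩

/-- The subtree of `v` can be entered from above only at `v`, and the subtree of a child of `v` can
be left only towards `v`. -/
theorem mem_part_of_adj [DecidableEq V] (hF : F.labels.Nodup) {v : V} (hv : v ∈ F.labels)
    {P : List V} (hP : P ∈ F.parts v) {x y : V} (hx : x ∈ P) (h : F.graph.Adj x y)
    (hy : y ≠ v) : y ∈ P := by
  rcases List.mem_cons.1 hP with rfl | hP
  · simp only [aboveList, List.mem_filter, decide_eq_true_eq, mem_subtree_iff hF hv] at hx ⊢
    refine ⟨mem_treeOf_of_adj hF hv hx.1 h, fun hd => ?_⟩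
    rcases desc_of_adj hF hd h.symm with h' | ⟨h', -⟩
    · exact hx.2 h'
    · exact hy h'
  · obtain ⟨ρ, hρ, hd⟩ := exists_child_of_mem_childSubtrees hF hv hP
    rw [hd] at hx ⊢
    rcases desc_of_adj hF hx h with h' | ⟨rfl, h'⟩
    · exact h'
    · exact absurd (h'.parent_unique hF hρ) hy

/-- Both ends are reached by descending from one vertex: the root of the tree for the part above
`v`, the child of `v` for a child subtree. The vertices on the way are ancestors of the end and
descendants of the start, hence not `v`. -/
theorem exists_walk_of_mem_part [DecidableEq V] (hF : F.labels.Nodup) {v : V}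
    (hv : v ∈ F.labels) {P : List V} (hP : P ∈ F.parts v) {s t : V} (hs : s ∈ P) (ht : t ∈ P) :
    ∃ p : F.graph.Walk s t, v ∉ p.support := by
  suffices h : ∃ ρ, ∀ u ∈ P, ∃ p : F.graph.Walk ρ u, v ∉ p.support by
    obtain ⟨ρ, h⟩ := h
    obtain ⟨p, hp⟩ := h s hs
    obtain ⟨q, hq⟩ := h t ht
    refine ⟨p.reverse.append q, ?_⟩
    rw [SimpleGraph.Walk.mem_support_append_iff, SimpleGraph.Walk.support_reverse,
      List.mem_reverse]
    tauto
  rcases List.mem_cons.1 hP with rfl | hP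
  · obtain ⟨ρ, -, hd⟩ := exists_root_treeOf hF hv
    refine ⟨ρ, fun u hu => ?_⟩
    simp only [aboveList, List.mem_filter, decide_eq_true_eq, mem_subtree_iff hF hv] at hu
    obtain ⟨p, hp⟩ := ((hd u).1 hu.1).exists_walk hF
    exact ⟨p, fun h => hu.2 (hp v h).2⟩
  · obtain ⟨ρ, hρ, hd⟩ := exists_child_of_mem_childSubtrees hF hv hP
    refine ⟨ρ, fun u hu => ?_⟩
    obtain ⟨p, hp⟩ := ((hd u).1 hu).exists_walk hF
    exact ⟨p, fun h => hρ.not_desc hF (hp v h).1⟩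

/-- The path between `s` and `t` passes through `v` if and only if `s` and `t` are in different
components of what remains of the tree containing `v` without `v`. -/
theorem exists_path_through_iff [DecidableEq V] (hF : F.labels.Nodup) {v : V}
    (hv : v ∈ F.labels) {s t : V} (hs : s ≠ v) (ht : t ≠ v) :
    (∃ p : F.graph.Walk s t, p.IsPath ∧ v ∈ p.support) ↔
      s ∈ (F.parts v).flatten ∧ t ∈ (F.parts v).flatten ∧
        ¬ ∃ P ∈ F.parts v, s ∈ P ∧ t ∈ P := by
  rw [mem_flatten_parts hF hv, mem_flatten_parts hF hv, ← reachable_iff_mem_treeOf hF hv,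
    ← reachable_iff_mem_treeOf hF hv]
  constructor
  · rintro ⟨p, hp, hvp⟩
    refine ⟨⟨⟨(p.takeUntil v hvp).reverse⟩, hs⟩, ⟨⟨p.dropUntil v hvp⟩, ht⟩, ?_⟩
    rintro ⟨P, hP, hsP, htP⟩
    obtain ⟨q, hq⟩ := exists_walk_of_mem_part hF hv hP hsP htP
    -- The path extracted from `q` uses only vertices of `q` and, by uniqueness, is `p`, which
    -- contains `v`.
    have e := isPath_unique hF hp q.toPath.2
    apply hq
    apply q.support_toPath_subset_support
    rw [← e]
    exact hvp
  · rintro ⟨⟨h1, -⟩, ⟨h2, -⟩, h3⟩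
    obtain ⟨w⟩ := h1.symm.trans h2
    refine ⟨w.toPath, w.toPath.2, ?_⟩
    by_contra hvw
    have hs' : s ∈ (F.parts v).flatten :=
      (mem_flatten_parts hF hv).2 ⟨(reachable_iff_mem_treeOf hF hv).1 h1, hs⟩
    obtain ⟨P, hP, hsP⟩ := List.mem_flatten.1 hs'
    have : ∀ {a b : V} (q : F.graph.Walk a b), v ∉ q.support → a ∈ P → b ∈ P := by
      intro a b q
      induction q with
      | nil => exact fun _ => id
      | cons hadj q ih =>
        intro hvq ha
        rw [SimpleGraph.Walk.support_cons, List.mem_cons, not_or] at hvq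
        refine ih hvq.2 (mem_part_of_adj hF hv hP ha hadj fun e => hvq.2 ?_)
        rw [← e]
        exact q.start_mem_support
    exact h3 ⟨P, hP, hsP, this _ hvw hsP⟩

theorem exists_path_through_symm {v s t : V}
    (h : ∃ p : F.graph.Walk s t, p.IsPath ∧ v ∈ p.support) :
    ∃ p : F.graph.Walk t s, p.IsPath ∧ v ∈ p.support := by
  obtain ⟨p, hp, hv⟩ := h
  exact ⟨p.reverse, hp.reverse, by simpa using hv⟩

/-- A walk of minimal length is a path, and paths are unique. -/
theorem setOf_length_eq_dist [DecidableEq V] (hF : F.labels.Nodup) {s t : V}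
    (p : F.graph.Walk s t) (hp : p.IsPath) :
    {q : F.graph.Walk s t | q.length = F.graph.dist s t} = {p} := by
  have huniq : ∀ q : F.graph.Walk s t, q.length = F.graph.dist s t → q = p := fun q hq =>
    isPath_unique hF (q.isPath_of_length_eq_dist hq) hp
  obtain ⟨q, hq⟩ := SimpleGraph.Reachable.exists_walk_length_eq_dist (u := s) (v := t) ⟨p⟩
  ext q'
  refine ⟨fun h => huniq q' h, ?_⟩
  rintro rfl
  exact huniq q hq ▸ hq

open Classical in
theorem numShortestThrough_div [DecidableEq V] (hF : F.labels.Nodup) (s t v : V) :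
    (numShortestThrough F.graph s t v : ℚ) / (numShortest F.graph s t : ℚ) =
      if ∃ p : F.graph.Walk s t, p.IsPath ∧ v ∈ p.support then 1 else 0 := by
  by_cases hr : F.graph.Reachable s t
  · obtain ⟨w⟩ := hr
    obtain ⟨p, hp⟩ := w.toPath
    have h1 := setOf_length_eq_dist hF p hp
    have h2 : {q : F.graph.Walk s t | q.length = F.graph.dist s t ∧ v ∈ q.support} =
        {q | q ∈ ({p} : Set (F.graph.Walk s t)) ∧ v ∈ q.support} := by
      rw [← h1]; rfl
    rw [numShortest, numShortestThrough, h1, h2]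
    by_cases hv : v ∈ p.support
    · rw [if_pos ⟨p, hp, hv⟩]
      have : {q | q ∈ ({p} : Set (F.graph.Walk s t)) ∧ v ∈ q.support} = {p} := by
        ext q
        exact ⟨fun h => h.1, fun h => ⟨h, by rw [Set.mem_singleton_iff.1 h]; exact hv⟩⟩
      rw [this]
      simp
    · rw [if_neg]
      · have : {q | q ∈ ({p} : Set (F.graph.Walk s t)) ∧ v ∈ q.support} = ∅ := by
          ext q
          refine ⟨fun h => hv ?_, fun h => h.elim⟩
          rw [← Set.mem_singleton_iff.1 h.1]
          exact h.2
        rw [this]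
        simp
      · rintro ⟨q, hq, hvq⟩
        exact hv (isPath_unique hF hq hp ▸ hvq)
  -- In different trees the denominator is 0, and division by 0 yields the intended value 0.
  · rw [if_neg fun ⟨p, _⟩ => hr ⟨p⟩, numShortest]
    have : {p : F.graph.Walk s t | p.length = F.graph.dist s t} = ∅ :=
      Set.eq_empty_of_forall_notMem fun p _ => hr ⟨p⟩
    simp [this]

/-! ### Counting pairs -/

theorem card_same_part {α : Type*} [DecidableEq α] {Ps : List (List α)} (h : Ps.flatten.Nodup) :
    ((Ps.flatten.toFinset ×ˢ Ps.flatten.toFinset).filter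
      fun e => ∃ P ∈ Ps, e.1 ∈ P ∧ e.2 ∈ P).card = (Ps.map fun P => P.length ^ 2).sum := by
  induction Ps with
  | nil => simp
  | cons P Ps ih =>
    rw [List.flatten_cons, List.nodup_append] at h
    obtain ⟨hP, hPs, hd⟩ := h
    have e : (((P :: Ps).flatten.toFinset ×ˢ (P :: Ps).flatten.toFinset).filter
        fun e => ∃ Q ∈ P :: Ps, e.1 ∈ Q ∧ e.2 ∈ Q) =
        (P.toFinset ×ˢ P.toFinset) ∪ ((Ps.flatten.toFinset ×ˢ Ps.flatten.toFinset).filter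
      fun e => ∃ P ∈ Ps, e.1 ∈ P ∧ e.2 ∈ P) := by
      ext ⟨a, b⟩
      simp only [Finset.mem_filter, Finset.mem_union, Finset.mem_product, List.mem_toFinset,
        List.mem_cons, exists_eq_or_imp, List.mem_flatten]
      constructor
      · rintro ⟨-, h | ⟨Q, hQ, ha, hb⟩⟩
        · exact .inl h
        · exact .inr ⟨⟨⟨Q, hQ, ha⟩, Q, hQ, hb⟩, Q, hQ, ha, hb⟩
      · rintro (⟨ha, hb⟩ | ⟨⟨h1, h2⟩, h3⟩)
        · exact ⟨⟨.inl ha, .inl hb⟩, .inl ⟨ha, hb⟩⟩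
        · exact ⟨⟨.inr h1, .inr h2⟩, .inr h3⟩
    rw [e, Finset.card_union_of_disjoint, ih hPs, Finset.card_product,
      List.toFinset_card_of_nodup hP, List.map_cons, List.sum_cons, pow_two]
    rw [Finset.disjoint_left]
    rintro ⟨a, b⟩ h1 h2
    simp only [Finset.mem_filter, Finset.mem_product, List.mem_toFinset] at h1 h2
    exact hd a h1.1 a h2.1.1 rfl

/-- The fibre over an unordered pair consists of its two orientations, which are distinct. -/
theorem card_image_sym2_mk {α : Type*} [DecidableEq α] {O : Finset (α × α)}
    (hsymm : ∀ a b, (a, b) ∈ O → (b, a) ∈ O) (hirr : ∀ a, (a, a) ∉ O) :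
    O.card = 2 * (O.image fun e => s(e.1, e.2)).card := by
  rw [Finset.card_eq_sum_card_image (fun e => s(e.1, e.2)) O, mul_comm]
  refine (Finset.sum_const_nat fun x hx => ?_)
  obtain ⟨⟨a, b⟩, hab, rfl⟩ := Finset.mem_image.1 hx
  have : O.filter (fun e => s(e.1, e.2) = s(a, b)) = {(a, b), (b, a)} := by
    ext ⟨c, d⟩
    simp only [Finset.mem_filter, Finset.mem_insert, Finset.mem_singleton, Sym2.eq_iff,
      Prod.mk.injEq]
    constructor
    · exact fun h => h.2
    · rintro (⟨rfl, rfl⟩ | ⟨rfl, rfl⟩)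
      · exact ⟨hab, .inl ⟨rfl, rfl⟩⟩
      · exact ⟨hsymm _ _ hab, .inr ⟨rfl, rfl⟩⟩
  rw [this, Finset.card_pair]
  intro e
  simp only [Prod.mk.injEq] at e
  exact hirr a (e.1 ▸ hab)

/-- The ordered pairs of vertices whose connecting path passes through `v`. -/
def throughPairs [DecidableEq V] (F : Forest V) (v : V) : Finset (V × V) :=
  ((F.parts v).flatten.toFinset ×ˢ (F.parts v).flatten.toFinset).filter
    fun e => ¬ ∃ P ∈ F.parts v, e.1 ∈ P ∧ e.2 ∈ P

theorem mem_throughPairs [DecidableEq V] (hF : F.labels.Nodup) {v : V} (hv : v ∈ F.labels)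
    {s t : V} : (s, t) ∈ F.throughPairs v ↔ s ≠ t ∧ s ≠ v ∧ t ≠ v ∧
      ∃ p : F.graph.Walk s t, p.IsPath ∧ v ∈ p.support := by
  simp only [throughPairs, Finset.mem_filter, Finset.mem_product, List.mem_toFinset]
  constructor
  · rintro ⟨⟨hs, ht⟩, h⟩
    have hs' := ((mem_flatten_parts hF hv).1 hs).2
    have ht' := ((mem_flatten_parts hF hv).1 ht).2
    refine ⟨?_, hs', ht', (exists_path_through_iff hF hv hs' ht').2 ⟨hs, ht, h⟩⟩
    rintro rfl
    obtain ⟨P, hP, hsP⟩ := List.mem_flatten.1 hs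
    exact h ⟨P, hP, hsP, hsP⟩
  · rintro ⟨-, hs, ht, h⟩
    obtain ⟨h1, h2, h3⟩ := (exists_path_through_iff hF hv hs ht).1 h
    exact ⟨⟨h1, h2⟩, h3⟩

/-- All pairs minus the pairs within one part: `(a + S)² - (a² + Q)`, where `a²` belongs to the part
above `v`. -/
theorem card_throughPairs [DecidableEq V] (hF : F.labels.Nodup) {v : V} (hv : v ∈ F.labels) :
    ((F.throughPairs v).card : ℤ) =
      2 * ((F.above v).ncard * ((F.childSubtrees v).map fun st => (st.length : ℤ)).sum) +
        (((F.childSubtrees v).map fun st => (st.length : ℤ)).sum ^ 2 -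
          ((F.childSubtrees v).map fun st => (st.length : ℤ) ^ 2).sum) := by
  have hn := flatten_parts_nodup hF v
  have h1 := card_same_part hn
  have h2 := Finset.card_filter_add_card_filter_not
    (s := (F.parts v).flatten.toFinset ×ˢ (F.parts v).flatten.toFinset)
    (fun e => ∃ P ∈ F.parts v, e.1 ∈ P ∧ e.2 ∈ P)
  rw [h1, Finset.card_product, List.toFinset_card_of_nodup hn] at h2
  change _ + (F.throughPairs v).card = _ at h2
  have h3 : ((F.parts v).flatten.length : ℤ) = (F.above v).ncard +
      ((F.childSubtrees v).map fun st => (st.length : ℤ)).sum := by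
    rw [above_ncard_eq_length hF hv, parts, List.flatten_cons, List.length_append,
      List.length_flatten]
    push_cast
    rw [List.map_map]
    rfl
  have h4 : ((((F.parts v).map fun P => P.length ^ 2).sum : ℕ) : ℤ) = (F.above v).ncard ^ 2 +
      ((F.childSubtrees v).map fun st => (st.length : ℤ) ^ 2).sum := by
    rw [above_ncard_eq_length hF hv, parts, List.map_cons, List.sum_cons]
    push_cast
    rw [List.map_map]
    congr 3
  zify at h2
  rw [h3] at h2
  push_cast at h4
  rw [h4] at h2
  linarith

theorem two_mul_ncard_pathsThrough [DecidableEq V] (hF : F.labels.Nodup) {v : V}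
    (hv : v ∈ F.labels) : 2 * (pathsThrough F v).ncard = (F.throughPairs v).card := by
  have e : pathsThrough F v =
      ((F.throughPairs v).image fun e => s(e.1, e.2) : Finset (Sym2 V)) := by
    ext x
    simp only [pathsThrough, Set.mem_ofPred_eq, Finset.coe_image, Set.mem_image, Finset.mem_coe]
    constructor
    · rintro ⟨s, t, rfl, h⟩
      exact ⟨(s, t), (mem_throughPairs hF hv).2 h, rfl⟩
    · rintro ⟨⟨s, t⟩, h, rfl⟩
      exact ⟨s, t, rfl, (mem_throughPairs hF hv).1 h⟩
  rw [e, Set.ncard_coe_finset, ← card_image_sym2_mk]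
  · intro a b h
    obtain ⟨h1, h2, h3, h4⟩ := (mem_throughPairs hF hv).1 h
    exact (mem_throughPairs hF hv).2 ⟨h1.symm, h3, h2, exists_path_through_symm h4⟩
  · exact fun a h => ((mem_throughPairs hF hv).1 h).1 rfl

theorem betweenness_eq_card [DecidableEq V] (hF : F.labels.Nodup) {v : V} (hv : v ∈ F.labels) :
    betweenness F v = (F.throughPairs v).card := by
  classical
  have hsub : F.throughPairs v ⊆ F.labels.toFinset ×ˢ F.labels.toFinset := by
    rintro ⟨s, t⟩ h
    simp only [throughPairs, Finset.mem_filter, Finset.mem_product, List.mem_toFinset] at h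
    simp only [Finset.mem_product, List.mem_toFinset]
    exact ⟨(F.treeOf_sublist v).subset ((mem_flatten_parts hF hv).1 h.1.1).1,
      (F.treeOf_sublist v).subset ((mem_flatten_parts hF hv).1 h.1.2).1⟩
  rw [betweenness, ← Finset.sum_product', ← Finset.inter_eq_right.2 hsub,
    ← Finset.filter_mem_eq_inter,
    Finset.card_filter]
  push_cast
  refine Finset.sum_congr rfl fun e _ => ?_
  obtain ⟨s, t⟩ := e
  simp only [numShortestThrough_div hF, mem_throughPairs hF hv]
  by_cases h : s ≠ t ∧ s ≠ v ∧ t ≠ v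
  · rw [if_pos h]
    refine if_congr ?_ rfl rfl
    tauto
  · rw [if_neg h, if_neg]
    tauto

theorem reduceChildSubtrees_eq [DecidableEq V] (F : Forest V) (v : V) :
    reduceChildSubtrees bcPlus bcTimes (0, 0) (0, 0) bcVal F v =
      (((F.childSubtrees v).map fun st => (st.length : ℤ)).sum,
        ((F.childSubtrees v).map fun st => (st.length : ℤ) ^ 2).sum) := by
  simp only [reduceChildSubtrees, foldr_bcPlus, foldr_bcTimes]

end Forest

/-! ### From a group of trees to the whole forest -/

section Join

variable {V : Type u}

/-- The query sees only the search tree of the group of `v`; the tree and the child subtrees of `v`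
are the same there as in the whole forest. -/
theorem Forest.exists_mem_join [DecidableEq V] {Fs : List (Forest V)} {v : V}
    (hv : v ∈ (Forest.join Fs).labels) : ∃ F ∈ Fs, v ∈ F.labels ∧
      (Forest.join Fs).treeOf v = F.treeOf v ∧
      (Forest.join Fs).childForest v = F.childForest v := by
  induction Fs with
  | nil => simp [join, labels] at hv
  | cons F Fs ih =>
    have e : join (F :: Fs) = F.append (join Fs) := rfl
    rw [e, labels_append, List.mem_append] at hv
    rw [e, treeOf_append, childForest_append]
    by_cases h : v ∈ F.labels
    · exact ⟨F, by simp, h, if_pos h, if_pos h⟩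
    · obtain ⟨G, hG, h1, h2, h3⟩ := ih (hv.resolve_left h)
      exact ⟨G, by simp [hG], h1, by rw [if_neg h, h2], by rw [if_neg h, h3]⟩

theorem Forest.labels_sublist_join {Fs : List (Forest V)} {F : Forest V} (hF : F ∈ Fs) :
    F.labels.Sublist (Forest.join Fs).labels := by
  induction Fs with
  | nil => simp at hF
  | cons G Fs ih =>
    have e : join (G :: Fs) = G.append (join Fs) := rfl
    rw [e, labels_append]
    rcases List.mem_cons.1 hF with rfl | hF
    · exact List.sublist_append_left _ _
    · exact (ih hF).trans (List.sublist_append_right _ _)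

theorem numNodes_eq_length_inorder (t : BinaryTree (Paren V)) :
    t.numNodes = (inorder t).length := by
  induction t with
  | nil => rfl
  | node x l r ihl ihr =>
    simp only [BinaryTree.numNodes, inorder, List.length_append, List.length_cons, ihl, ihr]
    omega

theorem height_pos_of_inorder_ne_nil {t : BinaryTree (Paren V)} (h : inorder t ≠ []) :
    1 ≤ t.height := by
  cases t with
  | nil => exact absurd rfl h
  | node x l r => simp

theorem IsDFTTree.properlyPlaced {c : ℝ} {m : Memory} {addr : Paren V → ℤ}
    {Fs : List (Forest V)} (h : IsDFTTree c m addr Fs) {F : Forest V} (hF : F ∈ Fs)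
    {t : BinaryTree (Paren V)} (ht : inorder t = F.tour) : ProperlyPlaced m addr t := by
  have hs := Forest.labels_sublist_join hF
  have hsub : ∀ z ∈ F.tour, z ∈ (Forest.join Fs).tour := fun z hz =>
    Forest.mem_tour.2 (hs.subset (Forest.mem_tour.1 hz))
  constructor
  · rw [ht]
    exact (Forest.tour_nodup (h.labels_nodup.sublist hs)).map_on fun x hx y hy =>
      h.addr_injective x (hsub x hx) y (hsub y hy)
  · exact fun z hz => h.addr_ne_null z (hsub z (ht ▸ hz))
  · exact fun z hz => h.tag_eq z (hsub z (ht ▸ hz))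

/-- A tour has two entries per vertex, and `2n + 1 ≤ (n + 1)²`, so the logarithm at most doubles.
The absolute value is there because `c` has no prescribed sign. -/
theorem height_le_log {c : ℝ} {F : Forest V} {n : ℕ} (hn : F.labels.length ≤ n)
    {t : BinaryTree (Paren V)} (ht : inorder t = F.tour)
    (hh : (t.height : ℝ) ≤ c * Real.logb 2 (t.numNodes + 1)) :
    (t.height : ℝ) ≤ |c| * 2 / Real.log 2 * Real.log (n + 1) := by
  have h2 : 0 < Real.log 2 := Real.log_pos (by norm_num)
  have hN : t.numNodes = 2 * F.labels.length := by
    rw [numNodes_eq_length_inorder, ht, Forest.tour_length]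
  have hn' : (F.labels.length : ℝ) ≤ n := by exact_mod_cast hn
  have hl : Real.log (t.numNodes + 1) ≤ 2 * Real.log (n + 1) := by
    rw [hN, ← Real.log_rpow (by positivity)]
    refine Real.log_le_log (by positivity) ?_
    push_cast
    rw [show (2 : ℝ) = ((2 : ℕ) : ℝ) by norm_num, Real.rpow_natCast]
    push_cast
    nlinarith [sq_nonneg (n : ℝ)]
  have h0 : 0 ≤ Real.log (t.numNodes + 1) := Real.log_nonneg (by simp)
  calc (t.height : ℝ) ≤ c * (Real.log (t.numNodes + 1) / Real.log 2) := hh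
    _ ≤ |c| * (Real.log (t.numNodes + 1) / Real.log 2) :=
        mul_le_mul_of_nonneg_right (le_abs_self c) (by positivity)
    _ ≤ |c| * (2 * Real.log (n + 1) / Real.log 2) := by gcongr
    _ = _ := by ring

end Join

theorem query_correct {V : Type u} [DecidableEq V] {c : ℝ} {m : Memory} {addr : Paren V → ℤ}
    {Fs : List (Forest V)} (h : IsDFTTree c m addr Fs) {v : V}
    (hv : v ∈ (Forest.join Fs).labels) {σ : State} (hm : σ.mem = m)
    (h0 : σ.reg 0 = addr (v, true)) :
    ∃ (k : ℕ) (τ : State), Exec query σ k τ ∧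
      (k : ℝ) ≤ 650 * (|c| * 2 / Real.log 2) *
        Real.log ((Forest.join Fs).labels.length + 1) ∧
      τ.mem = m ∧
      (τ.reg 1, τ.reg 2) =
        Forest.reduceChildSubtrees bcPlus bcTimes (0, 0) (0, 0) bcVal (Forest.join Fs) v ∧
      τ.reg 3 = ((Forest.join Fs).above v).ncard ∧
      τ.reg 4 = (pathsThrough (Forest.join Fs) v).ncard ∧
      (τ.reg 5 : ℚ) = betweenness (Forest.join Fs) v := by
  obtain ⟨F, hF, hvF, htree, hchild⟩ := Forest.exists_mem_join hv
  obtain ⟨t, ht, hst, hh⟩ := h.tree F hF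
  have hs := Forest.labels_sublist_join hF
  obtain ⟨L, R, A, B, he, hA, hB, hpd, hpp, hsd, hsp, hlen⟩ :=
    Forest.exists_tour_eq (h.labels_nodup.sublist hs) hvF
  have htw : m (addr (v, true)) .twin = addr (v, false) :=
    h.twin_eq (v, true) (Forest.mem_tour.2 hv)
  obtain ⟨k, τ, hex, hk, hmem, A', B', D, hA', hB', hD, r1, r2, r3, r5, r4⟩ :=
    runs_query hst (h.properlyPlaced hF ht) (ht.trans he) htw hm h0
  obtain rfl := hA'.unique hA
  have hB2 := ((hD.append (IsDigest.single (v, false))).append hB)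
  rw [List.append_assoc, List.singleton_append] at hB2
  obtain rfl := hB'.unique hB2
  obtain rfl := hD.unique (Forest.isDigest_tour _)
  have hpd' := hB.pd_nonpos
  have hpp' := hB.pp_eq_zero
  have e3 : τ.reg 3 = ((Forest.join Fs).above v).ncard := by
    rw [Forest.above_ncard_eq_length h.labels_nodup hv, r3]
    have := Forest.aboveList_length_add h.labels_nodup hv
    rw [htree, hchild] at this
    -- The close-node of `v` goes below the minimum of the tour of the child subtrees, so all of
    -- them fall into the prefix, followed by the prefix of `R`. If `R` has minimum 0, that prefix
    -- is empty and adds nothing.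
    have e : (((⟨0, 0, (F.childForest v).labels.length,
        ((F.childForest v).treeLabels.map fun st => (st.length : ℤ) ^ 2).sum, 0, 0⟩ :
        Digest).comb (Digest.single (tag (v, false)))).comb B).pp =
        (F.childForest v).labels.length + B.pp := by
      rcases hpd'.lt_or_eq with hlt | h0
      · simp [Digest.comb, Digest.single, tag, hlt]
      · simp [Digest.comb, Digest.single, tag, h0, hpp' h0]
    rw [e]
    simp only
    omega
  have e12 : (τ.reg 1, τ.reg 2) =
      Forest.reduceChildSubtrees bcPlus bcTimes (0, 0) (0, 0) bcVal (Forest.join Fs) v := by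
    rw [Forest.reduceChildSubtrees_eq, Forest.childSubtrees, hchild, r1, r2,
      Forest.labels_eq_flatten, List.length_flatten]
    push_cast
    rw [List.map_map]
    rfl
  have e5 : τ.reg 5 = ((Forest.join Fs).throughPairs v).card := by
    rw [Forest.reduceChildSubtrees_eq, Prod.mk.injEq] at e12
    rw [Forest.card_throughPairs h.labels_nodup hv, r5, e12.1, e12.2, e3]
  refine ⟨k, τ, hex, ?_, hmem, e12, e3, ?_, ?_⟩
  · have h1 : 1 ≤ t.height := height_pos_of_inorder_ne_nil (by rw [ht, he]; simp)
    have h2 := height_le_log hs.length_le ht hh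
    -- The search tree is not empty, so its height absorbs the additive constant 250.
    have h3 : (k : ℝ) ≤ 650 * t.height := by
      have : k ≤ 650 * t.height := by omega
      exact_mod_cast this
    calc (k : ℝ) ≤ 650 * t.height := h3
      _ ≤ 650 * (|c| * 2 / Real.log 2 * Real.log ((Forest.join Fs).labels.length + 1)) := by
          gcongr
      _ = _ := by ring
  -- Register 5 holds twice the number of unordered pairs, so the halving is exact.
  · rw [r4, e5, ← Forest.two_mul_ncard_pathsThrough h.labels_nodup hv]
    push_cast
    omega
  · rw [e5, Forest.betweenness_eq_card h.labels_nodup hv]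
    norm_cast

end DFTree

theorem mainTheorem2 :
    -- the pair computed by `reduceChildSubtrees`, and the count of the paths through `v`
    (∀ (V : Type u) [DecidableEq V] (F : Forest V) (v : V), F.labels.Nodup → v ∈ F.labels →
      Forest.reduceChildSubtrees bcPlus bcTimes (0, 0) (0, 0) bcVal F v =
        (((F.childSubtrees v).map fun st => (st.length : ℤ)).sum,
          ((F.childSubtrees v).map fun st => (st.length : ℤ) ^ 2).sum) ∧
      2 * ((pathsThrough F v).ncard : ℤ) =
        2 * ((F.above v).ncard *
            (Forest.reduceChildSubtrees bcPlus bcTimes (0, 0) (0, 0) bcVal F v).1) +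
          ((Forest.reduceChildSubtrees bcPlus bcTimes (0, 0) (0, 0) bcVal F v).1 ^ 2 -
            (Forest.reduceChildSubtrees bcPlus bcTimes (0, 0) (0, 0) bcVal F v).2) ∧
      betweenness F v = 2 * ((pathsThrough F v).ncard : ℚ)) ∧
    -- the query, in time `O(log n)`
    (∃ query : Program, ∀ c : ℝ, ∃ C : ℝ,
      ∀ (V : Type u) [DecidableEq V] (m : Memory) (addr : Paren V → ℤ) (Fs : List (Forest V)),
        IsDFTTree c m addr Fs → ∀ v ∈ (Forest.join Fs).labels,
        ∀ σ : State, σ.mem = m → σ.reg 0 = addr (v, true) →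
          ∃ (k : ℕ) (τ : State), Exec query σ k τ ∧
            (k : ℝ) ≤ C * Real.log ((Forest.join Fs).labels.length + 1) ∧
            τ.mem = m ∧
            (τ.reg 1, τ.reg 2) =
              Forest.reduceChildSubtrees bcPlus bcTimes (0, 0) (0, 0) bcVal (Forest.join Fs) v ∧
            τ.reg 3 = ((Forest.join Fs).above v).ncard ∧
            τ.reg 4 = (pathsThrough (Forest.join Fs) v).ncard ∧
            (τ.reg 5 : ℚ) = betweenness (Forest.join Fs) v) ∧
    -- the summaries are maintained locally, in constant time per record
    (∃ (recalc : Program) (K : ℕ),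
      ∀ (V : Type u) (m : Memory) (addr : Paren V → ℤ) (x : Paren V)
        (l r : BinaryTree (Paren V)),
        (∀ y ∈ inorder (.node x l r), addr y ≠ 0) →
        m (addr x) .tag = tag x →
        m (addr x) .left = pointer addr l → m (addr x) .right = pointer addr r →
        RootSummary m addr l → RootSummary m addr r →
        ∀ σ : State, σ.mem = m → σ.reg 0 = addr x →
          ∃ (k : ℕ) (τ : State), Exec recalc σ k τ ∧ k ≤ K ∧
            RootSummary τ.mem addr (.node x l r) ∧
            ∀ (a : ℤ) (f : NodeField), ¬ (a = addr x ∧ f.IsSummary) → τ.mem a f = m a f) := by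
  refine ⟨fun V _ F v hF hv => ⟨F.reduceChildSubtrees_eq v, ?_, ?_⟩,
    ⟨query, fun c => ⟨650 * (|c| * 2 / Real.log 2), ?_⟩⟩,
    recalculate, 82, ?_⟩
  · rw [F.reduceChildSubtrees_eq v, ← Forest.card_throughPairs hF hv,
      ← Forest.two_mul_ncard_pathsThrough hF hv]
    push_cast
    rfl
  · rw [Forest.betweenness_eq_card hF hv, ← Forest.two_mul_ncard_pathsThrough hF hv]
    push_cast
    rfl
  · exact fun V _ m addr Fs h v hv σ hm h0 => query_correct h hv hm h0
  · intro V m addr x l r h0 ht hl hr hsl hsr σ hm ha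
    obtain ⟨k, τ, h1, h2, h3, h4⟩ := recalculate_correct m addr x l r h0 ht hl hr hsl hsr σ hm ha
    exact ⟨k, τ, h1, h2, h3, h4⟩
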